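/- **Theorem 3 (Regret of FD-UCB).** Let $G$ models with generative distributions $p_1,\dots,p_G$ and an embedding $f$ into $\mathbb{R}^d$ be given, such that for every $g$ the embedding of a sample $X_g\sim p_g$ is Gaussian, $f(X_g)\sim\mathcal N(\mu_g,\Sigma_g)$; let $\mu_r\in\mathbb{R}^d$ and let $\Sigma_r\in\mathbb{R}^{d\times d}$ be positive definite (mean and covariance of the embedded real data). Put $$\mathrm{FD}_g=\|\mu_g-\mu_r\|_2^2+\mathrm{Tr}\big[\Sigma_g+\Sigma_r-2(\Sigma_g\Sigma_r)^{1/2}\big],\qquad \mathrm{FD}^*=\min_g\mathrm{FD}_g,\qquad \Delta_{\max}=\max_g(\mathrm{FD}_g-\mathrm{FD}^*),$$ and $\mathbf r(\Sigma)=\mathrm{Tr}[\Sigma]/\|\Sigma\|_2$ (read as $0$ if $\Sigma=0$). Let $\kappa>0$ be a constant with $\|y^\top(f(X_g)-\mu_g)\|_{\psi_2}\le\kappa\sqrt{y^\top\Sigma_g y}$ for all $g$ and $y$, where $\|Z\|_{\psi_2}=\inf\{t>0:\mathbb E[e^{Z^2/t^2}]\le 2\}$. For $n$ i.i.d. samples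 $x^1,\dots,x^n$ of model $g$ let $\widehat\mu_g^n=\frac1n\sum_i f(x^i)$, $\widehat\Sigma_g^n=\frac1n\sum_i(f(x^i)-\widehat\mu_g^n)(f(x^i)-\widehat\mu_g^n)^\top$, let $\widetilde{\mathrm{FD}}{}_g^n$ be $\mathrm{FD}_g$ with $\widehat\mu_g^n,\widehat\Sigma_g^n$ in place of $\mu_g,\Sigma_g$, and for $\eta\in(0,1)$ let $$\Delta_{\mu_g}^n=\sqrt{\tfrac1n\Big(\sqrt{8\,\mathrm{Tr}[\Sigma_g^2]\log\tfrac6\eta}+8\|\Sigma_g\|_2\log\tfrac6\eta\Big)},\qquad \Delta_{\Sigma_g}^n=20\kappa^2\|\Sigma_g\|_2\sqrt{\tfrac{4\mathbf r(\Sigma_g)+\log(3/\eta)}{n}}+(\Delta_{\mu_g}^n)^2,$$ $$\mathcal B_g^n=2\Delta_{\mu_g}^n\big(\Delta_{\mu_g}^n+\|\widehat\mu_g^n-\mu_r\|_2\big)+\mathrm{Tr}[\Sigma_r^{1/2}]\sqrt{8\Delta_{\Sigma_g}^n}+\mathrm{Tr}[\Sigma_g]\sqrt{\tfrac8n\log\tfrac6\eta}+\tfrac{8\|\Sigma_g\|_2}{n}\log\tfrac6\eta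 .$$ The algorithm FD-UCB with failure probability $\delta\in(0,1)$, batch size $b\ge1$ and $T\ge1$ steps uses $\eta=\delta/T$. It first generates $N\ge\max_g\{4\mathbf r(\Sigma_g)+\log(3T/\delta)\}$ burn-in samples from every model. At each step $t=1,\dots,T$ it picks a model $g_t$ with the smallest current score (ties broken arbitrarily) and then generates $b$ new samples from $g_t$. The score of $g$ is $\widetilde{\mathrm{FD}}{}_g^{n_g}-\mathcal B_g^{n_g}$, computed from all $n_g$ samples of $g$ generated so far; before the first pick of $g$ it is either computed in the same way from the burn-in samples or equal to $-\infty$ (the result holds for both variants). The regret, including the burn-in samples, is $$\mathrm{Regret}(T)=N\sum_{g=1}^G(\mathrm{FD}_g-\mathrm{FD}^*)+\sum_{t=1}^T(\mathrm{FD}_{g_t}-\mathrm{FD}^*).$$ Then with probability at least $1-\delta$ $$\mathrm{Regret}(T)\le\widetilde O\Big(\frac{D_1G^{1/4}}{b^{1/4}}T^{3/4}+\frac{D_2G^{1/2}}{b^{1/2}}T^{1/2}+\frac{D_3G}{b}\log T+\Delta_{\max}\,N\,G\Big),$$ where $$D_1=\max_g\Big\{\mathrm{Tr}[\Sigma_r^{1/2}]\big(\|\Sigma_g\|_2^2(\mathbf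 r(\Sigma_g)+1)\big)^{1/4}\Big\},\qquad D_3=\max_g\Big\{\sqrt{\mathrm{Tr}[\Sigma_g^2]}+\|\Sigma_g\|_2\Big\},$$ $$D_2=\max_g\Big\{\big(\|\mu_g-\mu_r\|_2+\mathrm{Tr}[\Sigma_r^{1/2}]\big)\big(\sqrt{\mathrm{Tr}[\Sigma_g^2]}+\|\Sigma_g\|_2\big)^{1/2}+\mathrm{Tr}[\Sigma_g]\Big\}.$$ Here $\widetilde O(A)$ stands for $C\,\log(6GT/\delta)^q\,A$ with constants $C>0$ and $q\in\mathbb N$ that depend on $\kappa$ only. -/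

import Mathlib

open MeasureTheory ProbabilityTheory
open scoped ENNReal MatrixOrder

noncomputable section

/-- The embedding space `ℝ^d` with the Euclidean norm. -/
abbrev Emb (d : ℕ) : Type := EuclideanSpace ℝ (Fin d)

/-! ### Matrices -/

/-- The spectral norm `‖A‖₂` (operator norm for the Euclidean norm). -/
def specNorm {d : ℕ} (A : Matrix (Fin d) (Fin d) ℝ) : ℝ :=
  ‖Matrix.toEuclideanCLM (𝕜 := ℝ) A‖

/-- The effective rank `Tr A / ‖A‖₂` (it is `0` for `A = 0`). -/
def effRank {d : ℕ} (A : Matrix (Fin d) (Fin d) ℝ) : ℝ :=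
  A.trace / specNorm A

/-- The principal square root `(A B)^{1/2}` of the product of a positive semidefinite matrix `A`
and a positive definite matrix `B`. Since `A B = B^{-1/2} (B^{1/2} A B^{1/2}) B^{1/2}` is similar
to a positive semidefinite matrix, its square root with nonnegative eigenvalues is
`B^{-1/2} (B^{1/2} A B^{1/2})^{1/2} B^{1/2}`. -/
def prodSqrt {d : ℕ} (A B : Matrix (Fin d) (Fin d) ℝ) : Matrix (Fin d) (Fin d) ℝ :=
  (CFC.sqrt B)⁻¹ * CFC.sqrt (CFC.sqrt B * A * CFC.sqrt B) * CFC.sqrt B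

theorem prodSqrt_mul_self {d : ℕ} {A B : Matrix (Fin d) (Fin d) ℝ}
    (hA : A.PosSemidef) (hB : B.PosDef) : prodSqrt A B * prodSqrt A B = A * B := by
  have hBB : CFC.sqrt B * CFC.sqrt B = B :=
    CFC.sqrt_mul_sqrt_self B hB.posSemidef.nonneg
  have hu : IsUnit (CFC.sqrt B).det := by
    have h1 : IsUnit (CFC.sqrt B * CFC.sqrt B).det := by
      rw [hBB]; exact (Matrix.isUnit_iff_isUnit_det _).1 hB.isUnit
    rw [Matrix.det_mul] at h1
    exact isUnit_of_mul_isUnit_left h1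
  have hs : (CFC.sqrt B).IsHermitian :=
    (Matrix.nonneg_iff_posSemidef.1 (CFC.sqrt_nonneg B)).1
  have hM : (CFC.sqrt B * A * CFC.sqrt B).PosSemidef := by
    have := hA.conjTranspose_mul_mul_same (CFC.sqrt B)
    rwa [hs.eq] at this
  have hMM := CFC.sqrt_mul_sqrt_self _ hM.nonneg
  unfold prodSqrt
  set R := CFC.sqrt B with hR
  set Q := CFC.sqrt (R * A * R) with hQ
  calc R⁻¹ * Q * R * (R⁻¹ * Q * R) = R⁻¹ * Q * (R * R⁻¹) * Q * R := by
        simp only [mul_assoc]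
    _ = R⁻¹ * (Q * Q) * R := by rw [Matrix.mul_nonsing_inv _ hu]; simp only [mul_assoc, one_mul]
    _ = (R⁻¹ * R) * A * (R * R) := by rw [hMM]; simp only [mul_assoc]
    _ = A * B := by rw [Matrix.nonsing_inv_mul _ hu, hBB, one_mul]

/-! ### The Fréchet distance and its empirical version -/

/-- The Fréchet distance between distributions with means `m`, `mr` and covariance matrices
`S`, `Sr`. -/
def frechetDist {d : ℕ} (m mr : Emb d) (S Sr : Matrix (Fin d) (Fin d) ℝ) : ℝ :=
  ‖m - mr‖ ^ 2 + (S + Sr - (2 : ℝ) • prodSqrt S Sr).trace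

/-- The empirical mean of the first `n` elements of a stream `x`. -/
def empMean {d : ℕ} (x : ℕ → Emb d) (n : ℕ) : Emb d :=
  (n : ℝ)⁻¹ • ∑ i ∈ Finset.range n, x i

/-- The empirical covariance matrix of the first `n` elements of a stream `x`. -/
def empCov {d : ℕ} (x : ℕ → Emb d) (n : ℕ) : Matrix (Fin d) (Fin d) ℝ :=
  (n : ℝ)⁻¹ • ∑ i ∈ Finset.range n,
    Matrix.vecMulVec (fun k => (x i - empMean x n) k) (fun k => (x i - empMean x n) k)

/-- The empirical Fréchet distance computed from the first `n` elements of `x`. -/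
def empFrechetDist {d : ℕ} (x : ℕ → Emb d) (n : ℕ) (mr : Emb d)
    (Sr : Matrix (Fin d) (Fin d) ℝ) : ℝ :=
  frechetDist (empMean x n) mr (empCov x n) Sr

/-! ### The bonus and the optimistic score -/

/-- The error level `Δ_μ` for the mean, for `n` samples, covariance `S` and confidence `δ`. -/
def meanErr {d : ℕ} (S : Matrix (Fin d) (Fin d) ℝ) (δ : ℝ) (n : ℕ) : ℝ :=
  √(1 / n * (√(8 * (S ^ 2).trace * Real.log (6 / δ)) + 8 * specNorm S * Real.log (6 / δ)))

/-- The error level `Δ_Σ` for the covariance matrix. -/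
def covErr {d : ℕ} (κ : ℝ) (S : Matrix (Fin d) (Fin d) ℝ) (δ : ℝ) (n : ℕ) : ℝ :=
  20 * κ ^ 2 * specNorm S * √((4 * effRank S + Real.log (3 / δ)) / n) + meanErr S δ n ^ 2

/-- The bonus of a model with covariance `S`, at confidence `δ`, from the first `n` elements of
its stream of embeddings `x`. -/
def bonus {d : ℕ} (κ : ℝ) (mr : Emb d) (S Sr : Matrix (Fin d) (Fin d) ℝ) (δ : ℝ)
    (x : ℕ → Emb d) (n : ℕ) : ℝ :=
  2 * meanErr S δ n * (meanErr S δ n + ‖empMean x n - mr‖)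
    + (CFC.sqrt Sr).trace * √(8 * covErr κ S δ n)
    + S.trace * √(8 / n * Real.log (6 / δ))
    + 8 * specNorm S / n * Real.log (6 / δ)

/-- The optimistic score: empirical Fréchet distance minus bonus. -/
def optimisticFD {d : ℕ} (κ : ℝ) (mr : Emb d) (S Sr : Matrix (Fin d) (Fin d) ℝ) (δ : ℝ)
    (x : ℕ → Emb d) (n : ℕ) : ℝ :=
  empFrechetDist x n mr Sr - bonus κ mr S Sr δ x n

/-- The sub-Gaussian norm `inf {t > 0 : E[exp(Z²/t²)] ≤ 2}`, with value `∞` if there is no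
such `t`. -/
def psi2Norm {Ω : Type*} [MeasurableSpace Ω] (Z : Ω → ℝ) (P : Measure Ω) : ℝ≥0∞ :=
  ⨅ (t : ℝ) (_ : 0 < t) (_ : ∫⁻ ω, ENNReal.ofReal (Real.exp (Z ω ^ 2 / t ^ 2)) ∂P ≤ 2),
    ENNReal.ofReal t

/-! ### The FD-UCB algorithm -/

/-- The number of times model `g` is picked in the steps `0, …, t - 1`. -/
def numPicks {G : ℕ} (pick : ℕ → Fin G) (t : ℕ) (g : Fin G) : ℕ :=
  ((Finset.range t).filter fun s => pick s = g).card

/-- The number of samples generated by model `g` before step `t`: `N` burn-in samples and a batch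
of `b` samples for each earlier pick. -/
def numSamples {G : ℕ} (N b : ℕ) (pick : ℕ → Fin G) (t : ℕ) (g : Fin G) : ℕ :=
  N + b * numPicks pick t g

/-- The score of model `g` held by FD-UCB at the beginning of step `t`, where `x g i` is the
embedding of the `i`-th sample generated by model `g` and `δ` is the confidence passed to the
bonus. Before the first pick of `g`, the score is computed from the burn-in samples if
`evalBurnIn = true`, and is still at its initial value `-∞` if `evalBurnIn = false`. -/
def fducbScore {d G : ℕ} (evalBurnIn : Bool) (κ : ℝ) (mr : Emb d)
    (S : Fin G → Matrix (Fin d) (Fin d) ℝ) (Sr : Matrix (Fin d) (Fin d) ℝ) (δ : ℝ) (N b : ℕ)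
    (x : Fin G → ℕ → Emb d) (pick : ℕ → Fin G) (t : ℕ) (g : Fin G) : EReal :=
  if evalBurnIn = false ∧ numPicks pick t g = 0 then ⊥
  else ((optimisticFD κ mr (S g) Sr δ (x g) (numSamples N b pick t g) : ℝ) : EReal)

/-- `pick 0, …, pick (T - 1)` are the models picked by a run of FD-UCB for `T` steps with failure
probability `δ` (so that the bonus is used with confidence `δ / T`) on the streams `x`: at each
step the picked model minimizes the current score. Ties may be broken in any way. -/
def IsFDUCBRun {d G : ℕ} (evalBurnIn : Bool) (κ : ℝ) (mr : Emb d)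
    (S : Fin G → Matrix (Fin d) (Fin d) ℝ) (Sr : Matrix (Fin d) (Fin d) ℝ) (δ : ℝ) (T N b : ℕ)
    (x : Fin G → ℕ → Emb d) (pick : ℕ → Fin G) : Prop :=
  ∀ t < T, ∀ g : Fin G,
    fducbScore evalBurnIn κ mr S Sr (δ / T) N b x pick t (pick t)
      ≤ fducbScore evalBurnIn κ mr S Sr (δ / T) N b x pick t g

/-! ### Regret and problem constants -/

/-- The gap `FD_g - min_{g'} FD_{g'}` of a model, for the scores `ν`. -/
def fdGap {G : ℕ} (ν : Fin G → ℝ) (g : Fin G) : ℝ := ν g - ⨅ g', ν g'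

/-- The regret after `T` steps, including the cost of the `N` burn-in samples of each model. -/
def totalRegret {G : ℕ} (ν : Fin G → ℝ) (N T : ℕ) (pick : ℕ → Fin G) : ℝ :=
  N * ∑ g, fdGap ν g + ∑ t ∈ Finset.range T, fdGap ν (pick t)

def constD1 {d G : ℕ} (S : Fin G → Matrix (Fin d) (Fin d) ℝ)
    (Sr : Matrix (Fin d) (Fin d) ℝ) : ℝ :=
  ⨆ g, (CFC.sqrt Sr).trace * (specNorm (S g) ^ 2 * (effRank (S g) + 1)) ^ (1 / 4 : ℝ)

def constD2 {d G : ℕ} (m : Fin G → Emb d) (mr : Emb d) (S : Fin G → Matrix (Fin d) (Fin d) ℝ)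
    (Sr : Matrix (Fin d) (Fin d) ℝ) : ℝ :=
  ⨆ g, ((‖m g - mr‖ + (CFC.sqrt Sr).trace)
      * (√((S g ^ 2).trace) + specNorm (S g)) ^ (1 / 2 : ℝ) + (S g).trace)

def constD3 {d G : ℕ} (S : Fin G → Matrix (Fin d) (Fin d) ℝ) : ℝ :=
  ⨆ g, (√((S g ^ 2).trace) + specNorm (S g))

end

/-! The score is an optimistic estimate of the Fréchet distance, and the regret is controlled by the
errors of the scores of the picked models. Let `gs` attain the minimum FD*. If the score of `gs`
never exceeds FD*, a model picked before has score at most FD*, so its gap is at most FD minus score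
(`fdGap_pick_le`). After `k` earlier picks this error is at most `errorRate`, with terms of order
(bk)^(-1/4), (bk)^(-1/2) and (bk)^(-1) (`errorRate_le`). The harmonic sum and Cauchy–Schwarz turn
these into T^(3/4), T^(1/2) and log T (`sum_gap_le`). Each model's first pick costs at most Δ_max,
which the burn-in term absorbs.

Every sample count that occurs is `N + b * k` with `k < T`, so a union bound over these
deterministic counts deals with the adaptivity of the run. Optimism is needed only for `gs`, which
is why confidence δ/T suffices in the bonus: it fails with probability at most 2δ/(3T) per count.
The error bound is needed for all G models, but its deviation level occurs only in the analysis and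
may contain G: it fails with probability at most δ/(3GT) per model and count.

Put R = Σ_r^(1/2) and F(A) = Tr (R A R)^(1/2), which is `traceSqrtConj R A`. By `empFrechetDist_sub`
the error of the empirical distance consists of an inner product with the mean error, a trace
fluctuation, and -2(F(Σ̂) - F(Σ)). The two directions are treated differently.

Optimism (`optimisticFD_le_frechetDist`) needs F(Σ) ≤ F(Σ̂) + small. This follows from Σ ≤ Σ̂ + ε I
at the price √ε Tr R (`traceSqrtConj_le_add`), so only a lower bound on the sample covariance is
needed, uniformly over directions and governed by the effective rank. It comes from the Gaussian
PAC-Bayes argument in `quadForm_sub_le_of_lintegral_exp_le` and `measure_quadForm_lower`.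

The error bound (`frechetDist_sub_optimisticFD_le`) needs F(Σ̂) ≤ F(Σ) + small. There F is bounded
by a regularized tangent at Σ, which is linear in the matrix, so a single scalar chi-square
fluctuation of order n^(-1/2) remains. The rate n^(-1/4) therefore stems from the bonus alone.

The sub-Gaussian constant enters only through κ ≥ 1, which the hypothesis forces for a nonzero
covariance (`one_le_of_psi2Norm_le`). The deviations themselves come from explicit Gaussian
exponential moments. -/

/-! ### Quadratic forms, spectral bounds and trace inequalities for matrix square roots. -/

section LinearAlgebra

open Matrix

variable {d : ℕ}

/-- The quadratic form `v ↦ ⟨v, A v⟩` of a matrix. -/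
noncomputable def quadForm (A : Matrix (Fin d) (Fin d) ℝ) (v : Emb d) : ℝ :=
  inner ℝ v (Matrix.toEuclideanCLM (𝕜 := ℝ) A v)

theorem quadForm_eq_dotProduct (A : Matrix (Fin d) (Fin d) ℝ) (v : Emb d) :
    quadForm A v = v.ofLp ⬝ᵥ A *ᵥ v.ofLp := by
  rw [quadForm, inner_toEuclideanCLM]

theorem quadForm_add (A B : Matrix (Fin d) (Fin d) ℝ) (v : Emb d) :
    quadForm (A + B) v = quadForm A v + quadForm B v := by
  simp [quadForm, inner_add_right]

theorem quadForm_sub (A B : Matrix (Fin d) (Fin d) ℝ) (v : Emb d) :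
    quadForm (A - B) v = quadForm A v - quadForm B v := by
  simp [quadForm, inner_sub_right]

theorem quadForm_smul (c : ℝ) (A : Matrix (Fin d) (Fin d) ℝ) (v : Emb d) :
    quadForm (c • A) v = c * quadForm A v := by
  simp [quadForm, inner_smul_right]

theorem quadForm_sum {ι : Type*} (s : Finset ι) (A : ι → Matrix (Fin d) (Fin d) ℝ) (v : Emb d) :
    quadForm (∑ i ∈ s, A i) v = ∑ i ∈ s, quadForm (A i) v := by
  simp [quadForm, inner_sum]

theorem quadForm_one (v : Emb d) : quadForm 1 v = ‖v‖ ^ 2 := by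
  simp [quadForm]

theorem quadForm_smul_right (A : Matrix (Fin d) (Fin d) ℝ) (c : ℝ) (v : Emb d) :
    quadForm A (c • v) = c ^ 2 * quadForm A v := by
  simp [quadForm, inner_smul_right, inner_smul_left]; ring

theorem quadForm_vecMulVec (u v : Emb d) :
    quadForm (vecMulVec (fun k => u k) (fun k => u k)) v = inner ℝ u v ^ 2 := by
  rw [quadForm_eq_dotProduct, PiLp.inner_apply, vecMulVec_mulVec]
  simp only [dotProduct, Pi.smul_apply, MulOpposite.smul_eq_mul_unop, MulOpposite.unop_op,
    RCLike.inner_apply, conj_trivial]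
  rw [sq, Finset.sum_mul]
  refine Finset.sum_congr rfl fun i _ => ?_
  rw [Finset.sum_congr rfl fun i _ => mul_comm (u i) (v i)]
  ring

theorem quadForm_nonneg {A : Matrix (Fin d) (Fin d) ℝ} (hA : A.PosSemidef) (v : Emb d) :
    0 ≤ quadForm A v := by
  rw [quadForm_eq_dotProduct]
  simpa using hA.dotProduct_mulVec_nonneg v.ofLp

theorem posSemidef_of_quadForm_nonneg {A : Matrix (Fin d) (Fin d) ℝ} (hA : A.IsHermitian)
    (h : ∀ v : Emb d, 0 ≤ quadForm A v) : A.PosSemidef := by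
  refine PosSemidef.of_dotProduct_mulVec_nonneg hA fun x => ?_
  have := h (WithLp.toLp 2 x)
  rw [quadForm_eq_dotProduct] at this
  simpa using this

theorem specNorm_nonneg (A : Matrix (Fin d) (Fin d) ℝ) : 0 ≤ specNorm A := norm_nonneg _

theorem quadForm_le_specNorm (A : Matrix (Fin d) (Fin d) ℝ) (v : Emb d) :
    quadForm A v ≤ specNorm A * ‖v‖ ^ 2 := by
  calc quadForm A v ≤ ‖v‖ * ‖Matrix.toEuclideanCLM (𝕜 := ℝ) A v‖ := real_inner_le_norm _ _
    _ ≤ ‖v‖ * (specNorm A * ‖v‖) := by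
        gcongr; exact ContinuousLinearMap.le_opNorm _ _
    _ = specNorm A * ‖v‖ ^ 2 := by ring

theorem quadForm_eigenvectorBasis {A : Matrix (Fin d) (Fin d) ℝ} (hA : A.IsHermitian)
    (x : Fin d → ℝ) :
    quadForm A (∑ i, x i • hA.eigenvectorBasis i) = ∑ i, hA.eigenvalues i * x i ^ 2 := by
  have h1 : ∀ i, Matrix.toEuclideanCLM (𝕜 := ℝ) A (hA.eigenvectorBasis i)
      = hA.eigenvalues i • hA.eigenvectorBasis i := by
    intro i
    apply (WithLp.ofLp_injective 2)
    rw [Matrix.ofLp_toEuclideanCLM, hA.mulVec_eigenvectorBasis]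
    simp
  rw [quadForm, map_sum]
  simp only [map_smul, h1, sum_inner, inner_sum, inner_smul_left, inner_smul_right,
    OrthonormalBasis.inner_eq_ite]
  simp
  refine Finset.sum_congr rfl fun i _ => by ring

theorem eigenvalues_le_specNorm {A : Matrix (Fin d) (Fin d) ℝ} (hA : A.IsHermitian) (i : Fin d) :
    hA.eigenvalues i ≤ specNorm A := by
  have h := quadForm_eigenvectorBasis hA (Pi.single i 1)
  have h2 := quadForm_le_specNorm A (∑ j, (Pi.single i 1 : Fin d → ℝ) j • hA.eigenvectorBasis j)
  rw [h] at h2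
  have h3 : ∑ j, (Pi.single i 1 : Fin d → ℝ) j • hA.eigenvectorBasis j = hA.eigenvectorBasis i := by
    simp [Pi.single_apply]
  rw [h3] at h2
  simpa [Pi.single_apply] using h2

theorem trace_eq_sum_eigenvalues_real {A : Matrix (Fin d) (Fin d) ℝ} (hA : A.IsHermitian) :
    A.trace = ∑ i, hA.eigenvalues i := by
  simpa using hA.trace_eq_sum_eigenvalues

theorem trace_sq_eq_sum_eigenvalues {A : Matrix (Fin d) (Fin d) ℝ} (hA : A.IsHermitian) :
    (A ^ 2).trace = ∑ i, hA.eigenvalues i ^ 2 := by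
  set U := (hA.eigenvectorUnitary : Matrix (Fin d) (Fin d) ℝ) with hU
  have hUU : star U * U = 1 := Unitary.coe_star_mul_self hA.eigenvectorUnitary
  have h : A = U * diagonal hA.eigenvalues * star U := by
    conv_lhs => rw [hA.spectral_theorem, Unitary.conjStarAlgAut_apply]
    rfl
  have h2 : A ^ 2 = U * (diagonal hA.eigenvalues * diagonal hA.eigenvalues) * star U := by
    conv_lhs => rw [sq, h]
    calc _ = U * diagonal hA.eigenvalues * (star U * U) * diagonal hA.eigenvalues * star U := by
          simp only [mul_assoc]
      _ = _ := by rw [hUU]; simp only [mul_assoc, one_mul]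
  rw [h2, trace_mul_comm, ← mul_assoc, hUU, one_mul, diagonal_mul_diagonal, trace_diagonal]
  simp [sq]

theorem specNorm_le_trace {A : Matrix (Fin d) (Fin d) ℝ} (hA : A.PosSemidef) :
    specNorm A ≤ A.trace := by
  have hl : ∀ i, 0 ≤ hA.1.eigenvalues i := hA.eigenvalues_nonneg
  refine ContinuousLinearMap.opNorm_le_bound _ hA.trace_nonneg fun v => ?_
  have h1 : ∀ i, Matrix.toEuclideanCLM (𝕜 := ℝ) A (hA.1.eigenvectorBasis i)
      = hA.1.eigenvalues i • hA.1.eigenvectorBasis i := by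
    intro i
    apply (WithLp.ofLp_injective 2)
    rw [Matrix.ofLp_toEuclideanCLM, hA.1.mulVec_eigenvectorBasis]
    simp
  conv_lhs => rw [← hA.1.eigenvectorBasis.sum_repr v, map_sum]
  rw [trace_eq_sum_eigenvalues_real hA.1, Finset.sum_mul]
  refine (norm_sum_le _ _).trans (Finset.sum_le_sum fun i _ => ?_)
  rw [map_smul, h1, norm_smul, norm_smul, hA.1.eigenvectorBasis.norm_eq_one, mul_one,
    OrthonormalBasis.repr_apply_apply, mul_comm, Real.norm_eq_abs, Real.norm_eq_abs,
    abs_of_nonneg (hl i)]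
  refine mul_le_mul_of_nonneg_left ?_ (hl i)
  simpa using abs_real_inner_le_norm (hA.1.eigenvectorBasis i) v

theorem trace_sq_nonneg {A : Matrix (Fin d) (Fin d) ℝ} (hA : A.PosSemidef) :
    0 ≤ (A ^ 2).trace := by
  rw [trace_sq_eq_sum_eigenvalues hA.1]
  exact Finset.sum_nonneg fun i _ => sq_nonneg _

theorem trace_sq_le {A : Matrix (Fin d) (Fin d) ℝ} (hA : A.PosSemidef) :
    (A ^ 2).trace ≤ A.trace ^ 2 := by
  rw [trace_sq_eq_sum_eigenvalues hA.1, trace_eq_sum_eigenvalues_real hA.1]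
  exact Finset.sum_sq_le_sq_sum_of_nonneg fun i _ => hA.eigenvalues_nonneg i

/-! ### Trace inequalities for the square root -/

theorem CFC_sqrt_posSemidef (A : Matrix (Fin d) (Fin d) ℝ) : (CFC.sqrt A).PosSemidef :=
  Matrix.nonneg_iff_posSemidef.1 (CFC.sqrt_nonneg A)

theorem PosSemidef.conj_self {A R : Matrix (Fin d) (Fin d) ℝ} (hA : A.PosSemidef)
    (hR : R.IsHermitian) : (R * A * R).PosSemidef := by
  have := hA.conjTranspose_mul_mul_same R
  rwa [hR.eq] at this

theorem CFC_sqrt_posDef {A : Matrix (Fin d) (Fin d) ℝ} (hA : A.PosDef) :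
    (CFC.sqrt A).PosDef := by
  have h : CFC.sqrt A * CFC.sqrt A = A := CFC.sqrt_mul_sqrt_self A hA.posSemidef.nonneg
  refine (CFC_sqrt_posSemidef A).posDef_iff_isUnit.2 ?_
  have h1 : IsUnit (CFC.sqrt A * CFC.sqrt A) := by rw [h]; exact hA.isUnit
  rw [Matrix.isUnit_iff_isUnit_det] at h1 ⊢
  rw [Matrix.det_mul] at h1
  exact isUnit_of_mul_isUnit_left h1

/-- Expand the trace of the positive semidefinite matrix (Q - Z) Z⁻¹ (Q - Z) with Q = M^(1/2). This
is the matrix form of 2q ≤ q²/z + z; for fixed `Z` the bound is affine in `M`. -/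
theorem trace_sqrt_le {M Z : Matrix (Fin d) (Fin d) ℝ} (hM : M.PosSemidef) (hZ : Z.PosDef) :
    2 * (CFC.sqrt M).trace ≤ (M * Z⁻¹).trace + Z.trace := by
  set Q := CFC.sqrt M
  have hQ : Q.PosSemidef := CFC_sqrt_posSemidef M
  have hQQ : Q * Q = M := CFC.sqrt_mul_sqrt_self M hM.nonneg
  have hu : IsUnit Z.det := (Matrix.isUnit_iff_isUnit_det _).1 hZ.isUnit
  have hp : ((Q - Z) * Z⁻¹ * (Q - Z)).PosSemidef :=
    PosSemidef.conj_self hZ.inv.posSemidef (hQ.1.sub hZ.1)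
  have he : (Q - Z) * Z⁻¹ * (Q - Z) = Q * Z⁻¹ * Q - Q - Q + Z := by
    rw [sub_mul, Matrix.mul_nonsing_inv _ hu, sub_mul, mul_sub, one_mul, mul_assoc Q _ Z,
      Matrix.nonsing_inv_mul _ hu]
    noncomm_ring
  have ht := hp.trace_nonneg
  rw [he] at ht
  have h3 : (Q * Z⁻¹ * Q).trace = (M * Z⁻¹).trace := by
    rw [trace_mul_comm, ← mul_assoc, hQQ]
  simp only [trace_add, trace_sub, h3] at ht
  linarith

/-- With Z = X + Y, the matrix X - X Z⁻¹ X is a sum of two congruences, one of X and one of Y, so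
its trace is nonnegative. This is the noncommutative substitute for x²/(x + y) ≤ x. -/
theorem trace_sq_mul_inv_add_le {X Y : Matrix (Fin d) (Fin d) ℝ} (hX : X.PosSemidef)
    (hY : Y.PosSemidef) (hXY : (X + Y).PosDef) :
    (X * X * (X + Y)⁻¹).trace ≤ X.trace := by
  set Z := X + Y with hZ
  have hu : IsUnit Z.det := (Matrix.isUnit_iff_isUnit_det _).1 hXY.isUnit
  have hZi : (Z⁻¹).IsHermitian := hXY.inv.1
  have h1 : ((1 - X * Z⁻¹) * X * (1 - Z⁻¹ * X)).PosSemidef := by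
    have := hX.conjTranspose_mul_mul_same (1 - Z⁻¹ * X)
    rwa [conjTranspose_sub, conjTranspose_mul, hX.1.eq, hZi.eq, conjTranspose_one] at this
  have h2 : ((X * Z⁻¹) * Y * (Z⁻¹ * X)).PosSemidef := by
    have := hY.conjTranspose_mul_mul_same (Z⁻¹ * X)
    rwa [conjTranspose_mul, hX.1.eq, hZi.eq] at this
  have hY' : Y = Z - X := by rw [hZ]; abel
  have he : (1 - X * Z⁻¹) * X * (1 - Z⁻¹ * X) + (X * Z⁻¹) * Y * (Z⁻¹ * X) = X - X * Z⁻¹ * X := by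
    have h3 : (X * Z⁻¹) * Z * (Z⁻¹ * X) = X * Z⁻¹ * X := by
      rw [mul_assoc X, Matrix.nonsing_inv_mul _ hu]; simp only [mul_one, mul_assoc]
    rw [hY', mul_sub (X * Z⁻¹) Z X, sub_mul (X * Z⁻¹ * Z), h3]
    noncomm_ring
  have ht := (h1.add h2).trace_nonneg
  rw [he, trace_sub] at ht
  have h3 : (X * Z⁻¹ * X).trace = (X * X * Z⁻¹).trace := by
    rw [trace_mul_comm, ← mul_assoc]
  linarith

/-- The trace of `(R A R)^{1/2}`. -/
noncomputable def traceSqrtConj (R A : Matrix (Fin d) (Fin d) ℝ) : ℝ :=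
  (CFC.sqrt (R * A * R)).trace

theorem trace_mul_le_of_le {A B M : Matrix (Fin d) (Fin d) ℝ} (hAB : (B - A).PosSemidef)
    (hM : M.PosSemidef) : (A * M).trace ≤ (B * M).trace := by
  set Q := CFC.sqrt M
  have hQ : Q.PosSemidef := CFC_sqrt_posSemidef M
  have hQQ : Q * Q = M := CFC.sqrt_mul_sqrt_self M hM.nonneg
  have h := (PosSemidef.conj_self hAB hQ.1).trace_nonneg
  have h1 : ∀ C : Matrix (Fin d) (Fin d) ℝ, (Q * C * Q).trace = (C * M).trace := by
    intro C
    rw [trace_mul_comm, ← mul_assoc, hQQ, trace_mul_comm]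
  rw [h1, sub_mul, trace_sub] at h
  linarith

/-- Take X = (R B R)^(1/2) and Y = √ε R. Conjugation by `R` gives R A R ≤ X² + Y², and
`trace_sqrt_le` with Z = X + Y, followed by `trace_sq_mul_inv_add_le` for each of the two squares,
leaves Tr X + Tr Y. -/
theorem traceSqrtConj_le_add {R A B : Matrix (Fin d) (Fin d) ℝ} (hR : R.PosDef)
    (hA : A.PosSemidef) (hB : B.PosSemidef) {ε : ℝ} (hε : 0 < ε)
    (hAB : (B + ε • 1 - A).PosSemidef) :
    traceSqrtConj R A ≤ traceSqrtConj R B + √ε * R.trace := by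
  have hRBR := PosSemidef.conj_self hB hR.1
  set X := CFC.sqrt (R * B * R) with hXdef
  have hX : X.PosSemidef := CFC_sqrt_posSemidef _
  have hXX : X * X = R * B * R := CFC.sqrt_mul_sqrt_self _ hRBR.nonneg
  set Y := √ε • R with hYdef
  have hY : Y.PosDef := hR.smul (Real.sqrt_pos.2 hε)
  have hYY : Y * Y = ε • (R * R) := by
    rw [hYdef, smul_mul_smul_comm, Real.mul_self_sqrt hε.le]
  have hZ : (X + Y).PosDef := hY.posSemidef_add hX
  have h1 := trace_sqrt_le (PosSemidef.conj_self hA hR.1) hZ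
  have h2 : (R * A * R * (X + Y)⁻¹).trace ≤ ((X * X + Y * Y) * (X + Y)⁻¹).trace := by
    refine trace_mul_le_of_le ?_ hZ.inv.posSemidef
    have h3 : X * X + Y * Y - R * A * R = R * (B + ε • 1 - A) * R := by
      rw [hXX, hYY]
      simp only [mul_sub, sub_mul, mul_add, add_mul, smul_mul_assoc, mul_smul_comm, mul_one]
    rw [h3]
    exact PosSemidef.conj_self hAB hR.1
  have h4 := trace_sq_mul_inv_add_le hX hY.posSemidef hZ
  have h5 : (Y * Y * (X + Y)⁻¹).trace ≤ Y.trace := by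
    rw [add_comm X Y]
    rw [add_comm X Y] at hZ
    exact trace_sq_mul_inv_add_le hY.posSemidef hX hZ
  rw [add_mul, trace_add] at h2
  rw [trace_add] at h1
  have h6 : Y.trace = √ε * R.trace := by rw [hYdef, trace_smul, smul_eq_mul]
  unfold traceSqrtConj
  rw [← h6]
  linarith

theorem traceSqrtConj_zero (R : Matrix (Fin d) (Fin d) ℝ) : traceSqrtConj R 0 = 0 := by
  simp [traceSqrtConj]

/-- The matrix of the linear functional that supports the concave function `traceSqrtConj R` near
`B`, regularized by `τ`. -/
noncomputable def supportMatrix (R B : Matrix (Fin d) (Fin d) ℝ) (τ : ℝ) :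
    Matrix (Fin d) (Fin d) ℝ :=
  R * (CFC.sqrt (R * B * R) + τ • R)⁻¹ * R

theorem supportMatrix_posSemidef {R B : Matrix (Fin d) (Fin d) ℝ} (hR : R.PosDef) {τ : ℝ}
    (hτ : 0 < τ) : (supportMatrix R B τ).PosSemidef := by
  have hZ : (CFC.sqrt (R * B * R) + τ • R).PosDef :=
    (hR.smul hτ).posSemidef_add (CFC_sqrt_posSemidef _)
  exact PosSemidef.conj_self hZ.inv.posSemidef hR.1

theorem trace_mul_supportMatrix_le {R B : Matrix (Fin d) (Fin d) ℝ} (hR : R.PosDef)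
    (hB : B.PosSemidef) {τ : ℝ} (hτ : 0 < τ) :
    (B * supportMatrix R B τ).trace ≤ traceSqrtConj R B := by
  have hZ : (CFC.sqrt (R * B * R) + τ • R).PosDef :=
    (hR.smul hτ).posSemidef_add (CFC_sqrt_posSemidef _)
  have h := trace_sq_mul_inv_add_le (CFC_sqrt_posSemidef (R * B * R)) (hR.smul hτ).posSemidef hZ
  rw [CFC.sqrt_mul_sqrt_self _ (PosSemidef.conj_self hB hR.1).nonneg] at h
  refine le_trans (le_of_eq ?_) h
  rw [supportMatrix, ← mul_assoc, trace_mul_comm, ← mul_assoc, ← mul_assoc]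

/-- This is `trace_sqrt_le` at Z = (R B R)^(1/2) + τ R. Together with `trace_mul_supportMatrix_le`
it is the tangent inequality at `B`; the summand τ R keeps Z invertible when B is singular and costs
τ Tr R. -/
theorem traceSqrtConj_le_supportMatrix {R A B : Matrix (Fin d) (Fin d) ℝ} (hR : R.PosDef)
    (hA : A.PosSemidef) {τ : ℝ} (hτ : 0 < τ) :
    2 * traceSqrtConj R A
      ≤ (A * supportMatrix R B τ).trace + traceSqrtConj R B + τ * R.trace := by
  have hZ : (CFC.sqrt (R * B * R) + τ • R).PosDef :=
    (hR.smul hτ).posSemidef_add (CFC_sqrt_posSemidef _)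
  have h := trace_sqrt_le (PosSemidef.conj_self hA hR.1) hZ
  have h2 : (A * supportMatrix R B τ).trace
      = (R * A * R * (CFC.sqrt (R * B * R) + τ • R)⁻¹).trace := by
    rw [supportMatrix, ← mul_assoc, trace_mul_comm, ← mul_assoc, ← mul_assoc]
  rw [h2]
  rw [trace_add, trace_smul, smul_eq_mul] at h
  unfold traceSqrtConj
  linarith

theorem trace_prodSqrt {S Sr : Matrix (Fin d) (Fin d) ℝ} (hSr : Sr.PosDef) :
    (prodSqrt S Sr).trace = traceSqrtConj (CFC.sqrt Sr) S := by
  have hu : IsUnit (CFC.sqrt Sr).det :=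
    (Matrix.isUnit_iff_isUnit_det _).1 (CFC_sqrt_posDef hSr).isUnit
  rw [prodSqrt, traceSqrtConj, trace_mul_comm, ← mul_assoc, Matrix.mul_nonsing_inv _ hu, one_mul]

theorem isHermitian_one_smul (ε : ℝ) : (ε • (1 : Matrix (Fin d) (Fin d) ℝ)).IsHermitian := by
  simp [IsHermitian]

theorem traceSqrtConj_le_specNorm {R S : Matrix (Fin d) (Fin d) ℝ} (hR : R.PosDef)
    (hS : S.PosSemidef) : traceSqrtConj R S ≤ √(specNorm S) * R.trace := by
  rcases (specNorm_nonneg S).eq_or_lt with h | h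
  · have h0 : S = 0 := by
      have : Matrix.toEuclideanCLM (𝕜 := ℝ) S = 0 := norm_eq_zero.1 h.symm
      simpa using this
    rw [← h, h0, traceSqrtConj_zero]; simp
  · have := traceSqrtConj_le_add hR hS PosSemidef.zero h (by
      rw [zero_add]
      refine posSemidef_of_quadForm_nonneg ((isHermitian_one_smul _).sub hS.1) fun v => ?_
      rw [quadForm_sub, quadForm_smul, quadForm_one]
      linarith [quadForm_le_specNorm S v])
    rwa [traceSqrtConj_zero, zero_add] at this

end LinearAlgebra

/-! ### Exponential moments of the square of a standard normal variable. -/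

section GaussianOneDim

theorem integral_exp_mul_sq_gaussianReal {c : ℝ} (hc : 2 * c < 1) :
    ∫ x, Real.exp (c * x ^ 2) ∂(gaussianReal 0 1) = (√(1 - 2 * c))⁻¹ := by
  rw [integral_gaussianReal_eq_integral_smul one_ne_zero]
  have h : ∀ x : ℝ, gaussianPDFReal 0 1 x • Real.exp (c * x ^ 2)
      = (√(2 * Real.pi))⁻¹ * Real.exp (-(1 / 2 - c) * x ^ 2) := by
    intro x
    rw [gaussianPDFReal, smul_eq_mul, mul_assoc, ← Real.exp_add]
    norm_num
    left
    ring_nf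
  simp_rw [h]
  rw [integral_const_mul, integral_gaussian, ← Real.sqrt_inv, ← Real.sqrt_inv, ← Real.sqrt_mul]
  · congr 1
    have : (1 : ℝ) - 2 * c ≠ 0 := by linarith
    have h2 : (1 : ℝ) / 2 - c ≠ 0 := by intro h; apply this; linarith
    field_simp
  · positivity

/-- The integral has already been evaluated to a nonzero number, whereas the Bochner integral of a
non-integrable function is zero. -/
theorem integrable_exp_mul_sq_gaussianReal {c : ℝ} (hc : 2 * c < 1) :
    Integrable (fun x => Real.exp (c * x ^ 2)) (gaussianReal 0 1) := by
  by_contra h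
  have h1 := integral_exp_mul_sq_gaussianReal hc
  rw [integral_undef h] at h1
  have : 0 < √(1 - 2 * c) := Real.sqrt_pos.2 (by linarith)
  have := inv_pos.2 this
  linarith

/-- With p = 1 - 2u and x = -log p, the inequality x ≤ sinh x reads -log p ≤ (1/p - p)/2, and half
of the right side is exactly the stated exponent. -/
theorem inv_sqrt_one_sub_le_exp {u : ℝ} (h0 : 0 ≤ u) (h1 : 2 * u < 1) :
    (√(1 - 2 * u))⁻¹ ≤ Real.exp (u + u ^ 2 / (1 - 2 * u)) := by
  have hp : 0 < 1 - 2 * u := by linarith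
  have hi : 0 ≤ -Real.log (1 - 2 * u) := by
    have := Real.log_nonpos hp.le (by linarith); linarith
  have hs := Real.self_le_sinh_iff.2 hi
  rw [Real.sinh_eq, neg_neg, Real.exp_neg, Real.exp_log hp] at hs
  rw [← Real.exp_log (inv_pos.2 (Real.sqrt_pos.2 hp)), Real.log_inv, Real.log_sqrt hp.le]
  apply Real.exp_le_exp.2
  have : u + u ^ 2 / (1 - 2 * u) = ((1 - 2 * u)⁻¹ - (1 - 2 * u)) / 2 / 2 := by
    rw [div_eq_mul_inv]
    linear_combination (-(1 / 4) - u / 2) * inv_mul_cancel₀ hp.ne'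
  rw [this]
  linarith

theorem inv_sqrt_one_add_le_exp {u : ℝ} (h0 : 0 ≤ u) :
    (√(1 + 2 * u))⁻¹ ≤ Real.exp (-u + u ^ 2) := by
  have hp : 0 < 1 + 2 * u := by linarith
  rw [← Real.exp_log (inv_pos.2 (Real.sqrt_pos.2 hp)), Real.log_inv, Real.log_sqrt hp.le]
  apply Real.exp_le_exp.2
  have h := Real.le_log_one_add_of_nonneg (x := 2 * u) (by linarith)
  have h2 : 2 * u - 2 * u ^ 2 ≤ 2 * (2 * u) / (2 * u + 2) := by
    rw [le_div_iff₀ (by linarith)]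
    nlinarith [pow_nonneg h0 3]
  linarith

end GaussianOneDim

/-! ### Exponential moments of Gaussian quadratic forms, and the Cameron–Martin shift. -/

section GaussianVector

variable {d : ℕ}

theorem continuous_quadForm (B : Matrix (Fin d) (Fin d) ℝ) : Continuous (quadForm B) := by
  unfold quadForm
  fun_prop

theorem measurable_quadForm (B : Matrix (Fin d) (Fin d) ℝ) : Measurable (quadForm B) :=
  (continuous_quadForm B).measurable

/-- In an eigenbasis of `B` the coordinates are independent standard normals and the form is a
weighted sum of their squares, so the moment factorizes. -/
theorem lintegral_exp_quadForm_stdGaussian {B : Matrix (Fin d) (Fin d) ℝ} (hB : B.IsHermitian)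
    {c : ℝ} (hc : ∀ i, 2 * (c * hB.eigenvalues i) < 1) :
    ∫⁻ w, ENNReal.ofReal (Real.exp (c * quadForm B w)) ∂(stdGaussian (Emb d))
      = ENNReal.ofReal (∏ i, (√(1 - 2 * (c * hB.eigenvalues i)))⁻¹) := by
  rw [stdGaussian_eq_map_pi_orthonormalBasis hB.eigenvectorBasis, lintegral_map]
  · simp_rw [quadForm_eigenvectorBasis hB]
    have h : ∀ x : Fin d → ℝ, Real.exp (c * ∑ i, hB.eigenvalues i * x i ^ 2)
        = ∏ i, Real.exp (c * hB.eigenvalues i * x i ^ 2) := by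
      intro x
      rw [← Real.exp_sum, Finset.mul_sum]
      simp only [mul_assoc]
    simp_rw [h]
    rw [← ofReal_integral_eq_lintegral_ofReal]
    · rw [integral_fintype_prod_eq_prod (fun i y => Real.exp (c * hB.eigenvalues i * y ^ 2))]
      congr 1
      exact Finset.prod_congr rfl fun i _ => integral_exp_mul_sq_gaussianReal (hc i)
    · exact Integrable.fintype_prod fun i => integrable_exp_mul_sq_gaussianReal (hc i)
    · exact ae_of_all _ fun x => Finset.prod_nonneg fun i _ => (Real.exp_pos _).le
  · exact ((measurable_quadForm B).const_mul c).exp.ennreal_ofReal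
  · fun_prop

theorem lintegral_exp_quadForm_stdGaussian_le {B : Matrix (Fin d) (Fin d) ℝ} (hB : B.PosSemidef)
    {c h σ : ℝ} (hc : 0 ≤ c) (hσ : specNorm B ≤ σ) (hcσ : 2 * (c * σ) < 1)
    (hh : (B ^ 2).trace ≤ h ^ 2) :
    ∫⁻ w, ENNReal.ofReal (Real.exp (c * quadForm B w)) ∂(stdGaussian (Emb d))
      ≤ ENNReal.ofReal (Real.exp (c * B.trace + c ^ 2 * h ^ 2 / (1 - 2 * (c * σ)))) := by
  have hl : ∀ i, 0 ≤ hB.1.eigenvalues i := hB.eigenvalues_nonneg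
  have hls : ∀ i, c * hB.1.eigenvalues i ≤ c * σ := fun i =>
    mul_le_mul_of_nonneg_left ((eigenvalues_le_specNorm hB.1 i).trans hσ) hc
  rw [lintegral_exp_quadForm_stdGaussian hB.1 fun i => by linarith [hls i]]
  apply ENNReal.ofReal_le_ofReal
  have hpos : 0 < 1 - 2 * (c * σ) := by linarith
  calc ∏ i, (√(1 - 2 * (c * hB.1.eigenvalues i)))⁻¹
      ≤ ∏ i, Real.exp (c * hB.1.eigenvalues i
          + (c * hB.1.eigenvalues i) ^ 2 / (1 - 2 * (c * σ))) := by
        refine Finset.prod_le_prod (fun i _ => by positivity) fun i _ => ?_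
        refine (inv_sqrt_one_sub_le_exp (mul_nonneg hc (hl i)) (by linarith [hls i])).trans ?_
        apply Real.exp_le_exp.2
        gcongr
        exact (eigenvalues_le_specNorm hB.1 i).trans hσ
    _ ≤ Real.exp (c * B.trace + c ^ 2 * h ^ 2 / (1 - 2 * (c * σ))) := by
        rw [← Real.exp_sum, Finset.sum_add_distrib, ← Finset.mul_sum, ← Finset.sum_div,
          ← trace_eq_sum_eigenvalues_real]
        simp_rw [mul_pow]
        rw [← Finset.mul_sum, ← trace_sq_eq_sum_eigenvalues]
        apply Real.exp_le_exp.2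
        gcongr

/-- A negative exponent needs no upper restriction on `c`. The variance term Tr B² is relaxed to (Tr
B)², which loses nothing for rank-one forms and suffices for the trace. -/
theorem lintegral_exp_neg_quadForm_stdGaussian_le {B : Matrix (Fin d) (Fin d) ℝ}
    (hB : B.PosSemidef) {c : ℝ} (hc : 0 ≤ c) :
    ∫⁻ w, ENNReal.ofReal (Real.exp (-c * quadForm B w)) ∂(stdGaussian (Emb d))
      ≤ ENNReal.ofReal (Real.exp (-c * B.trace + c ^ 2 * B.trace ^ 2)) := by
  have hl : ∀ i, 0 ≤ hB.1.eigenvalues i := hB.eigenvalues_nonneg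
  have hcl : ∀ i, 0 ≤ c * hB.1.eigenvalues i := fun i => mul_nonneg hc (hl i)
  rw [lintegral_exp_quadForm_stdGaussian hB.1 fun i => by linarith [hcl i]]
  apply ENNReal.ofReal_le_ofReal
  calc ∏ i, (√(1 - 2 * (-c * hB.1.eigenvalues i)))⁻¹
      ≤ ∏ i, Real.exp (-(c * hB.1.eigenvalues i) + (c * hB.1.eigenvalues i) ^ 2) := by
        refine Finset.prod_le_prod (fun i _ => by positivity) fun i _ => ?_
        rw [(by ring : 1 - 2 * (-c * hB.1.eigenvalues i) = 1 + 2 * (c * hB.1.eigenvalues i))]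
        exact inv_sqrt_one_add_le_exp (hcl i)
    _ ≤ _ := by
        rw [← Real.exp_sum, Finset.sum_add_distrib, Finset.sum_neg_distrib, ← Finset.mul_sum,
          ← trace_eq_sum_eigenvalues_real]
        simp_rw [mul_pow]
        rw [← Finset.mul_sum, ← trace_sq_eq_sum_eigenvalues]
        apply Real.exp_le_exp.2
        have := mul_le_mul_of_nonneg_left (trace_sq_le hB) (sq_nonneg c)
        linarith

theorem lintegral_multivariateGaussian {m : Emb d} {S : Matrix (Fin d) (Fin d) ℝ}
    {g : Emb d → ℝ≥0∞} (hg : Measurable g) :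
    ∫⁻ y, g (y - m) ∂(multivariateGaussian m S)
      = ∫⁻ w, g (Matrix.toEuclideanCLM (𝕜 := ℝ) (CFC.sqrt S) w) ∂(stdGaussian (Emb d)) := by
  rw [multivariateGaussian, lintegral_map]
  · simp
  · fun_prop
  · fun_prop

theorem quadForm_conj {R M : Matrix (Fin d) (Fin d) ℝ} (hR : R.IsHermitian) (w : Emb d) :
    quadForm M (Matrix.toEuclideanCLM (𝕜 := ℝ) R w) = quadForm (R * M * R) w := by
  have h : IsSelfAdjoint (Matrix.toEuclideanCLM (𝕜 := ℝ) R) := by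
    have : IsSelfAdjoint R := hR
    exact this.map _
  rw [quadForm, quadForm, map_mul, map_mul]
  simp only [mul_apply_eq_comp]
  have h2 := ContinuousLinearMap.adjoint_inner_left (Matrix.toEuclideanCLM (𝕜 := ℝ) R)
    (Matrix.toEuclideanCLM (𝕜 := ℝ) M (Matrix.toEuclideanCLM (𝕜 := ℝ) R w)) w
  rwa [h.adjoint_eq] at h2

theorem lintegral_quadForm_multivariateGaussian {m : Emb d} {S M : Matrix (Fin d) (Fin d) ℝ}
    {g : ℝ → ℝ≥0∞} (hg : Measurable g) :
    ∫⁻ y, g (quadForm M (y - m)) ∂(multivariateGaussian m S)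
      = ∫⁻ w, g (quadForm (CFC.sqrt S * M * CFC.sqrt S) w) ∂(stdGaussian (Emb d)) := by
  rw [lintegral_multivariateGaussian (g := fun v => g (quadForm M v))
    (hg.comp (measurable_quadForm M))]
  simp_rw [quadForm_conj (CFC_sqrt_posSemidef S).1]

theorem trace_sqrt_conj {S M : Matrix (Fin d) (Fin d) ℝ} (hS : S.PosSemidef) :
    (CFC.sqrt S * M * CFC.sqrt S).trace = (S * M).trace := by
  rw [Matrix.trace_mul_comm, ← mul_assoc, CFC.sqrt_mul_sqrt_self _ hS.nonneg]

theorem integral_cexp_sum_pi (z : Fin d → ℂ) :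
    ∫ x : Fin d → ℝ, Complex.exp (∑ i, z i * x i) ∂(Measure.pi fun _ => gaussianReal 0 1)
      = Complex.exp (∑ i, z i ^ 2 / 2) := by
  simp_rw [Complex.exp_sum]
  rw [integral_fintype_prod_eq_prod (fun i (x : ℝ) => Complex.exp (z i * x))]
  refine Finset.prod_congr rfl fun i _ => ?_
  have := complexMGF_id_gaussianReal (μ := 0) (v := 1) (z i)
  simpa [complexMGF] using this

theorem lintegral_exp_inner_stdGaussian (u : Emb d) :
    ∫⁻ w, ENNReal.ofReal (Real.exp (inner ℝ u w)) ∂(stdGaussian (Emb d))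
      = ENNReal.ofReal (Real.exp (‖u‖ ^ 2 / 2)) := by
  rw [← map_pi_eq_stdGaussian, lintegral_map (by fun_prop) (by fun_prop)]
  have h : ∀ x : Fin d → ℝ, Real.exp (inner ℝ u (WithLp.toLp 2 x)) = ∏ i, Real.exp (u i * x i) := by
    intro x
    rw [← Real.exp_sum, PiLp.inner_apply]
    simp [mul_comm]
  simp_rw [h]
  rw [← ofReal_integral_eq_lintegral_ofReal]
  · rw [integral_fintype_prod_eq_prod (fun i (y : ℝ) => Real.exp (u i * y))]
    congr 1
    rw [EuclideanSpace.real_norm_sq_eq, Finset.sum_div, Real.exp_sum]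
    refine Finset.prod_congr rfl fun i _ => ?_
    have := congrFun (mgf_fun_id_gaussianReal (μ := 0) (v := 1)) (u i)
    simpa [mgf] using this
  · exact Integrable.fintype_prod fun i => integrable_exp_mul_gaussianReal (u i)
  · exact ae_of_all _ fun x => Finset.prod_nonneg fun i _ => (Real.exp_pos _).le

/-- Both sides are finite measures, so it suffices to compare characteristic functions; in
coordinates the tilted one is a product of complex Gaussian moments at u_i + i t_i. -/
theorem stdGaussian_withDensity_eq_map_add (u : Emb d) :
    (stdGaussian (Emb d)).withDensity
        (fun w => ENNReal.ofReal (Real.exp (inner ℝ u w - ‖u‖ ^ 2 / 2)))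
      = (stdGaussian (Emb d)).map (fun w => w + u) := by
  have hm : Measurable fun w : Emb d => Real.exp (inner ℝ u w - ‖u‖ ^ 2 / 2) := by fun_prop
  have : IsFiniteMeasure ((stdGaussian (Emb d)).withDensity
      (fun w => ENNReal.ofReal (Real.exp (inner ℝ u w - ‖u‖ ^ 2 / 2)))) := by
    refine isFiniteMeasure_withDensity ?_
    simp_rw [sub_eq_add_neg, Real.exp_add, ENNReal.ofReal_mul (Real.exp_pos _).le]
    rw [lintegral_mul_const _ (by fun_prop), lintegral_exp_inner_stdGaussian]
    exact ENNReal.mul_ne_top ENNReal.ofReal_ne_top ENNReal.ofReal_ne_top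
  have hp : IsProbabilityMeasure ((stdGaussian (Emb d)).map (fun w => w + u)) :=
    Measure.isProbabilityMeasure_map (by fun_prop)
  apply Measure.ext_of_charFun
  ext t
  rw [charFun_map_add_const, charFun_stdGaussian, charFun_apply,
    integral_withDensity_eq_integral_toReal_smul (by fun_prop) (by simp)]
  simp_rw [ENNReal.toReal_ofReal (Real.exp_pos _).le]
  rw [← map_pi_eq_stdGaussian, integral_map (by fun_prop) (by fun_prop)]
  have h : ∀ x : Fin d → ℝ, Real.exp (inner ℝ u (WithLp.toLp 2 x) - ‖u‖ ^ 2 / 2)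
      • Complex.exp (inner ℝ (WithLp.toLp 2 x) t * Complex.I)
      = Complex.exp (∑ i, (u i + t i * Complex.I) * x i) * Complex.exp (-(‖u‖ : ℂ) ^ 2 / 2) := by
    intro x
    rw [Complex.real_smul, Complex.ofReal_exp, ← Complex.exp_add, ← Complex.exp_add,
      PiLp.inner_apply, PiLp.inner_apply]
    congr 1
    simp only [RCLike.inner_apply, conj_trivial]
    push_cast
    rw [Finset.sum_mul]
    simp_rw [add_mul]
    rw [Finset.sum_add_distrib]
    rw [Finset.sum_congr rfl fun i _ => mul_comm (x i : ℂ) (u i : ℂ)]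
    rw [Finset.sum_congr rfl fun i _ => (by ring : (t i : ℂ) * x i * Complex.I
      = t i * Complex.I * x i)]
    ring
  simp_rw [h]
  rw [integral_mul_const, integral_cexp_sum_pi, ← Complex.exp_add, ← Complex.exp_add]
  congr 1
  have h3 : (‖u‖ : ℂ) ^ 2 = ∑ i, (u i : ℂ) ^ 2 := by
    rw [← Complex.ofReal_pow, EuclideanSpace.real_norm_sq_eq]; push_cast; rfl
  have h4 : (‖t‖ : ℂ) ^ 2 = ∑ i, (t i : ℂ) ^ 2 := by
    rw [← Complex.ofReal_pow, EuclideanSpace.real_norm_sq_eq]; push_cast; rfl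
  rw [h3, h4, PiLp.inner_apply]
  simp only [RCLike.inner_apply, conj_trivial]
  push_cast
  rw [Finset.sum_mul, ← Finset.sum_neg_distrib, ← Finset.sum_neg_distrib, Finset.sum_div,
    Finset.sum_div, ← Finset.sum_add_distrib, ← Finset.sum_add_distrib]
  refine Finset.sum_congr rfl fun i _ => ?_
  have : Complex.I ^ 2 = -1 := Complex.I_sq
  linear_combination (t i : ℂ) ^ 2 / 2 * this

/-- The Cameron–Martin change of variables for the standard Gaussian measure. -/
theorem lintegral_stdGaussian_shift (u : Emb d) {g : Emb d → ℝ≥0∞} (hg : Measurable g) :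
    ∫⁻ w, g w ∂(stdGaussian (Emb d))
      = ∫⁻ w, g (w + u) * ENNReal.ofReal (Real.exp (-inner ℝ u w - ‖u‖ ^ 2 / 2))
          ∂(stdGaussian (Emb d)) := by
  set k : Emb d → ℝ≥0∞ := fun y => g y * ENNReal.ofReal (Real.exp (-inner ℝ u y + ‖u‖ ^ 2 / 2))
  have hk : Measurable k := hg.mul (by fun_prop)
  have h1 : ∫⁻ w, k (w + u) ∂(stdGaussian (Emb d)) = ∫⁻ w, g w ∂(stdGaussian (Emb d)) := by
    rw [← lintegral_map (f := k) (g := fun w => w + u) hk (by fun_prop),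
      ← stdGaussian_withDensity_eq_map_add, lintegral_withDensity_eq_lintegral_mul _ (by fun_prop) hk]
    refine lintegral_congr fun w => ?_
    simp only [k, Pi.mul_apply]
    rw [mul_comm, mul_assoc, ← ENNReal.ofReal_mul (Real.exp_pos _).le, ← Real.exp_add]
    simp
  rw [← h1]
  refine lintegral_congr fun w => ?_
  simp only [k]
  congr 3
  rw [inner_add_right, real_inner_self_eq_norm_sq]
  ring

end GaussianVector

/-! ### Chernoff bounds from chi-square type exponential moments. -/

section Chernoff

variable {Ω : Type*} [MeasurableSpace Ω] {P : Measure Ω}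

theorem measure_le_of_lintegral_exp_le {f : Ω → ℝ} (hf : Measurable f) {a t : ℝ}
    (h : ∫⁻ ω, ENNReal.ofReal (Real.exp (f ω)) ∂P ≤ ENNReal.ofReal (Real.exp a)) :
    P {ω | a + t ≤ f ω} ≤ ENNReal.ofReal (Real.exp (-t)) := by
  have h1 := mul_meas_ge_le_lintegral (μ := P) (hf.exp.ennreal_ofReal)
    (ENNReal.ofReal (Real.exp (a + t)))
  have h2 : {ω | a + t ≤ f ω}
      ⊆ {ω | ENNReal.ofReal (Real.exp (a + t)) ≤ ENNReal.ofReal (Real.exp (f ω))} := by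
    intro ω hω
    exact ENNReal.ofReal_le_ofReal (Real.exp_le_exp.2 hω)
  have h3 : ENNReal.ofReal (Real.exp (a + t)) * P {ω | a + t ≤ f ω}
      ≤ ENNReal.ofReal (Real.exp a) :=
    (mul_le_mul_right (measure_mono h2) _).trans (h1.trans h)
  have h4 : ENNReal.ofReal (Real.exp (-(a + t))) * (ENNReal.ofReal (Real.exp (a + t))
      * P {ω | a + t ≤ f ω}) = P {ω | a + t ≤ f ω} := by
    rw [← mul_assoc, ← ENNReal.ofReal_mul (Real.exp_pos _).le, ← Real.exp_add]
    simp
  rw [← h4]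
  refine (mul_le_mul_right h3 _).trans (le_of_eq ?_)
  rw [← ENNReal.ofReal_mul (Real.exp_pos _).le, ← Real.exp_add]
  ring_nf

theorem measure_upper_tail {f : Ω → ℝ} (hf : Measurable f) {ν τ h σ t : ℝ} (hν : 0 < ν)
    (hh : 0 < h) (hσ : 0 ≤ σ) (ht : 0 ≤ t)
    (H : ∀ c : ℝ, 0 ≤ c → 2 * (c * σ) < 1 →
      ∫⁻ ω, ENNReal.ofReal (Real.exp (c * f ω)) ∂P
        ≤ ENNReal.ofReal (Real.exp (ν * (c * τ + c ^ 2 * h ^ 2 / (1 - 2 * (c * σ)))))) :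
    P {ω | ν * (τ + 2 * h * √(t / ν) + 2 * σ * (t / ν)) < f ω}
      ≤ ENNReal.ofReal (Real.exp (-t)) := by
  rcases ht.eq_or_lt with ht0 | ht0
  · subst ht0
    have := H 0 le_rfl (by norm_num)
    simp only [zero_mul, Real.exp_zero, ENNReal.ofReal_one, lintegral_const, one_mul] at this
    simp only [ne_eq, OfNat.ofNat_ne_zero, not_false_eq_true, zero_pow, zero_mul, mul_zero,
      sub_zero, zero_div, add_zero, Real.exp_zero, ENNReal.ofReal_one] at this
    simpa using (measure_mono (Set.subset_univ _)).trans this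
  set x := √(t / ν) with hx
  have hx0 : 0 < x := Real.sqrt_pos.2 (by positivity)
  have hxx : x ^ 2 = t / ν := Real.sq_sqrt (by positivity)
  have hD : 0 < h + 2 * σ * x := by positivity
  -- For this `c`, 1 - 2cσ = h/(h + 2σx), so the quadratic term of the exponent collapses to c h x
  -- and the Chernoff exponent is exactly t.
  set c := x / (h + 2 * σ * x) with hc
  have hc0 : 0 < c := by positivity
  have h1 : 1 - 2 * (c * σ) = h / (h + 2 * σ * x) := by
    rw [hc]; field_simp; ring
  have hcσ : 2 * (c * σ) < 1 := by
    have : 0 < 1 - 2 * (c * σ) := by rw [h1]; positivity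
    linarith
  have h2 := measure_le_of_lintegral_exp_le (hf.const_mul c) (t := t) (H c hc0.le hcσ)
  refine (measure_mono fun ω hω => ?_).trans h2
  simp only [Set.mem_ofPred_eq] at hω ⊢
  have h3 : c ^ 2 * h ^ 2 / (1 - 2 * (c * σ)) = c * h * x := by
    rw [h1, hc]; field_simp
  have h4 : t = ν * (c * (h + 2 * σ * x) * x) := by
    have : c * (h + 2 * σ * x) = x := by rw [hc]; field_simp
    rw [this, ← sq, hxx]; field_simp
  rw [← hxx] at hω
  have h5 := mul_le_mul_of_nonneg_left hω.le hc0.le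
  refine le_trans (le_of_eq ?_) h5
  rw [h3]
  linear_combination h4

theorem measure_lower_tail {f : Ω → ℝ} (hf : Measurable f) {ν τ h t : ℝ} (hν : 0 < ν)
    (hh : 0 < h) (ht : 0 ≤ t)
    (H : ∀ c : ℝ, 0 ≤ c →
      ∫⁻ ω, ENNReal.ofReal (Real.exp (-c * f ω)) ∂P
        ≤ ENNReal.ofReal (Real.exp (ν * (-c * τ + c ^ 2 * h ^ 2)))) :
    P {ω | f ω < ν * (τ - 2 * h * √(t / ν))} ≤ ENNReal.ofReal (Real.exp (-t)) := by
  set x := √(t / ν) with hx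
  have hx0 : 0 ≤ x := Real.sqrt_nonneg _
  have hxx : x ^ 2 = t / ν := Real.sq_sqrt (by positivity)
  have h2 := measure_le_of_lintegral_exp_le (hf.const_mul (-(x / h))) (t := t)
    (H (x / h) (by positivity))
  refine (measure_mono fun ω hω => ?_).trans h2
  simp only [Set.mem_ofPred_eq] at hω ⊢
  have h4 : t = ν * x ^ 2 := by rw [hxx]; field_simp
  have h5 := mul_le_mul_of_nonneg_left hω.le (by positivity : 0 ≤ x / h)
  have h6 : x / h * (ν * (τ - 2 * h * x)) = ν * (x / h * τ) - 2 * t := by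
    rw [h4]; field_simp
  have h7 : (x / h) ^ 2 * h ^ 2 = x ^ 2 := by field_simp
  rw [h7]
  have h8 : ν * (-(x / h) * τ + x ^ 2) = -(ν * (x / h * τ)) + t := by rw [h4]; ring
  rw [h8]
  linarith

end Chernoff

/-! ### Tails of sums over an i.i.d. Gaussian sample. -/

section SampleTails

variable {d : ℕ} {Ω : Type*} [MeasurableSpace Ω] {P : Measure Ω}
  {Z : ℕ → Ω → Emb d} {m : Emb d} {S : Matrix (Fin d) (Fin d) ℝ}

theorem lintegral_prod_range_eq_pow (hZm : ∀ a, Measurable (Z a))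
    (hZ : ∀ a, HasLaw (Z a) (multivariateGaussian m S) P) (hI : iIndepFun Z P)
    {g : Emb d → ℝ≥0∞} (hg : Measurable g) (n : ℕ) :
    ∫⁻ ω, ∏ a ∈ Finset.range n, g (Z a ω) ∂P
      = (∫⁻ y, g y ∂(multivariateGaussian m S)) ^ n := by
  have h := lintegral_prod_eq_prod_lintegral_of_indepFun (Finset.range n)
    (fun a => g ∘ Z a) (hI.comp (fun _ => g) fun _ => hg) fun a => hg.comp (hZm a)
  simp only [Function.comp_apply] at h
  rw [h]
  simp_rw [(hZ _).lintegral_comp hg.aemeasurable]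
  simp

theorem lintegral_exp_sum_quadForm (hZm : ∀ a, Measurable (Z a))
    (hZ : ∀ a, HasLaw (Z a) (multivariateGaussian m S) P) (hI : iIndepFun Z P)
    (M : Matrix (Fin d) (Fin d) ℝ) (c : ℝ) (n : ℕ) :
    ∫⁻ ω, ENNReal.ofReal (Real.exp (c * ∑ a ∈ Finset.range n, quadForm M (Z a ω - m))) ∂P
      = (∫⁻ w, ENNReal.ofReal (Real.exp (c * quadForm (CFC.sqrt S * M * CFC.sqrt S) w))
          ∂(stdGaussian (Emb d))) ^ n := by
  have hm : Measurable fun x : ℝ => ENNReal.ofReal (Real.exp (c * x)) := by fun_prop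
  rw [← lintegral_quadForm_multivariateGaussian (m := m) hm, ← lintegral_prod_range_eq_pow hZm hZ hI
    (g := fun y => ENNReal.ofReal (Real.exp (c * quadForm M (y - m))))
    (hm.comp ((measurable_quadForm M).comp (by fun_prop)))]
  refine lintegral_congr fun ω => ?_
  rw [Finset.mul_sum, Real.exp_sum, ENNReal.ofReal_prod_of_nonneg]
  exact fun _ _ => (Real.exp_pos _).le

theorem measurable_sum_quadForm (hZm : ∀ a, Measurable (Z a)) (M : Matrix (Fin d) (Fin d) ℝ)
    (n : ℕ) : Measurable fun ω => ∑ a ∈ Finset.range n, quadForm M (Z a ω - m) :=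
  Finset.measurable_fun_sum _ fun a _ =>
    (measurable_quadForm M).comp ((hZm a).sub_const m)

theorem ofReal_exp_pow (a : ℝ) (n : ℕ) :
    ENNReal.ofReal (Real.exp a) ^ n = ENNReal.ofReal (Real.exp (n * a)) := by
  rw [← ENNReal.ofReal_pow (Real.exp_pos _).le, ← Real.exp_nat_mul]

theorem measure_sum_quadForm_upper (hZm : ∀ a, Measurable (Z a))
    (hZ : ∀ a, HasLaw (Z a) (multivariateGaussian m S) P) (hI : iIndepFun Z P)
    (hS : S.PosSemidef) {M : Matrix (Fin d) (Fin d) ℝ} (hM : M.PosSemidef) {h σ t : ℝ} (hh : 0 < h)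
    (hhB : ((CFC.sqrt S * M * CFC.sqrt S) ^ 2).trace ≤ h ^ 2)
    (hσ : specNorm (CFC.sqrt S * M * CFC.sqrt S) ≤ σ) (ht : 0 ≤ t) {n : ℕ} (hn : 0 < n) :
    P {ω | n * ((S * M).trace + 2 * h * √(t / n) + 2 * σ * (t / n))
        < ∑ a ∈ Finset.range n, quadForm M (Z a ω - m)} ≤ ENNReal.ofReal (Real.exp (-t)) := by
  refine measure_upper_tail (measurable_sum_quadForm hZm M n) (by exact_mod_cast hn) hh
    ((specNorm_nonneg _).trans hσ) ht fun c hc hcσ => ?_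
  rw [lintegral_exp_sum_quadForm hZm hZ hI, ← ofReal_exp_pow, ← trace_sqrt_conj hS]
  exact pow_le_pow_left' (lintegral_exp_quadForm_stdGaussian_le
    (PosSemidef.conj_self hM (CFC_sqrt_posSemidef S).1) hc hσ hcσ hhB) n

theorem measure_sum_quadForm_lower (hZm : ∀ a, Measurable (Z a))
    (hZ : ∀ a, HasLaw (Z a) (multivariateGaussian m S) P) (hI : iIndepFun Z P)
    (hS : S.PosSemidef) {M : Matrix (Fin d) (Fin d) ℝ} (hM : M.PosSemidef) {t : ℝ}
    (hSM : 0 < (S * M).trace) (ht : 0 ≤ t) {n : ℕ} (hn : 0 < n) :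
    P {ω | ∑ a ∈ Finset.range n, quadForm M (Z a ω - m)
        < n * ((S * M).trace - 2 * (S * M).trace * √(t / n))} ≤ ENNReal.ofReal (Real.exp (-t)) := by
  refine measure_lower_tail (measurable_sum_quadForm hZm M n) (by exact_mod_cast hn) hSM ht
    fun c hc => ?_
  rw [lintegral_exp_sum_quadForm hZm hZ hI, ← ofReal_exp_pow, ← trace_sqrt_conj hS]
  exact pow_le_pow_left' (lintegral_exp_neg_quadForm_stdGaussian_le
    (PosSemidef.conj_self hM (CFC_sqrt_posSemidef S).1) hc) n

/-- The normalized sum of a centered Gaussian sample has the law of a single element. -/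
theorem hasLaw_normalized_sum (hZm : ∀ a, Measurable (Z a))
    (hZ : ∀ a, HasLaw (Z a) (multivariateGaussian m S) P) (hI : iIndepFun Z P)
    (hS : S.PosSemidef) {n : ℕ} (hn : 0 < n) :
    HasLaw (fun ω => (√n)⁻¹ • ∑ a ∈ Finset.range n, (Z a ω - m)) (multivariateGaussian 0 S) P := by
  have hP : IsProbabilityMeasure P := (hZ 0).isProbabilityMeasure
  have hmeas : Measurable fun ω => ∑ a ∈ Finset.range n, (Z a ω - m) :=
    Finset.measurable_fun_sum _ fun a _ => (hZm a).sub_const m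
  have hmeas' : Measurable fun ω => (√n)⁻¹ • ∑ a ∈ Finset.range n, (Z a ω - m) :=
    Measurable.fun_const_smul hmeas _
  refine ⟨hmeas'.aemeasurable, ?_⟩
  have : IsProbabilityMeasure (P.map fun ω => (√n)⁻¹ • ∑ a ∈ Finset.range n, (Z a ω - m)) :=
    Measure.isProbabilityMeasure_map hmeas'.aemeasurable
  apply Measure.ext_of_charFun
  ext t
  have hI' : iIndepFun (fun a ω => Z a ω - m) P :=
    hI.comp (fun _ y => y - m) fun _ => by fun_prop
  have h1 : ∀ a, charFun (P.map fun ω => Z a ω - m) = charFun (multivariateGaussian 0 S) := by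
    intro a
    have hc : (fun ω => Z a ω - m) = (fun y => y + -m) ∘ Z a := by ext; simp [sub_eq_add_neg]
    ext s
    rw [hc, ← Measure.map_map (by fun_prop) (hZm a), charFun_map_add_const, (hZ a).map_eq,
      charFun_multivariateGaussian hS, charFun_multivariateGaussian hS, ← Complex.exp_add]
    congr 1
    simp [inner_neg_left, real_inner_comm]
    ring
  have h2 := (hI'.restrict (Finset.range n)).charFun_map_fun_finsetSum_eq_prod
    (fun a _ => ((hZm a).sub_const m).aemeasurable)
  simp_rw [h1, Finset.prod_const, Finset.card_range] at h2
  have hc2 : (fun ω => (√n)⁻¹ • ∑ a ∈ Finset.range n, (Z a ω - m))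
      = (fun y : Emb d => (√n)⁻¹ • y) ∘ fun ω => ∑ a ∈ Finset.range n, (Z a ω - m) := rfl
  rw [hc2, ← Measure.map_map (by fun_prop) hmeas, charFun_map_smul, h2, Pi.pow_apply,
    charFun_multivariateGaussian hS, charFun_multivariateGaussian hS, ← Complex.exp_nat_mul]
  congr 1
  have hn' : ((√n : ℝ) : ℂ) ^ 2 = n := by
    rw [← Complex.ofReal_pow, Real.sq_sqrt (by positivity)]; simp
  have hn0 : ((√n : ℝ) : ℂ) ≠ 0 := by
    have : √(n : ℝ) ≠ 0 := by positivity
    exact_mod_cast this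
  simp only [inner_zero_right, Complex.ofReal_zero, zero_mul, zero_sub, WithLp.ofLp_smul,
    Matrix.mulVec_smul, dotProduct_smul, smul_dotProduct, smul_eq_mul]
  push_cast
  field_simp
  rw [hn']

/-- The normalized sum is again centered Gaussian with covariance `S`, so this is the tail of a
single Gaussian quadratic form, whatever `n` is. -/
theorem measure_norm_sum_upper (hZm : ∀ a, Measurable (Z a))
    (hZ : ∀ a, HasLaw (Z a) (multivariateGaussian m S) P) (hI : iIndepFun Z P)
    (hS : S.PosSemidef) {h σ t : ℝ} (hh : 0 < h) (hhS : (S ^ 2).trace ≤ h ^ 2)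
    (hσ : specNorm S ≤ σ) (ht : 0 ≤ t) {n : ℕ} (hn : 0 < n) :
    P {ω | S.trace + 2 * h * √t + 2 * σ * t
        < ‖(√n)⁻¹ • ∑ a ∈ Finset.range n, (Z a ω - m)‖ ^ 2} ≤ ENNReal.ofReal (Real.exp (-t)) := by
  have hL := hasLaw_normalized_sum hZm hZ hI hS hn
  have hmeas : Measurable fun ω => ‖(√n)⁻¹ • ∑ a ∈ Finset.range n, (Z a ω - m)‖ ^ 2 :=
    ((Finset.measurable_fun_sum _ fun a _ => (hZm a).sub_const m).const_smul (√n)⁻¹).norm.pow_const 2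
  have hB : CFC.sqrt S * 1 * CFC.sqrt S = S := by
    rw [mul_one, CFC.sqrt_mul_sqrt_self _ hS.nonneg]
  have := measure_upper_tail (P := P) hmeas (ν := 1) (τ := S.trace) one_pos hh
    ((specNorm_nonneg _).trans hσ) ht fun c hc hcσ => by
      have hm : Measurable fun x : ℝ => ENNReal.ofReal (Real.exp (c * x)) := by fun_prop
      have h1 := hL.lintegral_comp (f := fun y => ENNReal.ofReal (Real.exp (c * ‖y‖ ^ 2)))
        (by fun_prop)
      have h2 := lintegral_quadForm_multivariateGaussian (m := 0) (S := S) (M := 1) hm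
      simp only [quadForm_one, sub_zero, hB] at h2
      rw [h1, h2, one_mul]
      exact lintegral_exp_quadForm_stdGaussian_le hS hc hσ hcσ hhS
  simpa using this

theorem measure_inner_sum_upper (hZm : ∀ a, Measurable (Z a))
    (hZ : ∀ a, HasLaw (Z a) (multivariateGaussian m S) P) (hI : iIndepFun Z P)
    (hS : S.PosSemidef) (hS0 : 0 < specNorm S) (v : Emb d) {t : ℝ} (ht : 0 ≤ t)
    {n : ℕ} (hn : 0 < n) :
    P {ω | ‖v‖ * √(2 * specNorm S * t)
        < inner ℝ v ((√n)⁻¹ • ∑ a ∈ Finset.range n, (Z a ω - m))}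
      ≤ ENNReal.ofReal (Real.exp (-t)) := by
  have hP : IsProbabilityMeasure P := (hZ 0).isProbabilityMeasure
  rcases eq_or_ne v 0 with rfl | hv
  · simp
  have hv0 : 0 < ‖v‖ := norm_pos_iff.2 hv
  have hL := hasLaw_normalized_sum hZm hZ hI hS hn
  set σ := specNorm S
  set f : Ω → ℝ := fun ω => inner ℝ v ((√n)⁻¹ • ∑ a ∈ Finset.range n, (Z a ω - m))
  have hmeas : Measurable f :=
    ((Finset.measurable_fun_sum _ fun a _ => (hZm a).sub_const m).const_smul (√n)⁻¹).const_inner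
  have hR := (CFC_sqrt_posSemidef S).1
  have hmgf : ∀ c : ℝ, ∫⁻ ω, ENNReal.ofReal (Real.exp (c * f ω)) ∂P
      ≤ ENNReal.ofReal (Real.exp (c ^ 2 * (σ * ‖v‖ ^ 2) / 2)) := by
    intro c
    have h1 := hL.lintegral_comp (f := fun y => ENNReal.ofReal (Real.exp (c * inner ℝ v y)))
      (by fun_prop)
    have h2 := lintegral_multivariateGaussian (m := 0) (S := S)
      (g := fun y => ENNReal.ofReal (Real.exp (c * inner ℝ v y))) (by fun_prop)
    simp only [sub_zero] at h2
    rw [h1, h2]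
    have hsa : IsSelfAdjoint (Matrix.toEuclideanCLM (𝕜 := ℝ) (CFC.sqrt S)) := by
      have : IsSelfAdjoint (CFC.sqrt S) := hR
      exact this.map _
    have h3 : ∀ w : Emb d, c * inner ℝ v (Matrix.toEuclideanCLM (𝕜 := ℝ) (CFC.sqrt S) w)
        = inner ℝ (c • Matrix.toEuclideanCLM (𝕜 := ℝ) (CFC.sqrt S) v) w := by
      intro w
      rw [← ContinuousLinearMap.adjoint_inner_left, hsa.adjoint_eq, inner_smul_left]
      simp
    simp_rw [h3]
    rw [lintegral_exp_inner_stdGaussian]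
    apply ENNReal.ofReal_le_ofReal
    apply Real.exp_le_exp.2
    have h4 : ‖Matrix.toEuclideanCLM (𝕜 := ℝ) (CFC.sqrt S) v‖ ^ 2 = quadForm S v := by
      rw [← quadForm_one, quadForm_conj hR, mul_one, CFC.sqrt_mul_sqrt_self _ hS.nonneg]
    rw [norm_smul, mul_pow, h4, Real.norm_eq_abs, sq_abs]
    have := quadForm_le_specNorm S v
    gcongr
  set s := √(2 * σ * t)
  have hss : s ^ 2 = 2 * σ * t := Real.sq_sqrt (by positivity)
  have hs0 : 0 ≤ s := Real.sqrt_nonneg _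
  -- This multiplier is threshold over variance proxy, ‖v‖ s / (σ ‖v‖²), the optimal Chernoff
  -- parameter.
  have h5 := measure_le_of_lintegral_exp_le (hmeas.const_mul (s / (σ * ‖v‖))) (t := t)
    (hmgf (s / (σ * ‖v‖)))
  refine (measure_mono fun ω hω => ?_).trans h5
  simp only [Set.mem_ofPred_eq] at hω ⊢
  have h6 := mul_le_mul_of_nonneg_left hω.le (by positivity : 0 ≤ s / (σ * ‖v‖))
  refine le_trans (le_of_eq ?_) h6
  have h7 : t = s ^ 2 / (2 * σ) := by rw [hss]; field_simp
  rw [h7]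
  field_simp
  ring

end SampleTails

/-! ### The Gaussian PAC-Bayes inequality for quadratic forms. -/

section PACBayes

variable {d : ℕ}

/-- Jensen's inequality, obtained by integrating the tangent line bound for the exponential at `t`:
g ≤ exp(-t) exp(g) + t - 1. -/
theorem integral_le_of_lintegral_exp_le {α : Type*} [MeasurableSpace α] {μ : Measure α}
    [IsProbabilityMeasure μ] {g : α → ℝ} (hg : Integrable g μ) {t : ℝ}
    (h : ∫⁻ x, ENNReal.ofReal (Real.exp (g x)) ∂μ ≤ ENNReal.ofReal (Real.exp t)) :
    ∫ x, g x ∂μ ≤ t := by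
  have hm : AEStronglyMeasurable (fun x => Real.exp (g x)) μ :=
    Real.continuous_exp.comp_aestronglyMeasurable hg.1
  have hnn : 0 ≤ᵐ[μ] fun x => Real.exp (g x) := ae_of_all _ fun x => (Real.exp_pos _).le
  have hi : Integrable (fun x => Real.exp (g x)) μ := by
    refine ⟨hm, ?_⟩
    rw [hasFiniteIntegral_iff_ofReal hnn]
    exact h.trans_lt ENNReal.ofReal_lt_top
  have h1 : ∫ x, Real.exp (g x) ∂μ ≤ Real.exp t := by
    rw [← ofReal_integral_eq_lintegral_ofReal hi hnn] at h
    exact (ENNReal.ofReal_le_ofReal_iff (Real.exp_pos _).le).1 h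
  have h2 : ∫ x, g x ∂μ ≤ ∫ x, (Real.exp (-t) * Real.exp (g x) + (t - 1)) ∂μ := by
    refine integral_mono hg ((hi.const_mul _).add (integrable_const _)) fun x => ?_
    have := Real.add_one_le_exp (g x - t)
    simp only
    rw [← Real.exp_add, neg_add_eq_sub]
    linarith
  rw [integral_add (hi.const_mul _) (integrable_const _), integral_const_mul, integral_const] at h2
  have h3 := mul_le_mul_of_nonneg_left h1 (Real.exp_pos (-t)).le
  rw [← Real.exp_add, neg_add_cancel, Real.exp_zero] at h3
  simp only [probReal_univ, one_smul] at h2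
  linarith

theorem abs_quadForm_le (B : Matrix (Fin d) (Fin d) ℝ) (v : Emb d) :
    |quadForm B v| ≤ specNorm B * ‖v‖ ^ 2 := by
  calc |quadForm B v| ≤ ‖v‖ * ‖Matrix.toEuclideanCLM (𝕜 := ℝ) B v‖ := abs_real_inner_le_norm _ _
    _ ≤ ‖v‖ * (specNorm B * ‖v‖) := by
        gcongr; exact ContinuousLinearMap.le_opNorm _ _
    _ = specNorm B * ‖v‖ ^ 2 := by ring

theorem integrable_norm_pow_stdGaussian (k : ℕ) :
    Integrable (fun w : Emb d => ‖w‖ ^ k) (stdGaussian (Emb d)) :=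
  (IsGaussian.memLp_id (stdGaussian (Emb d)) k (by simp)).integrable_norm_pow'

theorem integrable_quadForm_stdGaussian (B : Matrix (Fin d) (Fin d) ℝ) :
    Integrable (quadForm B) (stdGaussian (Emb d)) := by
  refine ((integrable_norm_pow_stdGaussian 2).const_mul (specNorm B)).mono'
    (measurable_quadForm B).aestronglyMeasurable (ae_of_all _ fun w => ?_)
  rw [Real.norm_eq_abs]
  exact abs_quadForm_le B w

theorem integrable_quadForm_sq_stdGaussian (B : Matrix (Fin d) (Fin d) ℝ) :
    Integrable (fun w => quadForm B w ^ 2) (stdGaussian (Emb d)) := by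
  refine ((integrable_norm_pow_stdGaussian 4).const_mul (specNorm B ^ 2)).mono'
    ((measurable_quadForm B).pow_const 2).aestronglyMeasurable (ae_of_all _ fun w => ?_)
  rw [Real.norm_eq_abs, abs_pow]
  calc |quadForm B w| ^ 2 ≤ (specNorm B * ‖w‖ ^ 2) ^ 2 := by
        gcongr; exact abs_quadForm_le B w
    _ = _ := by ring

theorem integral_quadForm_stdGaussian {B : Matrix (Fin d) (Fin d) ℝ} (hB : B.IsHermitian) :
    ∫ w, quadForm B w ∂(stdGaussian (Emb d)) = B.trace := by
  rw [stdGaussian_eq_map_pi_orthonormalBasis hB.eigenvectorBasis,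
    integral_map (Measurable.aemeasurable (by fun_prop)) (measurable_quadForm B).aestronglyMeasurable]
  simp_rw [quadForm_eigenvectorBasis hB]
  have hsq : Integrable (fun x : ℝ => x ^ 2) (gaussianReal 0 1) :=
    (memLp_id_gaussianReal (μ := 0) (v := 1) 2).integrable_sq
  have h1 : ∫ x, x ^ 2 ∂(gaussianReal 0 1) = 1 := by
    have := variance_id_gaussianReal (μ := 0) (v := 1)
    rw [variance_eq_integral (by fun_prop)] at this
    simpa using this
  have hmp : ∀ i : Fin d, MeasurePreserving (Function.eval i)
      (Measure.pi fun _ : Fin d => gaussianReal 0 1) (gaussianReal 0 1) := fun i =>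
    measurePreserving_eval _ i
  rw [integral_finsetSum]
  · rw [trace_eq_sum_eigenvalues_real hB]
    refine Finset.sum_congr rfl fun i _ => ?_
    rw [integral_const_mul]
    have h2 := (hmp i).hasLaw.integral_comp (f := fun x => x ^ 2) (by fun_prop)
    have h3 : ∫ x : Fin d → ℝ, x i ^ 2 ∂(Measure.pi fun _ : Fin d => gaussianReal 0 1) = 1 := by
      rw [← h1, ← h2]; rfl
    rw [h3, mul_one]
  · intro i _
    exact ((hmp i).integrable_comp_of_integrable hsq).const_mul _

/-- Bound x² by 2 exp x at x = q/(4 Tr B); the exponential moment there is at most exp(3/8) ≤ 2. The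
constant 64 is not sharp, but no fourth-moment formula is needed. -/
theorem integral_quadForm_sq_stdGaussian_le {B : Matrix (Fin d) (Fin d) ℝ} (hB : B.PosSemidef)
    (hB0 : 0 < B.trace) :
    ∫ w, quadForm B w ^ 2 ∂(stdGaussian (Emb d)) ≤ 64 * B.trace ^ 2 := by
  set τ := B.trace
  have hc : 2 * (1 / (4 * τ) * τ) = 1 / 2 := by field_simp; norm_num
  have h := lintegral_exp_quadForm_stdGaussian_le hB (c := 1 / (4 * τ)) (h := τ) (σ := τ)
    (by positivity) (specNorm_le_trace hB) (by rw [hc]; norm_num) (trace_sq_le hB)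
  have he : 1 / (4 * τ) * B.trace + (1 / (4 * τ)) ^ 2 * τ ^ 2 / (1 - 2 * (1 / (4 * τ) * τ))
      = 3 / 8 := by
    rw [hc]; change 1 / (4 * τ) * τ + _ = _; field_simp; norm_num
  rw [he] at h
  have hexp : Real.exp (3 / 8) ≤ 2 := by
    rw [← Real.le_log_iff_exp_le (by norm_num)]
    have := Real.log_two_gt_d9
    linarith
  have hnn : 0 ≤ᵐ[stdGaussian (Emb d)] fun w => Real.exp (1 / (4 * τ) * quadForm B w) :=
    ae_of_all _ fun x => (Real.exp_pos _).le
  have hm : AEStronglyMeasurable (fun w => Real.exp (1 / (4 * τ) * quadForm B w))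
      (stdGaussian (Emb d)) :=
    ((measurable_quadForm B).const_mul _).exp.aestronglyMeasurable
  have hi : Integrable (fun w => Real.exp (1 / (4 * τ) * quadForm B w)) (stdGaussian (Emb d)) := by
    refine ⟨hm, ?_⟩
    rw [hasFiniteIntegral_iff_ofReal hnn]
    exact h.trans_lt ENNReal.ofReal_lt_top
  rw [← ofReal_integral_eq_lintegral_ofReal hi hnn,
    ENNReal.ofReal_le_ofReal_iff (Real.exp_pos _).le] at h
  have h2 : ∫ w, quadForm B w ^ 2 ∂(stdGaussian (Emb d))
      ≤ ∫ w, 32 * τ ^ 2 * Real.exp (1 / (4 * τ) * quadForm B w) ∂(stdGaussian (Emb d)) := by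
    refine integral_mono (integrable_quadForm_sq_stdGaussian B) (hi.const_mul _) fun w => ?_
    have hq := quadForm_nonneg hB w
    have hx : 0 ≤ 1 / (4 * τ) * quadForm B w := by positivity
    have h3 := Real.quadratic_le_exp_of_nonneg hx
    have h4 : quadForm B w = 4 * τ * (1 / (4 * τ) * quadForm B w) := by field_simp
    simp only
    set x := 1 / (4 * τ) * quadForm B w
    rw [h4]
    have h5 : x ^ 2 ≤ 2 * Real.exp x := by linarith
    nlinarith [mul_le_mul_of_nonneg_left h5 (sq_nonneg τ)]
  rw [integral_const_mul] at h2
  have h3 := mul_le_mul_of_nonneg_left (h.trans hexp) (by positivity : 0 ≤ 32 * τ ^ 2)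
  linarith

theorem quadForm_add_smul {B : Matrix (Fin d) (Fin d) ℝ} (hB : B.IsHermitian) (v w : Emb d)
    (b : ℝ) : quadForm B (v + b • w) = quadForm B v
      + 2 * b * inner ℝ (Matrix.toEuclideanCLM (𝕜 := ℝ) B v) w + b ^ 2 * quadForm B w := by
  have h : IsSelfAdjoint (Matrix.toEuclideanCLM (𝕜 := ℝ) B) := by
    have : IsSelfAdjoint B := hB
    exact this.map _
  have h2 := ContinuousLinearMap.adjoint_inner_left (Matrix.toEuclideanCLM (𝕜 := ℝ) B) w v
  rw [h.adjoint_eq] at h2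
  rw [quadForm, quadForm, quadForm]
  simp only [map_add, map_smul, inner_add_left, inner_add_right, inner_smul_left, inner_smul_right,
    conj_trivial]
  rw [← h2, real_inner_comm (Matrix.toEuclideanCLM (𝕜 := ℝ) B v) w]
  ring

theorem integrable_inner_stdGaussian (z : Emb d) :
    Integrable (fun w => inner ℝ z w) (stdGaussian (Emb d)) :=
  IsGaussian.integrable_dual (stdGaussian (Emb d)) (innerSL ℝ z)

theorem integral_inner_stdGaussian (z : Emb d) :
    ∫ w, inner ℝ z w ∂(stdGaussian (Emb d)) = 0 :=
  integral_strongDual_stdGaussian (innerSL ℝ z)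

theorem integrable_quadForm_add_smul {B : Matrix (Fin d) (Fin d) ℝ} (hB : B.IsHermitian)
    (v : Emb d) (b : ℝ) :
    Integrable (fun w => quadForm B (v + b • w)) (stdGaussian (Emb d)) := by
  simp_rw [quadForm_add_smul hB]
  exact ((integrable_const _).add ((integrable_inner_stdGaussian _).const_mul _)).add
    ((integrable_quadForm_stdGaussian B).const_mul _)

theorem integral_quadForm_add_smul {B : Matrix (Fin d) (Fin d) ℝ} (hB : B.IsHermitian)
    (v : Emb d) (b : ℝ) :
    ∫ w, quadForm B (v + b • w) ∂(stdGaussian (Emb d)) = quadForm B v + b ^ 2 * B.trace := by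
  simp_rw [quadForm_add_smul hB]
  have i1 : Integrable (fun _ : Emb d => quadForm B v) (stdGaussian (Emb d)) := integrable_const _
  have i2 := (integrable_inner_stdGaussian (Matrix.toEuclideanCLM (𝕜 := ℝ) B v)).const_mul (2 * b)
  have i3 := (integrable_quadForm_stdGaussian B).const_mul (b ^ 2)
  have e1 := integral_add (i1.add i2) i3
  have e2 := integral_add i1 i2
  simp only [Pi.add_apply] at e1 e2
  rw [e1, e2, integral_const_mul, integral_const_mul, integral_inner_stdGaussian,
    integral_quadForm_stdGaussian hB]
  simp

/-- The variational (PAC-Bayes) argument: a bound on a Gaussian mixture of exponentials of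
`quadForm S - quadForm A` bounds this form uniformly. -/
theorem quadForm_sub_le_of_lintegral_exp_le {A S : Matrix (Fin d) (Fin d) ℝ} (hA : A.IsHermitian)
    (hS : S.PosSemidef) (hS0 : 0 < S.trace) {ν l b t : ℝ} (hν : 0 < ν) (hl : 0 < l) (hb : 0 < b)
    (H : ∫⁻ w, ENNReal.ofReal (Real.exp (ν * (-l * quadForm A (b • w) + l * quadForm S (b • w)
        - l ^ 2 * quadForm S (b • w) ^ 2))) ∂(stdGaussian (Emb d)) ≤ ENNReal.ofReal (Real.exp t))
    (v : Emb d) :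
    ν * l * (quadForm S v - quadForm A v)
      ≤ ν * l * (b ^ 2 * (A.trace - S.trace))
        + 8 * ν * l ^ 2 * (quadForm S v ^ 2 + 64 * b ^ 4 * S.trace ^ 2) + t
        + ‖v‖ ^ 2 / (2 * b ^ 2) := by
  have hm : Measurable fun w : Emb d => ENNReal.ofReal (Real.exp (ν * (-l * quadForm A (b • w)
      + l * quadForm S (b • w) - l ^ 2 * quadForm S (b • w) ^ 2))) := by
    have h1 := (measurable_quadForm A).comp (measurable_const_smul (α := Emb d) b)
    have h2 := (measurable_quadForm S).comp (measurable_const_smul (α := Emb d) b)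
    exact (((h1.const_mul _).add (h2.const_mul _)).sub
      ((h2.pow_const 2).const_mul _)).const_mul _ |>.exp.ennreal_ofReal
  -- The shift moves the prior N(0, b² I) on directions to the posterior N(v, b² I). The logarithm
  -- of the density integrates to minus the relative entropy ‖v‖²/(2b²), and Jensen's inequality
  -- bounds the posterior mean of the exponent.
  rw [lintegral_stdGaussian_shift (b⁻¹ • v) hm] at H
  set u := b⁻¹ • v with hu
  have hbu : ∀ w : Emb d, b • (w + u) = v + b • w := by
    intro w
    rw [smul_add, hu, smul_smul, mul_inv_cancel₀ hb.ne', one_smul, add_comm]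
  set g : Emb d → ℝ := fun w => ν * (-l * quadForm A (v + b • w) + l * quadForm S (v + b • w)
    - 8 * l ^ 2 * (quadForm S v ^ 2 + b ^ 4 * quadForm S w ^ 2)) - inner ℝ u w - ‖u‖ ^ 2 / 2 with hg
  have i1 := (integrable_quadForm_add_smul hA v b).const_mul (-l)
  have i2 := (integrable_quadForm_add_smul hS.1 v b).const_mul l
  have i3 : Integrable (fun w => 8 * l ^ 2 * (quadForm S v ^ 2 + b ^ 4 * quadForm S w ^ 2))
      (stdGaussian (Emb d)) :=
    ((integrable_const _).add ((integrable_quadForm_sq_stdGaussian S).const_mul _)).const_mul _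
  have i4 := (((i1.add i2).sub i3).const_mul ν)
  have hgi : Integrable g (stdGaussian (Emb d)) :=
    (i4.sub (integrable_inner_stdGaussian u)).sub (integrable_const _)
  have hgint : ∫ w, g w ∂(stdGaussian (Emb d))
      = ν * (-l * (quadForm A v + b ^ 2 * A.trace) + l * (quadForm S v + b ^ 2 * S.trace)
        - 8 * l ^ 2 * (quadForm S v ^ 2 + b ^ 4 * ∫ w, quadForm S w ^ 2 ∂(stdGaussian (Emb d))))
        - ‖u‖ ^ 2 / 2 := by
    have e1 : ∫ w, g w ∂(stdGaussian (Emb d)) = _ :=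
      integral_sub (i4.sub (integrable_inner_stdGaussian u)) (integrable_const _)
    have e2 := integral_sub i4 (integrable_inner_stdGaussian u)
    have e3 := integral_sub (i1.add i2) i3
    have e4 := integral_add i1 i2
    simp only [Pi.add_apply, Pi.sub_apply] at e1 e2 e3 e4
    rw [e1, e2, integral_const_mul, e3, e4, integral_const_mul, integral_const_mul,
      integral_const_mul, integral_add (integrable_const _)
      ((integrable_quadForm_sq_stdGaussian S).const_mul _), integral_const_mul,
      integral_quadForm_add_smul hA, integral_quadForm_add_smul hS.1, integral_inner_stdGaussian]
    simp
  have hle : ∫ w, g w ∂(stdGaussian (Emb d)) ≤ t := by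
    refine integral_le_of_lintegral_exp_le hgi (le_trans (lintegral_mono fun w => ?_) H)
    rw [hbu, ← ENNReal.ofReal_mul (Real.exp_pos _).le, ← Real.exp_add]
    apply ENNReal.ofReal_le_ofReal
    apply Real.exp_le_exp.2
    -- Nonnegativity of the form at v - b w controls the cross term, as in the parallelogram law.
    have hq : quadForm S (v + b • w) ^ 2 ≤ 8 * (quadForm S v ^ 2 + b ^ 4 * quadForm S w ^ 2) := by
      have p1 := quadForm_nonneg hS (v + b • w)
      have p2 := quadForm_nonneg hS (v + (-b) • w)
      have p3 := quadForm_add_smul hS.1 v w b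
      have p4 := quadForm_add_smul hS.1 v w (-b)
      have p5 : quadForm S (v + b • w) ≤ 2 * quadForm S v + 2 * (b ^ 2 * quadForm S w) := by
        rw [p4] at p2; rw [p3]; nlinarith
      calc quadForm S (v + b • w) ^ 2 ≤ (2 * quadForm S v + 2 * (b ^ 2 * quadForm S w)) ^ 2 := by
            gcongr
        _ ≤ _ := by nlinarith [sq_nonneg (quadForm S v - b ^ 2 * quadForm S w)]
    have hq2 := mul_le_mul_of_nonneg_left hq (by positivity : 0 ≤ ν * l ^ 2)
    simp only [hg]
    linarith
  rw [hgint] at hle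
  have hI := mul_le_mul_of_nonneg_left (integral_quadForm_sq_stdGaussian_le hS hS0)
    (by positivity : 0 ≤ 8 * ν * l ^ 2 * b ^ 4)
  have hun : ‖u‖ ^ 2 / 2 = ‖v‖ ^ 2 / (2 * b ^ 2) := by
    rw [hu, norm_smul, mul_pow, norm_inv, Real.norm_eq_abs, inv_pow, sq_abs]
    field_simp
  rw [hun] at hle
  linarith

end PACBayes

/-! ### A uniform lower bound for the empirical second-moment form. -/

section LowerTailForm

variable {d : ℕ} {Ω : Type*} [MeasurableSpace Ω] {P : Measure Ω}
  {Z : ℕ → Ω → Emb d} {m : Emb d} {S : Matrix (Fin d) (Fin d) ℝ}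

/-- The second-moment matrix about `m` of the first `n` elements of a stream. -/
noncomputable def secondMoment (x : ℕ → Emb d) (m : Emb d) (n : ℕ) : Matrix (Fin d) (Fin d) ℝ :=
  (n : ℝ)⁻¹ • ∑ i ∈ Finset.range n,
    Matrix.vecMulVec (fun k => (x i - m) k) (fun k => (x i - m) k)

theorem quadForm_secondMoment (x : ℕ → Emb d) (m : Emb d) (n : ℕ) (v : Emb d) :
    quadForm (secondMoment x m n) v
      = (n : ℝ)⁻¹ * ∑ i ∈ Finset.range n, inner ℝ (x i - m) v ^ 2 := by
  rw [secondMoment, quadForm_smul, quadForm_sum]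
  simp_rw [quadForm_vecMulVec]

theorem posSemidef_vecMulVec_real (u : Fin d → ℝ) : (Matrix.vecMulVec u u).PosSemidef := by
  simpa using Matrix.posSemidef_vecMulVec_self_star u

theorem posSemidef_secondMoment (x : ℕ → Emb d) (m : Emb d) (n : ℕ) :
    (secondMoment x m n).PosSemidef :=
  (Matrix.posSemidef_sum _ fun _ _ => posSemidef_vecMulVec_real _).smul (by positivity)

theorem trace_mul_vecMulVec (M : Matrix (Fin d) (Fin d) ℝ) (v : Emb d) :
    (M * Matrix.vecMulVec (fun k => v k) (fun k => v k)).trace = quadForm M v := by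
  rw [quadForm_eq_dotProduct, Matrix.mul_vecMulVec, Matrix.trace_vecMulVec, dotProduct_comm]

theorem trace_secondMoment_mul (x : ℕ → Emb d) (m : Emb d) (n : ℕ)
    (M : Matrix (Fin d) (Fin d) ℝ) :
    (secondMoment x m n * M).trace
      = (n : ℝ)⁻¹ * ∑ i ∈ Finset.range n, quadForm M (x i - m) := by
  rw [Matrix.trace_mul_comm, secondMoment, Matrix.mul_smul, Matrix.trace_smul, Matrix.mul_sum,
    Matrix.trace_sum, smul_eq_mul]
  simp_rw [trace_mul_vecMulVec]

/-- For a fixed direction with form value s, the subtracted l² s² is exactly the second-order term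
in the lower exponential moment of a rank-one form, so the expectation is at most 1. Tonelli carries
this over to the Gaussian mixture of directions; joint measurability is needed for the exchange. -/
theorem lintegral_mixture_le_one (hZm : ∀ a, Measurable (Z a))
    (hZ : ∀ a, HasLaw (Z a) (multivariateGaussian m S) P) (hI : iIndepFun Z P)
    (hS : S.PosSemidef) {l : ℝ} (hl : 0 < l) (b : ℝ) {n : ℕ} (hn : 0 < n) :
    Measurable (fun ω => ∫⁻ w, ENNReal.ofReal (Real.exp (n * (-l * quadForm
        (secondMoment (fun i => Z i ω) m n) (b • w) + l * quadForm S (b • w)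
        - l ^ 2 * quadForm S (b • w) ^ 2))) ∂(stdGaussian (Emb d))) ∧
    ∫⁻ ω, ∫⁻ w, ENNReal.ofReal (Real.exp (n * (-l * quadForm
        (secondMoment (fun i => Z i ω) m n) (b • w) + l * quadForm S (b • w)
        - l ^ 2 * quadForm S (b • w) ^ 2))) ∂(stdGaussian (Emb d)) ∂P ≤ 1 := by
  have hP : IsProbabilityMeasure P := (hZ 0).isProbabilityMeasure
  have hj : Measurable (fun p : Ω × Emb d => ENNReal.ofReal (Real.exp (n * (-l * quadForm
        (secondMoment (fun i => Z i p.1) m n) (b • p.2) + l * quadForm S (b • p.2)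
        - l ^ 2 * quadForm S (b • p.2) ^ 2)))) := by
    have h2 : Measurable fun p : Ω × Emb d => quadForm S (b • p.2) :=
      (measurable_quadForm S).comp (measurable_snd.const_smul b)
    have h1 : Measurable fun p : Ω × Emb d =>
        quadForm (secondMoment (fun i => Z i p.1) m n) (b • p.2) := by
      simp_rw [quadForm_secondMoment]
      refine Measurable.const_mul (Finset.measurable_fun_sum _ fun a _ => ?_) _
      exact ((((hZm a).comp measurable_fst).sub_const m).inner
        (measurable_snd.const_smul b)).pow_const 2
    exact (((h1.const_mul _).add (h2.const_mul _)).sub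
      ((h2.pow_const 2).const_mul _)).const_mul _ |>.exp.ennreal_ofReal
  refine ⟨hj.lintegral_prod_right', ?_⟩
  rw [lintegral_lintegral_swap hj.aemeasurable]
  have hn0 : (n : ℝ) ≠ 0 := by positivity
  calc _ ≤ ∫⁻ _, 1 ∂(stdGaussian (Emb d)) := lintegral_mono fun w => ?_
    _ = 1 := by simp
  set θ := b • w
  set s := quadForm S θ
  have hs : 0 ≤ s := quadForm_nonneg hS θ
  set M := Matrix.vecMulVec (fun k => θ k) (fun k => θ k)
  have hM : M.PosSemidef := posSemidef_vecMulVec_real _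
  have h1 : ∀ ω, ENNReal.ofReal (Real.exp (n * (-l * quadForm
        (secondMoment (fun i => Z i ω) m n) θ + l * s - l ^ 2 * s ^ 2)))
      = ENNReal.ofReal (Real.exp (n * (l * s - l ^ 2 * s ^ 2)))
        * ENNReal.ofReal (Real.exp (-l * ∑ a ∈ Finset.range n, quadForm M (Z a ω - m))) := by
    intro ω
    rw [← ENNReal.ofReal_mul (Real.exp_pos _).le, ← Real.exp_add, quadForm_secondMoment]
    congr 2
    simp_rw [M, quadForm_vecMulVec, real_inner_comm θ]
    field_simp
    ring
  simp_rw [h1]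
  rw [lintegral_const_mul' _ _ ENNReal.ofReal_ne_top, lintegral_exp_sum_quadForm hZm hZ hI]
  have h2 := lintegral_exp_neg_quadForm_stdGaussian_le
    (PosSemidef.conj_self hM (CFC_sqrt_posSemidef S).1) hl.le
  rw [trace_sqrt_conj hS, trace_mul_vecMulVec] at h2
  calc _ ≤ ENNReal.ofReal (Real.exp (n * (l * s - l ^ 2 * s ^ 2)))
        * ENNReal.ofReal (Real.exp (-l * s + l ^ 2 * s ^ 2)) ^ n := by
        gcongr
    _ = 1 := by
        rw [ofReal_exp_pow, ← ENNReal.ofReal_mul (Real.exp_pos _).le, ← Real.exp_add]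
        ring_nf
        simp

/-- Markov's inequality is applied once, to the mixture. On the resulting event the variational
bound holds for all directions simultaneously, without a net on the sphere. -/
theorem measure_quadForm_lower (hZm : ∀ a, Measurable (Z a))
    (hZ : ∀ a, HasLaw (Z a) (multivariateGaussian m S) P) (hI : iIndepFun Z P)
    (hS : S.PosSemidef) (hS0 : 0 < S.trace) {l b t : ℝ} (hl : 0 < l) (hb : 0 < b)
    {n : ℕ} (hn : 0 < n) :
    P {ω | ¬ ∀ v : Emb d, n * l * (quadForm S v - quadForm (secondMoment (fun i => Z i ω) m n) v)
      ≤ n * l * (b ^ 2 * ((secondMoment (fun i => Z i ω) m n).trace - S.trace))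
        + 8 * n * l ^ 2 * (quadForm S v ^ 2 + 64 * b ^ 4 * S.trace ^ 2) + t
        + ‖v‖ ^ 2 / (2 * b ^ 2)} ≤ ENNReal.ofReal (Real.exp (-t)) := by
  obtain ⟨hFm, hF⟩ := lintegral_mixture_le_one hZm hZ hI hS hl b hn
  set F : Ω → ℝ≥0∞ := fun ω => ∫⁻ w, ENNReal.ofReal (Real.exp (n * (-l * quadForm
        (secondMoment (fun i => Z i ω) m n) (b • w) + l * quadForm S (b • w)
        - l ^ 2 * quadForm S (b • w) ^ 2))) ∂(stdGaussian (Emb d)) with hFdef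
  have h1 := meas_ge_le_lintegral_div (μ := P) hFm.aemeasurable (ε := ENNReal.ofReal (Real.exp t))
    (by simp [Real.exp_pos]) ENNReal.ofReal_ne_top
  refine (measure_mono fun ω hω => ?_).trans (h1.trans ?_)
  · by_contra hlt
    apply hω
    have hlt' : F ω ≤ ENNReal.ofReal (Real.exp t) := (not_le.1 hlt).le
    exact quadForm_sub_le_of_lintegral_exp_le (posSemidef_secondMoment _ _ _).1 hS hS0
      (by positivity) hl hb hlt'
  · rw [Real.exp_neg, ENNReal.ofReal_inv_of_pos (Real.exp_pos t), ← one_div]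
    gcongr

end LowerTailForm

/-! ### Algebra of the empirical mean, covariance and Fréchet distance. -/

section Empirical

variable {d : ℕ}

theorem empMean_sub {x : ℕ → Emb d} {n : ℕ} (hn : 0 < n) (m : Emb d) :
    empMean x n - m = (n : ℝ)⁻¹ • ∑ i ∈ Finset.range n, (x i - m) := by
  have hn0 : (n : ℝ) ≠ 0 := by positivity
  rw [empMean, Finset.sum_sub_distrib, smul_sub, Finset.sum_const, Finset.card_range,
    ← Nat.cast_smul_eq_nsmul ℝ n m, smul_smul, inv_mul_cancel₀ hn0, one_smul]

theorem normalized_sum_eq {x : ℕ → Emb d} {n : ℕ} (hn : 0 < n) (m : Emb d) :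
    (√n)⁻¹ • ∑ i ∈ Finset.range n, (x i - m) = √n • (empMean x n - m) := by
  rw [empMean_sub hn, smul_smul]
  congr 1
  rw [← div_eq_mul_inv, Real.sqrt_div_self]

theorem empCov_posSemidef (x : ℕ → Emb d) (n : ℕ) : (empCov x n).PosSemidef :=
  posSemidef_secondMoment x (empMean x n) n

theorem empCov_eq {x : ℕ → Emb d} {n : ℕ} (hn : 0 < n) (m : Emb d) :
    empCov x n = secondMoment x m n
      - Matrix.vecMulVec (fun k => (empMean x n - m) k) (fun k => (empMean x n - m) k) := by
  have hn0 : (n : ℝ) ≠ 0 := by positivity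
  have he := empMean_sub (x := x) hn m
  set e := empMean x n - m
  have h1 : ∀ i, x i - empMean x n = (x i - m) - e := by intro i; simp [e]
  ext k l
  have hk : ∀ k, e k = (n : ℝ)⁻¹ * ∑ i ∈ Finset.range n, (x i - m) k := by
    intro k
    conv_lhs => rw [he]
    simp [WithLp.ofLp_sum]
  have hk' : ∀ k, ∑ i ∈ Finset.range n, (x i - m) k = n * e k := by
    intro k; rw [hk]; field_simp
  simp only [empCov, secondMoment, Matrix.sub_apply, Matrix.smul_apply, Matrix.sum_apply,
    Matrix.vecMulVec_apply, smul_eq_mul, h1]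
  have h2 : ∀ i, ((x i - m) - e) k * ((x i - m) - e) l
      = (x i - m) k * (x i - m) l - e l * (x i - m) k - e k * (x i - m) l + e k * e l := by
    intro i
    simp only [PiLp.sub_apply]
    ring
  simp_rw [h2]
  rw [Finset.sum_add_distrib, Finset.sum_sub_distrib, Finset.sum_sub_distrib, ← Finset.mul_sum,
    ← Finset.mul_sum, hk', hk', Finset.sum_const, Finset.card_range, nsmul_eq_mul]
  field_simp
  ring

theorem trace_vecMulVec_self (e : Emb d) :
    (Matrix.vecMulVec (fun k => e k) (fun k => e k)).trace = ‖e‖ ^ 2 := by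
  rw [Matrix.trace_vecMulVec, EuclideanSpace.real_norm_sq_eq]
  simp [dotProduct, sq]

theorem frechetDist_eq {m mr : Emb d} {S Sr : Matrix (Fin d) (Fin d) ℝ} (hSr : Sr.PosDef) :
    frechetDist m mr S Sr
      = ‖m - mr‖ ^ 2 + S.trace + Sr.trace - 2 * traceSqrtConj (CFC.sqrt Sr) S := by
  rw [frechetDist, Matrix.trace_sub, Matrix.trace_add, Matrix.trace_smul, trace_prodSqrt hSr,
    smul_eq_mul]
  ring

/-- The squared bias of the empirical mean cancels in the error of the empirical distance. -/
theorem empFrechetDist_sub {x : ℕ → Emb d} {n : ℕ} (hn : 0 < n) {m mr : Emb d}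
    {S Sr : Matrix (Fin d) (Fin d) ℝ} (hSr : Sr.PosDef) :
    empFrechetDist x n mr Sr - frechetDist m mr S Sr
      = 2 * inner ℝ (m - mr) (empMean x n - m) + ((secondMoment x m n).trace - S.trace)
        - 2 * (traceSqrtConj (CFC.sqrt Sr) (empCov x n) - traceSqrtConj (CFC.sqrt Sr) S) := by
  rw [empFrechetDist, frechetDist_eq hSr, frechetDist_eq hSr]
  have h1 : (empCov x n).trace = (secondMoment x m n).trace - ‖empMean x n - m‖ ^ 2 := by
    rw [empCov_eq hn m, Matrix.trace_sub, trace_vecMulVec_self]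
  have h2 : ‖empMean x n - mr‖ ^ 2 = ‖m - mr‖ ^ 2
      + 2 * inner ℝ (m - mr) (empMean x n - m) + ‖empMean x n - m‖ ^ 2 := by
    rw [← norm_add_sq_real]
    congr 2
    abel
  rw [h1, h2]
  ring

theorem trace_sq_le_specNorm_mul {S : Matrix (Fin d) (Fin d) ℝ} (hS : S.PosSemidef) :
    (S ^ 2).trace ≤ specNorm S * S.trace := by
  rw [trace_sq_eq_sum_eigenvalues hS.1]
  conv_rhs => rw [trace_eq_sum_eigenvalues_real hS.1]
  rw [Finset.mul_sum]
  refine Finset.sum_le_sum fun i _ => ?_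
  rw [sq]
  exact mul_le_mul_of_nonneg_right (eigenvalues_le_specNorm hS.1 i) (hS.eigenvalues_nonneg i)

theorem effRank_mul_specNorm {S : Matrix (Fin d) (Fin d) ℝ} (hS : 0 < specNorm S) :
    S.trace = effRank S * specNorm S := by
  rw [effRank, div_mul_cancel₀ _ hS.ne']

theorem one_le_effRank {S : Matrix (Fin d) (Fin d) ℝ} (hS : S.PosSemidef) (hS0 : 0 < specNorm S) :
    1 ≤ effRank S := by
  rw [effRank, one_le_div hS0]
  exact specNorm_le_trace hS

theorem effRank_nonneg {S : Matrix (Fin d) (Fin d) ℝ} (hS : S.PosSemidef) : 0 ≤ effRank S :=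
  div_nonneg hS.trace_nonneg (specNorm_nonneg S)

theorem meanErr_nonneg (S : Matrix (Fin d) (Fin d) ℝ) (η : ℝ) (n : ℕ) : 0 ≤ meanErr S η n :=
  Real.sqrt_nonneg _

theorem meanErr_sq (S : Matrix (Fin d) (Fin d) ℝ) {η : ℝ} (hη : 0 ≤ Real.log (6 / η)) (n : ℕ) :
    meanErr S η n ^ 2 = 1 / n * (√(8 * (S ^ 2).trace * Real.log (6 / η))
      + 8 * specNorm S * Real.log (6 / η)) := by
  rw [meanErr, Real.sq_sqrt]
  have := specNorm_nonneg S
  positivity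

theorem log_three_ge_one : 1 ≤ Real.log 3 := by
  rw [Real.le_log_iff_exp_le (by norm_num)]
  linarith [Real.exp_one_lt_d9]

theorem log_six_div_eq {η : ℝ} (hη : 0 < η) :
    Real.log (6 / η) = Real.log 2 + Real.log (3 / η) := by
  rw [← Real.log_mul (by norm_num) (by positivity)]
  ring_nf

theorem one_le_log_three_div {η : ℝ} (hη : 0 < η) (hη1 : η ≤ 1) : 1 ≤ Real.log (3 / η) := by
  rw [Real.log_div (by norm_num) hη.ne']
  linarith [log_three_ge_one, Real.log_nonpos hη.le hη1]

theorem bonus_nonneg {κ : ℝ} {mr : Emb d} {S Sr : Matrix (Fin d) (Fin d) ℝ} (hS : S.PosSemidef)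
    {η : ℝ} (hη : 0 ≤ Real.log (6 / η)) (x : ℕ → Emb d) (n : ℕ) :
    0 ≤ bonus κ mr S Sr η x n := by
  have h1 := meanErr_nonneg S η n
  have h2 := (CFC_sqrt_posSemidef Sr).trace_nonneg
  have h3 := hS.trace_nonneg
  have h4 := specNorm_nonneg S
  unfold bonus
  positivity

end Empirical

/-! ### The score of a model rarely exceeds its Fréchet distance: deterministic part. -/

section Optimism

variable {d : ℕ}

/-- The parameters b² = 1/(7r) and l = ρ/(4σ) balance the variational bound. After division by ν l,
the trace fluctuation contributes at most 1, the quadratic penalty at most 6, and the deviation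
level with the entropy at most 7 times σρ. -/
theorem sub_le_of_variational_bound {ν σ r τ L t ρ l x V qS qA : ℝ} (hν : 0 < ν) (hσ : 0 < σ)
    (hr : 1 ≤ r) (hτ : τ = r * σ) (ht : t ≤ 17 / 10 * L) (hρ : 0 < ρ)
    (hρ1 : ρ ≤ 1) (hρν : ρ ^ 2 * ν = 4 * r + L) (hL : 0 ≤ L) (hx : 0 ≤ x) (hxν : x ^ 2 * ν = t)
    (hV : V - τ ≤ 2 * τ * x + 2 * σ * x ^ 2) (hq0 : 0 ≤ qS) (hq : qS ≤ σ) (hl : l * (4 * σ) = ρ)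
    (H : ν * l * (qS - qA) ≤ ν * l * (1 / (7 * r) * (V - τ))
      + 8 * ν * l ^ 2 * (qS ^ 2 + 64 * (1 / (7 * r)) ^ 2 * τ ^ 2) + t + 1 / (2 * (1 / (7 * r)))) :
    qS - qA ≤ 14 * (σ * ρ) := by
  have hr0 : 0 < r := by linarith
  have hl0 : 0 < l := by
    by_contra hneg
    nlinarith [mul_nonneg (neg_nonneg.2 (not_lt.1 hneg)) hσ.le]
  have hxρ : x ≤ 7 / 5 * ρ := by
    refine abs_le_of_sq_le_sq' ?_ (by positivity) |>.2
    have : x ^ 2 * ν ≤ (7 / 5 * ρ) ^ 2 * ν := by nlinarith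
    exact le_of_mul_le_mul_right this hν
  have h1 : 1 / (7 * r) * (V - τ) ≤ σ * ρ := by
    rw [one_div, inv_mul_le_iff₀ (by positivity)]
    have h2 : 2 * τ * x ≤ 14 / 5 * (r * (σ * ρ)) := by
      rw [hτ]; nlinarith [mul_le_mul_of_nonneg_left hxρ (by positivity : 0 ≤ r * σ)]
    have h3 : x ^ 2 ≤ (7 / 5) ^ 2 * ρ := by
      calc x ^ 2 ≤ (7 / 5 * ρ) ^ 2 := by gcongr
        _ = (7 / 5) ^ 2 * (ρ * ρ) := by ring
        _ ≤ (7 / 5) ^ 2 * (ρ * 1) := by gcongr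
        _ = _ := by ring
    have h4 : 2 * σ * x ^ 2 ≤ 98 / 25 * (r * (σ * ρ)) := by
      have := mul_le_mul_of_nonneg_left h3 (by positivity : 0 ≤ 2 * σ)
      have h5 : σ * ρ ≤ r * (σ * ρ) := le_mul_of_one_le_left (by positivity) hr
      linarith
    nlinarith [mul_pos hr0 (mul_pos hσ hρ)]
  have h2 : 8 * l * (qS ^ 2 + 64 * (1 / (7 * r)) ^ 2 * τ ^ 2) ≤ 6 * (σ * ρ) := by
    have h3 : 64 * (1 / (7 * r)) ^ 2 * τ ^ 2 = 64 / 49 * σ ^ 2 := by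
      rw [hτ]; field_simp; norm_num
    rw [h3, ← hl]
    have h4 : qS ^ 2 ≤ σ ^ 2 := by gcongr
    have := mul_le_mul_of_nonneg_left h4 hl0.le
    nlinarith [mul_pos hl0 (mul_pos hσ hσ)]
  have h3 : t + 1 / (2 * (1 / (7 * r))) ≤ ν * l * (7 * (σ * ρ)) := by
    have h4 : 1 / (2 * (1 / (7 * r))) = 7 / 2 * r := by field_simp
    have h5 : ν * l * (7 * (σ * ρ)) = 7 / 4 * (ρ ^ 2 * ν) := by
      have : σ * l = ρ / 4 := by linarith
      calc ν * l * (7 * (σ * ρ)) = 7 * ν * ρ * (σ * l) := by ring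
        _ = _ := by rw [this]; ring
    rw [h4, h5, hρν]
    linarith
  have h4 : ν * l * (qS - qA) ≤ ν * l * (14 * (σ * ρ)) := by
    have hνl : 0 < ν * l := by positivity
    have p1 := mul_le_mul_of_nonneg_left h1 hνl.le
    have p2 := mul_le_mul_of_nonneg_left h2 hνl.le
    have p3 : 8 * ν * l ^ 2 * (qS ^ 2 + 64 * (1 / (7 * r)) ^ 2 * τ ^ 2)
      = ν * l * (8 * l * (qS ^ 2 + 64 * (1 / (7 * r)) ^ 2 * τ ^ 2)) := by ring
    rw [p3] at H
    linarith
  exact le_of_mul_le_mul_left h4 (by positivity)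

/-- The arithmetic-geometric mean inequality for τ and σt, as h² t ≤ τ · σt. -/
theorem two_mul_mul_sqrt_le {h σ τ t : ℝ} (hσ : 0 ≤ σ) (hτ : 0 ≤ τ) (ht : 0 ≤ t)
    (hh2 : h ^ 2 ≤ σ * τ) : 2 * h * √t ≤ τ + σ * t := by
  have hst : √t ^ 2 = t := Real.sq_sqrt ht
  refine abs_le_of_sq_le_sq' ?_ (by positivity) |>.2
  have h1 : (2 * h * √t) ^ 2 = 4 * (h ^ 2 * t) := by rw [mul_pow, mul_pow, hst]; ring
  have h2 := mul_le_mul_of_nonneg_right hh2 ht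
  have h3 : (τ + σ * t) ^ 2 = (τ - σ * t) ^ 2 + 4 * (σ * τ * t) := by ring
  rw [h1, h3]
  linarith [sq_nonneg (τ - σ * t)]

theorem sq_norm_le_of_deviation {ν σ r τ L t ρ h E : ℝ} (hν : 0 < ν) (hσ : 0 < σ)
    (hr : 1 ≤ r) (hτ : τ = r * σ) (ht0 : 0 ≤ t) (ht : t ≤ 17 / 10 * L) (hL : 1 ≤ L)
    (hρ0 : 0 ≤ ρ) (hρ1 : ρ ≤ 1) (hρν : ρ ^ 2 * ν = 4 * r + L) (hh2 : h ^ 2 ≤ σ * τ) (H : E * ν ≤ τ + 2 * h * √t + 2 * σ * t) :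
    E ≤ 6 * (σ * ρ) := by
  have hτ0 : 0 ≤ τ := by rw [hτ]; positivity
  have h1 := two_mul_mul_sqrt_le hσ.le hτ0 ht0 hh2
  have h3 : 2 * τ + 3 * (σ * t) ≤ 6 * σ * (ρ ^ 2 * ν) := by
    rw [hρν, hτ]
    have p1 := mul_le_mul_of_nonneg_left ht hσ.le
    have p2 : 0 ≤ σ * r := by positivity
    have p3 : 0 ≤ σ * L := by positivity
    linarith
  have h4 : ρ ^ 2 ≤ ρ := by
    rw [sq]; exact mul_le_of_le_one_left hρ0 hρ1
  have h5 := mul_le_mul_of_nonneg_left h4 (by positivity : 0 ≤ 6 * σ * ν)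
  refine le_of_mul_le_mul_right (a := ν) ?_ hν
  linarith

theorem inner_le_of_le_sqrt {v e : Emb d} {n : ℕ} (hn : 0 < n) {a : ℝ}
    (h : inner ℝ v (√n • e) ≤ ‖v‖ * √a) : inner ℝ v e ≤ ‖v‖ * √(a / n) := by
  have hs : 0 < √(n : ℝ) := by positivity
  rw [inner_smul_right] at h
  rw [Real.sqrt_div' _ (by positivity), ← mul_div_assoc, le_div_iff₀ hs]
  linarith

set_option maxHeartbeats 1000000 in
-- On the four deviation events, each summand in the error of the empirical distance is matched with
-- a summand of the bonus: the inner product with the first, the loss in F with the second, the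
-- trace fluctuation with the last two.
theorem optimisticFD_le_frechetDist {x : ℕ → Emb d} {m mr : Emb d}
    {S Sr : Matrix (Fin d) (Fin d) ℝ}
    (hS : S.PosSemidef) (hSr : Sr.PosDef) (hσ : 0 < specNorm S) {κ η : ℝ} (hκ : 1 ≤ κ)
    (hη : 0 < η) (hη1 : η ≤ 1) {n : ℕ} (hn : 0 < n)
    (hN : 4 * effRank S + Real.log (3 / η) ≤ n)
    (hform : ∀ v : Emb d,
      n * (√((4 * effRank S + Real.log (3 / η)) / n) / (4 * specNorm S))
          * (quadForm S v - quadForm (secondMoment x m n) v)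
        ≤ n * (√((4 * effRank S + Real.log (3 / η)) / n) / (4 * specNorm S))
            * (√(1 / (7 * effRank S)) ^ 2 * ((secondMoment x m n).trace - S.trace))
          + 8 * n * (√((4 * effRank S + Real.log (3 / η)) / n) / (4 * specNorm S)) ^ 2
            * (quadForm S v ^ 2 + 64 * √(1 / (7 * effRank S)) ^ 4 * S.trace ^ 2)
          + Real.log (6 / η) + ‖v‖ ^ 2 / (2 * √(1 / (7 * effRank S)) ^ 2))
    (htrace : (secondMoment x m n).trace ≤ S.trace
      + 2 * √((S ^ 2).trace) * √(Real.log (6 / η) / n)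
      + 2 * specNorm S * (Real.log (6 / η) / n))
    (hnorm : ‖√n • (empMean x n - m)‖ ^ 2 ≤ S.trace
      + 2 * √((S ^ 2).trace) * √(Real.log (6 / η)) + 2 * specNorm S * Real.log (6 / η))
    (hinner : inner ℝ (m - mr) (√n • (empMean x n - m))
      ≤ ‖m - mr‖ * √(2 * specNorm S * Real.log (6 / η))) :
    optimisticFD κ mr S Sr η x n ≤ frechetDist m mr S Sr := by
  have hn' : (0 : ℝ) < n := by exact_mod_cast hn
  have hr := one_le_effRank hS hσ
  have hτ := effRank_mul_specNorm hσ
  have hL := one_le_log_three_div hη hη1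
  have htL := log_six_div_eq hη
  have hlog2 := Real.log_two_lt_d9
  have hlog2' := Real.log_two_gt_d9
  have hτ0 := hS.trace_nonneg
  have hh2 := trace_sq_le_specNorm_mul hS
  have hh3 := trace_sq_le hS
  have hh0 := trace_sq_nonneg hS
  set σ := specNorm S
  set r := effRank S
  set τ := S.trace
  set L := Real.log (3 / η)
  set t := Real.log (6 / η)
  set h := √((S ^ 2).trace) with hhdef
  set e := empMean x n - m with he
  set v := m - mr
  set A := secondMoment x m n
  have ht0 : 0 < t := by linarith
  -- Here t = log 2 + L with log 2 < 7/10 and L ≥ 1.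
  have ht : t ≤ 17 / 10 * L := by linarith
  have hhsq : h ^ 2 = (S ^ 2).trace := Real.sq_sqrt hh0
  have hhτ : h ≤ τ := by
    rw [hhdef]; exact Real.sqrt_le_iff.2 ⟨hτ0, hh3⟩
  have hhn : 0 ≤ h := Real.sqrt_nonneg _
  set ρ := √((4 * r + L) / n) with hρdef
  have hρ0 : 0 < ρ := Real.sqrt_pos.2 (by positivity)
  have hρν : ρ ^ 2 * n = 4 * r + L := by
    rw [hρdef, Real.sq_sqrt (by positivity)]; field_simp
  -- This is where the size of the burn-in sample is used.
  have hρ1 : ρ ≤ 1 := by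
    exact Real.sqrt_le_iff.2 ⟨zero_le_one, by rw [one_pow, div_le_one hn']; exact hN⟩
  set y := √(t / n) with hy
  have hy0 : 0 ≤ y := Real.sqrt_nonneg _
  have hyy : y ^ 2 = t / n := Real.sq_sqrt (by positivity)
  have hb2 : √(1 / (7 * r)) ^ 2 = 1 / (7 * r) := Real.sq_sqrt (by positivity)
  have hb4 : √(1 / (7 * r)) ^ 4 = (1 / (7 * r)) ^ 2 := by
    calc √(1 / (7 * r)) ^ 4 = (√(1 / (7 * r)) ^ 2) ^ 2 := by ring
      _ = _ := by rw [hb2]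
  have hσρ : 0 < σ * ρ := by positivity
  -- the quadratic form of `S` on unit vectors
  have hunit : ∀ w : Emb d, ‖w‖ = 1 → quadForm S w - quadForm A w ≤ 14 * (σ * ρ) := by
    intro w hw
    have H := hform w
    rw [hb2, hb4, hw, one_pow] at H
    refine sub_le_of_variational_bound hn' hσ hr hτ ht hρ0 hρ1 hρν (by linarith) hy0
      (by rw [hyy]; field_simp) (V := A.trace) ?_ (quadForm_nonneg hS w) ?_
      (by field_simp) H
    · rw [hyy]
      have := mul_le_mul_of_nonneg_right hhτ hy0
      linarith
    · have := quadForm_le_specNorm S w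
      rwa [hw, one_pow, mul_one] at this
  have hall : ∀ w : Emb d, quadForm S w - quadForm A w ≤ 14 * (σ * ρ) * ‖w‖ ^ 2 := by
    intro w
    rcases eq_or_ne w 0 with rfl | hw
    · simp [quadForm]
    · have hw0 : ‖w‖ ≠ 0 := norm_ne_zero_iff.2 hw
      have H := hunit (‖w‖⁻¹ • w) (norm_smul_inv_norm hw)
      rw [quadForm_smul_right, quadForm_smul_right, ← mul_sub, inv_pow,
        inv_mul_le_iff₀ (by positivity)] at H
      linarith
  have hee : ‖e‖ ^ 2 ≤ 6 * (σ * ρ) := by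
    rw [norm_smul, mul_pow, Real.norm_eq_abs, sq_abs, Real.sq_sqrt hn'.le] at hnorm
    rw [mul_comm] at hnorm
    exact sq_norm_le_of_deviation hn' hσ hr hτ ht0.le ht hL hρ0.le hρ1 hρν
      (by rw [hhsq]; exact hh2) hnorm
  -- The uniform form bound 14 and the rank-one mean correction 6 require only 20 σρ. The value 40
  -- is what the bonus affords: 2√ε = √(160 σρ), where 160 = 8 · 20 and κ ≥ 1.
  set ε := 40 * (σ * ρ)
  have hε : 0 < ε := by positivity
  have hpsd : (empCov x n + ε • 1 - S).PosSemidef := by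
    refine posSemidef_of_quadForm_nonneg
      (((empCov_posSemidef x n).1.add (isHermitian_one_smul ε)).sub hS.1) fun w => ?_
    rw [quadForm_sub, quadForm_add, quadForm_smul, quadForm_one, empCov_eq hn m, quadForm_sub,
      quadForm_vecMulVec]
    have h1 := hall w
    have h2 : inner ℝ e w ^ 2 ≤ 6 * (σ * ρ) * ‖w‖ ^ 2 := by
      calc inner ℝ e w ^ 2 ≤ (‖e‖ * ‖w‖) ^ 2 := sq_le_sq' (by
            have := neg_le_of_abs_le (abs_real_inner_le_norm e w); exact this)
            (real_inner_le_norm e w)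
        _ = ‖e‖ ^ 2 * ‖w‖ ^ 2 := by ring
        _ ≤ _ := by gcongr
    have h3 : 20 * (σ * ρ) * ‖w‖ ^ 2 ≤ ε * ‖w‖ ^ 2 := by
      gcongr; simp only [ε]; linarith
    simp only [A] at h1
    linarith
  have hR := CFC_sqrt_posDef hSr
  have hRtr := hR.posSemidef.trace_nonneg
  have hF := traceSqrtConj_le_add hR hS (empCov_posSemidef x n) hε hpsd
  have hΔ := meanErr_nonneg S η n
  have hΔ2 := meanErr_sq S ht0.le n
  set Δ := meanErr S η n
  have hcov : 2 * √ε ≤ √(8 * covErr κ S η n) := by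
    have h1 : 2 * √ε = √(4 * ε) := by
      have h2 : √(4 : ℝ) = 2 := by
        rw [(by norm_num : (4 : ℝ) = 2 ^ 2), Real.sqrt_sq (by norm_num)]
      rw [Real.sqrt_mul (by norm_num : (0 : ℝ) ≤ 4) ε, h2]
    rw [h1]
    apply Real.sqrt_le_sqrt
    have h2 : covErr κ S η n = 20 * κ ^ 2 * σ * ρ + Δ ^ 2 := rfl
    rw [h2]
    have h3 : 1 ≤ κ ^ 2 := one_le_pow₀ hκ
    have h4 := mul_le_mul_of_nonneg_right h3 hσρ.le
    simp only [ε]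
    linarith [sq_nonneg Δ]
  have hcov2 := mul_le_mul_of_nonneg_left hcov hRtr
  -- The bonus contains the observed distance ‖μ̂ - μ_r‖ instead of ‖v‖. Only a positive inner
  -- product matters, and then ‖v‖ ≤ ‖v + e‖, which is the observed distance.
  have hmean : inner ℝ v e ≤ Δ * (Δ + ‖empMean x n - mr‖) := by
    rcases le_or_gt (inner ℝ v e) 0 with h0 | h0
    · exact h0.trans (by positivity)
    · have h1 := inner_le_of_le_sqrt hn hinner
      have h2 : √(2 * σ * t / n) ≤ Δ := by
        apply Real.sqrt_le_iff.2 ⟨hΔ, ?_⟩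
        rw [hΔ2, one_div, div_eq_inv_mul]
        gcongr
        have : 0 ≤ √(8 * (S ^ 2).trace * t) := Real.sqrt_nonneg _
        linarith [mul_pos hσ ht0]
      have h3 : ‖v‖ ≤ ‖empMean x n - mr‖ := by
        have h4 : empMean x n - mr = v + e := by simp only [v, e]; abel
        rw [h4]
        refine abs_le_of_sq_le_sq' ?_ (norm_nonneg _) |>.2
        rw [norm_add_sq_real]
        linarith [sq_nonneg ‖e‖]
      calc inner ℝ v e ≤ ‖v‖ * √(2 * σ * t / n) := h1
        _ ≤ ‖empMean x n - mr‖ * Δ := by gcongr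
        _ ≤ _ := by linarith [mul_nonneg hΔ hΔ]
  have htr : A.trace - τ ≤ τ * √(8 / n * t) + 8 * σ / n * t := by
    have h1 : √(8 / n * t) = √8 * y := by
      rw [hy, ← Real.sqrt_mul (by norm_num)]; congr 1; ring
    have h2 : 2 ≤ √8 := Real.le_sqrt_of_sq_le (by norm_num)
    rw [h1]
    have h3 : 2 * h * y ≤ τ * (√8 * y) := by
      calc 2 * h * y = h * (2 * y) := by ring
        _ ≤ τ * (√8 * y) := by gcongr
    have h4 : 2 * σ * (t / n) ≤ 8 * σ / n * t := by
      have : 0 < σ * (t / n) := by positivity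
      have h5 : 8 * σ / n * t = 8 * (σ * (t / n)) := by ring
      rw [h5]; linarith
    linarith
  have hdiff := empFrechetDist_sub (x := x) (m := m) (mr := mr) (S := S) hn hSr
  have hbonus : bonus κ mr S Sr η x n = 2 * Δ * (Δ + ‖empMean x n - mr‖)
      + (CFC.sqrt Sr).trace * √(8 * covErr κ S η n) + τ * √(8 / n * t) + 8 * σ / n * t := rfl
  rw [optimisticFD, hbonus]
  linarith

end Optimism

/-! ### The amount by which the score can fall below the Fréchet distance: deterministic part. -/

section Pessimism

variable {d : ℕ}

theorem sqrt_sqrt_le_of_sq_le {a b c : ℝ} (hc : 0 ≤ c) (h : a ^ 2 ≤ c ^ 4 * b) :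
    √a ≤ c * √√b := by
  have h1 : |a| ≤ c ^ 2 * √b := by
    rw [← Real.sqrt_sq (by positivity : 0 ≤ c ^ 2), ← Real.sqrt_mul (by positivity),
      ← Real.sqrt_sq_eq_abs]
    apply Real.sqrt_le_sqrt
    rw [← pow_mul]
    exact h
  calc √a ≤ √(c ^ 2 * √b) := Real.sqrt_le_sqrt ((le_abs_self a).trans h1)
    _ = c * √√b := by rw [Real.sqrt_mul (by positivity), Real.sqrt_sq hc]

theorem sqrt_le_of_sq_le_mul {a b c k : ℝ} (hc : 0 ≤ c) (hk : 0 ≤ k) (h : a ≤ c ^ 2 * (b / k ^ 2)) :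
    √a ≤ c * √b / k := by
  calc √a ≤ √(c ^ 2 * (b / k ^ 2)) := Real.sqrt_le_sqrt h
    _ = c * √b / k := by
      rw [Real.sqrt_mul (by positivity), Real.sqrt_sq hc, Real.sqrt_div' _ (by positivity),
        Real.sqrt_sq hk, mul_div_assoc]

/-- The shape of the estimation error of a model after `n` samples. -/
noncomputable def errorRate (κ l : ℝ) (m mr : Emb d) (S Sr : Matrix (Fin d) (Fin d) ℝ)
    (n : ℕ) : ℝ :=
  26 * κ * l * ((CFC.sqrt Sr).trace * √√(specNorm S ^ 2 * (effRank S + 1))) / √√n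
    + 33 * l * ((‖m - mr‖ + (CFC.sqrt Sr).trace) * √(√((S ^ 2).trace) + specNorm S) + S.trace) / √n
    + 24 * l * (√((S ^ 2).trace) + specNorm S) / n

theorem errorRate_nonneg {κ l : ℝ} (hκ : 0 ≤ κ) (hl : 0 ≤ l) (m mr : Emb d)
    {S : Matrix (Fin d) (Fin d) ℝ} (hS : S.PosSemidef) (Sr : Matrix (Fin d) (Fin d) ℝ) (n : ℕ) :
    0 ≤ errorRate κ l m mr S Sr n := by
  have h2 := (CFC_sqrt_posSemidef Sr).trace_nonneg
  have h3 := hS.trace_nonneg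
  have h4 := specNorm_nonneg S
  unfold errorRate
  positivity

theorem meanErr_le {S : Matrix (Fin d) (Fin d) ℝ} (hS : S.PosSemidef) {η l : ℝ}
    (ht0 : 0 ≤ Real.log (6 / η)) (htl : Real.log (6 / η) ≤ l) (hl : 1 ≤ l) {n : ℕ} (hn : 0 < n) :
    meanErr S η n ^ 2 ≤ 8 * l * (√((S ^ 2).trace) + specNorm S) / n := by
  rw [meanErr_sq S ht0, one_div, inv_mul_eq_div]
  have hσ := specNorm_nonneg S
  have h1 : √(8 * (S ^ 2).trace * Real.log (6 / η)) ≤ 8 * l * √((S ^ 2).trace) := by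
    rw [← Real.sqrt_sq (by linarith : 0 ≤ 8 * l), ← Real.sqrt_mul (by positivity)]
    apply Real.sqrt_le_sqrt
    have h2 := mul_le_mul_of_nonneg_left htl (trace_sq_nonneg hS)
    have h3 : l ≤ l ^ 2 := by nlinarith
    have h4 := mul_le_mul_of_nonneg_left h3 (trace_sq_nonneg hS)
    have h5 : 0 ≤ (S ^ 2).trace * l ^ 2 := mul_nonneg (trace_sq_nonneg hS) (sq_nonneg l)
    linarith
  have h2 := mul_le_mul_of_nonneg_left htl hσ
  gcongr
  linarith

theorem sqrt_add_le_sqrt_add_sqrt {a b : ℝ} (ha : 0 ≤ a) (hb : 0 ≤ b) : √(a + b) ≤ √a + √b := by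
  refine Real.sqrt_le_iff.2 ⟨by positivity, ?_⟩
  rw [add_sq, Real.sq_sqrt ha, Real.sq_sqrt hb]
  linarith [mul_nonneg (Real.sqrt_nonneg a) (Real.sqrt_nonneg b)]

theorem sqrt_const_mul_sq_le {κ : ℝ} (hκ : 0 ≤ κ) : √(160 * κ ^ 2) ≤ 13 * κ := by
  rw [Real.sqrt_le_left (by positivity), mul_pow]
  gcongr
  norm_num

theorem sqrt_mul_sqrt_div_le {σ r L l ν : ℝ} (hr : 0 ≤ r) (hL : 0 ≤ L) (hl1 : 1 ≤ l)
    (hLl : L ≤ l) (hν : 0 < ν) :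
    √(σ * √((4 * r + L) / ν)) ≤ 2 * l * √√(σ ^ 2 * (r + 1) / ν) := by
  apply sqrt_sqrt_le_of_sq_le (by positivity)
  rw [mul_pow, Real.sq_sqrt (by positivity)]
  have h4 : l ≤ l ^ 4 := le_self_pow₀ hl1 (by norm_num)
  have d1 : 4 * r + L ≤ 16 * l ^ 4 * (r + 1) := by
    have := mul_le_mul_of_nonneg_right (hl1.trans h4) hr
    linarith
  calc σ ^ 2 * ((4 * r + L) / ν) ≤ σ ^ 2 * (16 * l ^ 4 * (r + 1) / ν) := by gcongr
    _ = _ := by ring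

set_option maxHeartbeats 1000000 in
-- The rate n^(-1/4) comes from the square root of the covariance error, itself of order n^(-1/2).
-- The observed distance to `mr` is replaced by the true one plus the mean error, whose product with
-- the mean level goes into the trace term.
theorem bonus_le {m mr : Emb d} {x : ℕ → Emb d} {S Sr : Matrix (Fin d) (Fin d) ℝ}
    (hS : S.PosSemidef) {κ η l : ℝ} (hκ : 0 ≤ κ) (hη : 0 < η) (hη1 : η ≤ 1)
    (hl : Real.log (6 / η) ≤ l) {n : ℕ} (hn : 0 < n)
    (hnorm : ‖empMean x n - m‖ ^ 2 ≤ 9 * l * S.trace / n) :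
    bonus κ mr S Sr η x n
      ≤ 26 * κ * l * ((CFC.sqrt Sr).trace * √√(specNorm S ^ 2 * (effRank S + 1))) / √√n
        + l * ((6 * ‖m - mr‖ + 9 * (CFC.sqrt Sr).trace)
          * √(√((S ^ 2).trace) + specNorm S) + 30 * S.trace) / √n
        + 24 * l * (√((S ^ 2).trace) + specNorm S) / n := by
  have hL := one_le_log_three_div hη hη1
  have htL := log_six_div_eq hη
  have hlog2' := Real.log_two_gt_d9
  have ht0 : 0 ≤ Real.log (6 / η) := by linarith
  have hl1 : 1 ≤ l := by linarith
  have hLl : Real.log (3 / η) ≤ l := by linarith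
  have hΔ2 := meanErr_le hS ht0 hl hl1 hn
  have hΔ0 := meanErr_nonneg S η n
  have hτ0 := hS.trace_nonneg
  have hr := effRank_nonneg hS
  have hσ := specNorm_nonneg S
  have hστ := specNorm_le_trace hS
  have hR := (CFC_sqrt_posSemidef Sr).trace_nonneg
  have hhτ : √((S ^ 2).trace) ≤ S.trace := Real.sqrt_le_iff.2 ⟨hτ0, trace_sq_le hS⟩
  have hh0 := Real.sqrt_nonneg (S ^ 2).trace
  have hn' : (0 : ℝ) < n := by exact_mod_cast hn
  have hn1 : (1 : ℝ) ≤ n := by exact_mod_cast hn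
  have hbonus : bonus κ mr S Sr η x n = 2 * meanErr S η n * (meanErr S η n + ‖empMean x n - mr‖)
      + (CFC.sqrt Sr).trace * √(8 * (20 * κ ^ 2 * specNorm S
        * √((4 * effRank S + Real.log (3 / η)) / n) + meanErr S η n ^ 2))
      + S.trace * √(8 / n * Real.log (6 / η)) + 8 * specNorm S / n * Real.log (6 / η) := rfl
  rw [hbonus]
  -- From here on only inequalities between real numbers are involved.
  generalize meanErr S η n = Δ at *
  generalize hEdef : ‖empMean x n - m‖ = E at *
  have hE0 : 0 ≤ E := by rw [← hEdef]; exact norm_nonneg _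
  have hmr : ‖empMean x n - mr‖ ≤ ‖m - mr‖ + E := by
    rw [← hEdef, add_comm]
    exact norm_sub_le_norm_sub_add_norm_sub _ _ _
  have hv0 : 0 ≤ ‖m - mr‖ := norm_nonneg _
  generalize ‖empMean x n - mr‖ = E' at *
  generalize ‖m - mr‖ = v at *
  generalize Real.log (3 / η) = L at *
  generalize Real.log (6 / η) = t at *
  generalize √((S ^ 2).trace) = h at *
  generalize S.trace = τ at *
  generalize specNorm S = σ at *
  generalize effRank S = r at *
  generalize (CFC.sqrt Sr).trace = w at *
  clear hbonus
  set s := √(n : ℝ) with hs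
  have hs0 : 0 < s := Real.sqrt_pos.2 hn'
  have hss : s ^ 2 = n := Real.sq_sqrt hn'.le
  have hs1 : 1 ≤ s := Real.one_le_sqrt.2 hn1
  set g := √(h + σ) with hg
  have hg0 : 0 ≤ g := Real.sqrt_nonneg _
  have hgg : g ^ 2 = h + σ := Real.sq_sqrt (by positivity)
  have hll2 : l ≤ l ^ 2 := le_self_pow₀ hl1 two_ne_zero
  have hl_sqrt : √l ≤ l := by
    rw [Real.sqrt_le_left (by linarith)]; exact hll2
  have hl0 : 0 ≤ l := by linarith
  have hlg0 := Real.sqrt_nonneg l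
  have hll : √l * √l = l := Real.mul_self_sqrt hl0
  have hΔ : Δ ≤ 3 * √l * g / s := by
    refine abs_le_of_sq_le_sq' ?_ (by positivity) |>.2
    rw [div_pow, mul_pow, mul_pow, hgg, hss, Real.sq_sqrt hl0]
    refine hΔ2.trans ?_
    gcongr
    norm_num
  have hE : E ≤ 3 * √l * √τ / s := by
    refine abs_le_of_sq_le_sq' ?_ (by positivity) |>.2
    rw [div_pow, mul_pow, mul_pow, hss, Real.sq_sqrt hl0, Real.sq_sqrt hτ0]
    refine hnorm.trans (le_of_eq ?_)
    norm_num
  -- Both h and σ are at most τ, so g ≤ √(2τ) and √2 ≤ 3/2.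
  have hgτ : g * √τ ≤ 3 / 2 * τ := by
    rw [hg, ← Real.sqrt_mul (by positivity), Real.sqrt_le_left (by positivity)]
    calc (h + σ) * τ ≤ (τ + τ) * τ := by gcongr
      _ ≤ (3 / 2 * τ) ^ 2 := by linarith [sq_nonneg τ]
  have b1 : 2 * (Δ * Δ) ≤ 16 * l * (h + σ) / n := by
    rw [← sq]
    refine (mul_le_mul_of_nonneg_left hΔ2 zero_le_two).trans (le_of_eq ?_)
    ring
  have b2 : Δ * v ≤ 3 * (l * (v * g) / s) := by
    calc Δ * v ≤ 3 * √l * g / s * v := by gcongr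
      _ ≤ 3 * l * g / s * v := by gcongr
      _ = _ := by ring
  have b3 : Δ * E ≤ 27 / 2 * (l * τ / s) := by
    calc Δ * E ≤ (3 * √l * g / s) * (3 * √l * √τ / s) := by gcongr
      _ = 9 * (√l * √l) * (g * √τ) / s / s := by ring
      _ ≤ 9 * (√l * √l) * (3 / 2 * τ) / s / 1 := by gcongr
      _ = _ := by rw [hll]; ring
  have b4 : √(8 * (20 * κ ^ 2 * σ * √((4 * r + L) / n) + Δ ^ 2))
      ≤ 26 * κ * l * √√(σ ^ 2 * (r + 1)) / √s + 9 * (l * g / s) := by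
    have c1 : √(8 * (20 * κ ^ 2 * σ * √((4 * r + L) / n) + Δ ^ 2))
        ≤ √(160 * κ ^ 2 * (σ * √((4 * r + L) / n))) + √(8 * Δ ^ 2) := by
      refine le_trans (le_of_eq ?_) (sqrt_add_le_sqrt_add_sqrt (by positivity) (by positivity))
      congr 1; ring
    have c2 : √(8 * Δ ^ 2) ≤ 9 * (l * g / s) := by
      have : √(8 * Δ ^ 2) ≤ 3 * Δ := by
        rw [Real.sqrt_le_left (by positivity), mul_pow]; linarith [sq_nonneg Δ]
      calc √(8 * Δ ^ 2) ≤ 3 * Δ := this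
        _ ≤ 3 * (3 * √l * g / s) := by gcongr
        _ ≤ 3 * (3 * l * g / s) := by gcongr
        _ = _ := by ring
    have c3 : √(160 * κ ^ 2 * (σ * √((4 * r + L) / n)))
        ≤ 13 * κ * √(σ * √((4 * r + L) / n)) := by
      rw [Real.sqrt_mul (by positivity)]
      gcongr
      exact sqrt_const_mul_sq_le hκ
    have c4 := sqrt_mul_sqrt_div_le (σ := σ) hr (by linarith : 0 ≤ L) hl1 hLl hn'
    have c5 : √√(σ ^ 2 * (r + 1) / n) = √√(σ ^ 2 * (r + 1)) / √s := by
      rw [Real.sqrt_div (by positivity), Real.sqrt_div (by positivity)]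
    rw [c5] at c4
    have c6 := mul_le_mul_of_nonneg_left c4 (by positivity : 0 ≤ 13 * κ)
    have c7 : 13 * κ * (2 * l * (√√(σ ^ 2 * (r + 1)) / √s))
      = 26 * κ * l * √√(σ ^ 2 * (r + 1)) / √s := by ring
    linarith
  have b5 : √(8 / n * t) ≤ 3 * l / s := by
    rw [Real.sqrt_le_left (by positivity), div_pow, hss, div_mul_eq_mul_div,
      div_le_div_iff_of_pos_right hn']
    linarith
  have b6 : 8 * σ / n * t ≤ 8 * l * (h + σ) / n := by
    have h1 := mul_le_mul_of_nonneg_left hl hσ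
    have h2 := mul_nonneg hl0 hh0
    rw [div_mul_eq_mul_div, div_le_div_iff_of_pos_right hn']
    linarith
  have b7 := mul_le_mul_of_nonneg_left b4 hR
  have b8 := mul_le_mul_of_nonneg_left b5 hτ0
  have b9 : Δ * E' ≤ Δ * v + Δ * E := by
    rw [← mul_add]; exact mul_le_mul_of_nonneg_left hmr hΔ0
  have e1 : 2 * Δ * (Δ + E') = 2 * (Δ * Δ) + 2 * (Δ * E') := by ring
  have e2 : l * ((6 * v + 9 * w) * g + 30 * τ) / s
      = 6 * (l * (v * g) / s) + w * (9 * (l * g / s)) + 30 * (l * τ / s) := by ring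
  have e3 : w * (26 * κ * l * √√(σ ^ 2 * (r + 1)) / √s + 9 * (l * g / s))
      = 26 * κ * l * (w * √√(σ ^ 2 * (r + 1))) / √s + w * (9 * (l * g / s)) := by ring
  have e4 : τ * (3 * l / s) = 3 * (l * τ / s) := by ring
  have e5 : 24 * l * (h + σ) / n = 16 * l * (h + σ) / n + 8 * l * (h + σ) / n := by ring
  rw [e1, e2, e5]
  rw [e3] at b7
  rw [e4] at b8
  linarith

/-- F at the empirical covariance is bounded by the regularized tangent at the true one. Its linear
part is a scalar average of quadratic forms, so neither an operator-norm bound nor the burn-in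
condition enters. The regularization √(σ/n) costs only order n^(-1/2). -/
theorem frechetDist_sub_optimisticFD_le {m mr : Emb d} {x : ℕ → Emb d}
    {S Sr : Matrix (Fin d) (Fin d) ℝ} (hS : S.PosSemidef) (hSr : Sr.PosDef) (hσ : 0 < specNorm S)
    {κ η l t : ℝ} (hκ : 0 ≤ κ) (hη : 0 < η) (hη1 : η ≤ 1) (hl : Real.log (6 / η) ≤ l)
    (ht0 : 0 ≤ t) (ht : t ≤ 2 * l) {n : ℕ} (hn : 0 < n)
    (hquad : (secondMoment x m n
        * supportMatrix (CFC.sqrt Sr) S (√(specNorm S / n))).trace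
      ≤ (S * supportMatrix (CFC.sqrt Sr) S (√(specNorm S / n))).trace
        + 2 * (√(specNorm S) * (CFC.sqrt Sr).trace) * √(t / n)
        + 2 * (√(specNorm S) * (CFC.sqrt Sr).trace) * (t / n))
    (htrace : S.trace - 2 * S.trace * √(t / n) ≤ (secondMoment x m n).trace)
    (hnorm : ‖√n • (empMean x n - m)‖ ^ 2 ≤ S.trace
      + 2 * √((S ^ 2).trace) * √t + 2 * specNorm S * t)
    (hinner : inner ℝ (-(m - mr)) (√n • (empMean x n - m))
      ≤ ‖-(m - mr)‖ * √(2 * specNorm S * t)) :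
    frechetDist m mr S Sr - optimisticFD κ mr S Sr η x n ≤ errorRate κ l m mr S Sr n := by
  have hL := one_le_log_three_div hη hη1
  have htL := log_six_div_eq hη
  have hlog2' := Real.log_two_gt_d9
  have hl1 : 1 ≤ l := by linarith
  have hl0 : 0 ≤ l := by linarith
  have hn' : (0 : ℝ) < n := by exact_mod_cast hn
  have hτ0 := hS.trace_nonneg
  have hh2 := trace_sq_le_specNorm_mul hS
  have hstτ := specNorm_le_trace hS
  have hnorm' : ‖empMean x n - m‖ ^ 2 ≤ 9 * l * S.trace / n := by
    rw [norm_smul, mul_pow, Real.norm_eq_abs, sq_abs, Real.sq_sqrt hn'.le] at hnorm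
    rw [le_div_iff₀ hn', mul_comm]
    refine hnorm.trans ?_
    have h1 := two_mul_mul_sqrt_le hσ.le hτ0 ht0 (h := √((S ^ 2).trace))
      (by rw [Real.sq_sqrt (trace_sq_nonneg hS)]; exact hh2)
    have h2 : specNorm S * t ≤ S.trace * (2 * l) := by gcongr
    have h3 := mul_le_mul_of_nonneg_left hl1 hτ0
    linarith
  have hb := bonus_le (mr := mr) (x := x) (Sr := Sr) hS hκ hη hη1 hl hn hnorm'
  have hR := CFC_sqrt_posDef hSr
  have hRtr := hR.posSemidef.trace_nonneg
  have hτ' : 0 < √(specNorm S / n) := Real.sqrt_pos.2 (by positivity)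
  have hF1 := traceSqrtConj_le_supportMatrix (B := S) hR (empCov_posSemidef x n) hτ'
  have hF2 := trace_mul_supportMatrix_le hR hS hτ'
  -- Centering at the empirical mean subtracts a positive semidefinite rank-one matrix, which can
  -- only lower the trace against the support matrix.
  have hF3 : (empCov x n * supportMatrix (CFC.sqrt Sr) S (√(specNorm S / n))).trace
      ≤ (secondMoment x m n * supportMatrix (CFC.sqrt Sr) S (√(specNorm S / n))).trace := by
    refine trace_mul_le_of_le ?_ (supportMatrix_posSemidef hR hτ')
    rw [empCov_eq hn m, sub_sub_cancel]
    exact posSemidef_vecMulVec_real _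
  have hdiff := empFrechetDist_sub (x := x) (m := m) (mr := mr) (S := S) hn hSr
  have hin := inner_le_of_le_sqrt hn hinner
  rw [inner_neg_left, norm_neg] at hin
  have hopt : optimisticFD κ mr S Sr η x n = empFrechetDist x n mr Sr - bonus κ mr S Sr η x n := rfl
  rw [hopt]
  unfold errorRate
  have hh0 := Real.sqrt_nonneg (S ^ 2).trace
  have hv0 : 0 ≤ ‖m - mr‖ := norm_nonneg _
  generalize (empCov x n * supportMatrix (CFC.sqrt Sr) S (√(specNorm S / n))).trace = q1 at *
  generalize (secondMoment x m n * supportMatrix (CFC.sqrt Sr) S (√(specNorm S / n))).trace = q2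
    at *
  generalize (S * supportMatrix (CFC.sqrt Sr) S (√(specNorm S / n))).trace = q3 at *
  generalize bonus κ mr S Sr η x n = B at *
  generalize empFrechetDist x n mr Sr = D at *
  generalize frechetDist m mr S Sr = D' at *
  generalize inner ℝ (m - mr) (empMean x n - m) = i at *
  generalize (secondMoment x m n).trace = V at *
  generalize traceSqrtConj (CFC.sqrt Sr) (empCov x n) = F1 at *
  generalize traceSqrtConj (CFC.sqrt Sr) S = F2 at *
  generalize √√(specNorm S ^ 2 * (effRank S + 1)) = z at *
  generalize ‖m - mr‖ = v at *
  generalize √((S ^ 2).trace) = h at *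
  generalize S.trace = τ at *
  generalize specNorm S = σ at *
  generalize (CFC.sqrt Sr).trace = w at *
  clear hopt hnorm hnorm' hinner hτ' hh2
  set s := √(n : ℝ) with hs
  have hs0 : 0 < s := Real.sqrt_pos.2 hn'
  have hss : s ^ 2 = n := Real.sq_sqrt hn'.le
  have hs1 : 1 ≤ s := Real.one_le_sqrt.2 (by exact_mod_cast hn)
  set g := √(h + σ) with hg
  have hg0 : 0 ≤ g := Real.sqrt_nonneg _
  have hσg : √σ ≤ g := Real.sqrt_le_sqrt (by linarith)
  have hll2 : l ≤ l ^ 2 := le_self_pow₀ hl1 two_ne_zero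
  have htn : √(t / n) ≤ 3 / 2 * (l / s) := by
    rw [Real.sqrt_le_left (by positivity), mul_pow, div_pow (l), hss]
    calc t / n ≤ 9 / 4 * l ^ 2 / n := by gcongr; linarith
      _ = _ := by ring
  have htn2 : t / n ≤ 2 * (l / s) := by
    rw [← hss, sq, ← div_div]
    calc t / s / s ≤ 2 * l / s / 1 := by gcongr
      _ = _ := by ring
  have a1 : v * √(2 * σ * t / n) ≤ 2 * (l * (v * g) / s) := by
    have : √(2 * σ * t / n) ≤ 2 * l * √σ / s := by
      apply sqrt_le_of_sq_le_mul (by positivity) hs0.le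
      rw [hss]
      have h1 : σ * t ≤ σ * (2 * l ^ 2) := by gcongr; linarith
      calc 2 * σ * t / n = 2 * (σ * t) / n := by ring
        _ ≤ 2 * (σ * (2 * l ^ 2)) / n := by gcongr
        _ = _ := by ring
    calc v * √(2 * σ * t / n) ≤ v * (2 * l * √σ / s) := by gcongr
      _ ≤ v * (2 * l * g / s) := by gcongr
      _ = _ := by ring
  have a2 : 2 * τ * √(t / n) ≤ 3 * (l * τ / s) := by
    calc 2 * τ * √(t / n) ≤ 2 * τ * (3 / 2 * (l / s)) := by gcongr
      _ = _ := by ring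
  have a3 : 2 * (√σ * w) * √(t / n) ≤ 3 * (l * (w * g) / s) := by
    calc 2 * (√σ * w) * √(t / n) ≤ 2 * (g * w) * (3 / 2 * (l / s)) := by gcongr
      _ = _ := by ring
  have a4 : 2 * (√σ * w) * (t / n) ≤ 4 * (l * (w * g) / s) := by
    calc 2 * (√σ * w) * (t / n) ≤ 2 * (g * w) * (2 * (l / s)) := by gcongr
      _ = _ := by ring
  have a5 : √(σ / n) * w ≤ l * (w * g) / s := by
    rw [Real.sqrt_div' _ hn'.le]
    calc √σ / s * w ≤ g / s * w := by gcongr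
      _ = 1 * (w * g) / s := by ring
      _ ≤ _ := by gcongr
  have e2 : l * ((6 * v + 9 * w) * g + 30 * τ) / s
      = 6 * (l * (v * g) / s) + 9 * (l * (w * g) / s) + 30 * (l * τ / s) := by ring
  have e3 : 33 * l * ((v + w) * g + τ) / s
      = 33 * (l * (v * g) / s) + 33 * (l * (w * g) / s) + 33 * (l * τ / s) := by ring
  have p1 : 0 ≤ l * (v * g) / s := by positivity
  have p2 : 0 ≤ l * (w * g) / s := by positivity
  rw [e2] at hb
  rw [e3]
  linarith

end Pessimism

/-! ### Probabilities of the failure of optimism and of the error bound. -/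

section Concentration

variable {d : ℕ} {Ω : Type*} [MeasurableSpace Ω] {P : Measure Ω}
  {Z : ℕ → Ω → Emb d} {m mr : Emb d} {S Sr : Matrix (Fin d) (Fin d) ℝ}

theorem measure_le_four_mul {E B₁ B₂ B₃ B₄ : Set Ω} {c : ℝ≥0∞}
    (h : ∀ ω ∈ E, ω ∈ B₁ ∨ ω ∈ B₂ ∨ ω ∈ B₃ ∨ ω ∈ B₄) (h₁ : P B₁ ≤ c) (h₂ : P B₂ ≤ c)
    (h₃ : P B₃ ≤ c) (h₄ : P B₄ ≤ c) : P E ≤ 4 * c := by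
  have hsub : E ⊆ B₁ ∪ (B₂ ∪ (B₃ ∪ B₄)) := fun ω hω => h ω hω
  calc P E ≤ P (B₁ ∪ (B₂ ∪ (B₃ ∪ B₄))) := measure_mono hsub
    _ ≤ P B₁ + (P B₂ + (P B₃ + P B₄)) := by
        refine (measure_union_le _ _).trans (add_le_add le_rfl ?_)
        refine (measure_union_le _ _).trans (add_le_add le_rfl ?_)
        exact measure_union_le _ _
    _ ≤ c + (c + (c + c)) := by gcongr
    _ = 4 * c := by ring

theorem eq_zero_of_specNorm_eq_zero (h : specNorm S = 0) : S = 0 := by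
  have : Matrix.toEuclideanCLM (𝕜 := ℝ) S = 0 := norm_eq_zero.1 h
  simpa using this

theorem multivariateGaussian_zero_cov (m : Emb d) :
    multivariateGaussian m (0 : Matrix (Fin d) (Fin d) ℝ) = Measure.dirac m := by
  simp [multivariateGaussian]

theorem ae_eq_mean_of_zero_cov
    (hZ : ∀ a, HasLaw (Z a) (multivariateGaussian m (0 : Matrix (Fin d) (Fin d) ℝ)) P) :
    ∀ᵐ ω ∂P, (fun i => Z i ω) = fun _ => m := by
  have h : ∀ᵐ ω ∂P, ∀ i, Z i ω = m := by
    rw [ae_all_iff]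
    intro i
    have := hZ i
    rw [multivariateGaussian_zero_cov] at this
    exact this.ae_eq_of_dirac
  filter_upwards [h] with ω hω
  funext i
  exact hω i

theorem empMean_const {n : ℕ} (hn : 0 < n) (m : Emb d) : empMean (fun _ => m) n = m := by
  have := empMean_sub (x := fun _ => m) hn m
  simpa [sub_eq_zero] using this

theorem empFrechetDist_const {n : ℕ} (hn : 0 < n) (m mr : Emb d)
    (Sr : Matrix (Fin d) (Fin d) ℝ) :
    empFrechetDist (fun _ => m) n mr Sr = frechetDist m mr 0 Sr := by
  have h : empCov (fun _ => m) n = 0 := by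
    have h0 : Matrix.vecMulVec (fun k => (m - m) k) (fun k => (m - m) k) = 0 := by
      ext i j
      simp [Matrix.vecMulVec_apply]
    rw [empCov, empMean_const hn]
    simp only [h0, Finset.sum_const_zero, smul_zero]
  rw [empFrechetDist, empMean_const hn, h]

theorem specNorm_zero : specNorm (0 : Matrix (Fin d) (Fin d) ℝ) = 0 := by simp [specNorm]

theorem trace_secondMoment (x : ℕ → Emb d) (m : Emb d) (n : ℕ) :
    (secondMoment x m n).trace = (n : ℝ)⁻¹ * ∑ i ∈ Finset.range n, quadForm 1 (x i - m) := by
  have := trace_secondMoment_mul x m n 1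
  rwa [mul_one] at this

theorem trace_sq_pos (hS : S.PosSemidef) (hσ : 0 < specNorm S) : 0 < (S ^ 2).trace := by
  have hne : ∃ i, hS.1.eigenvalues i ≠ 0 := by
    by_contra hall
    push Not at hall
    have h1 : S.trace = 0 := by
      rw [trace_eq_sum_eigenvalues_real hS.1]; simp [hall]
    linarith [specNorm_le_trace hS]
  obtain ⟨i, hi⟩ := hne
  rw [trace_sq_eq_sum_eigenvalues hS.1]
  exact Finset.sum_pos' (fun j _ => sq_nonneg _) ⟨i, Finset.mem_univ i, by positivity⟩

/-- Four deviation events at level log(6/η) have probability at most η/6 each. For zero covariance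
the samples are almost surely constant and the empirical distance is exact, so κ ≥ 1 is required
only in the nondegenerate case. -/
theorem measure_frechetDist_lt_optimisticFD_le (hZm : ∀ a, Measurable (Z a))
    (hZ : ∀ a, HasLaw (Z a) (multivariateGaussian m S) P) (hI : iIndepFun Z P)
    (hS : S.PosSemidef) (hSr : Sr.PosDef) {κ η : ℝ} (hκ : 0 < specNorm S → 1 ≤ κ)
    (hη : 0 < η) (hη1 : η ≤ 1) {n : ℕ} (hn : 0 < n)
    (hN : 4 * effRank S + Real.log (3 / η) ≤ n) :
    P {ω | frechetDist m mr S Sr < optimisticFD κ mr S Sr η (fun i => Z i ω) n}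
      ≤ 4 * ENNReal.ofReal (η / 6) := by
  have hL := one_le_log_three_div hη hη1
  have htL := log_six_div_eq hη
  have hlog2' := Real.log_two_gt_d9
  have ht0 : 0 ≤ Real.log (6 / η) := by linarith
  rcases (specNorm_nonneg S).eq_or_lt with hσ | hσ
  · have h0 := eq_zero_of_specNorm_eq_zero hσ.symm
    subst h0
    have hnull : P {ω | frechetDist m mr 0 Sr < optimisticFD κ mr 0 Sr η (fun i => Z i ω) n}
        = 0 := by
      rw [← nonpos_iff_eq_zero, ← ae_iff.1 (ae_eq_mean_of_zero_cov hZ)]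
      refine measure_mono fun ω hω hc => ?_
      simp only [Set.mem_ofPred_eq] at hω
      rw [hc, optimisticFD, empFrechetDist_const hn] at hω
      linarith [bonus_nonneg (κ := κ) (mr := mr) (Sr := Sr) hS ht0 (fun _ => m) n]
    rw [hnull]; exact zero_le
  · have hn' : (0 : ℝ) < n := by exact_mod_cast hn
    have hr := one_le_effRank hS hσ
    have hh := trace_sq_pos hS hσ
    have hτ : 0 < S.trace := hσ.trans_le (specNorm_le_trace hS)
    have hexp : ENNReal.ofReal (Real.exp (-Real.log (6 / η))) = ENNReal.ofReal (η / 6) := by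
      rw [Real.exp_neg, Real.exp_log (by positivity), inv_div]
    have hB : CFC.sqrt S * 1 * CFC.sqrt S = S := by
      rw [mul_one, CFC.sqrt_mul_sqrt_self _ hS.nonneg]
    have hh2 : (S ^ 2).trace ≤ √((S ^ 2).trace) ^ 2 := (Real.sq_sqrt hh.le).ge
    have e1 := measure_quadForm_lower hZm hZ hI hS hτ
      (l := √((4 * effRank S + Real.log (3 / η)) / n) / (4 * specNorm S))
      (b := √(1 / (7 * effRank S))) (t := Real.log (6 / η)) (by positivity) (by positivity) hn
    have e2 := measure_sum_quadForm_upper hZm hZ hI hS Matrix.PosSemidef.one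
      (h := √((S ^ 2).trace)) (σ := specNorm S) (Real.sqrt_pos.2 hh) (by rw [hB]; exact hh2)
      (by rw [hB]) ht0 hn
    have e3 := measure_norm_sum_upper hZm hZ hI hS (Real.sqrt_pos.2 hh) hh2 le_rfl ht0 hn
    have e4 := measure_inner_sum_upper hZm hZ hI hS hσ (m - mr) ht0 hn
    rw [hexp] at e1 e2 e3 e4
    refine measure_le_four_mul (fun ω hω => ?_) e1 e2 e3 e4
    by_contra hc
    simp only [Set.mem_ofPred_eq, not_or, not_not, not_lt] at hc hω
    obtain ⟨c1, c2, c3, c4⟩ := hc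
    rw [normalized_sum_eq (x := fun i => Z i ω) hn] at c3 c4
    refine absurd (optimisticFD_le_frechetDist hS hSr hσ (hκ hσ) hη hη1 hn hN c1 ?_ c3 c4) hω.not_ge
    rw [trace_secondMoment, inv_mul_le_iff₀ hn']
    rwa [mul_one] at c2

/-- The level `t` is independent of the confidence `η` in the bonus, which makes room for a union
bound over the models. -/
theorem measure_errorRate_lt_le (hZm : ∀ a, Measurable (Z a))
    (hZ : ∀ a, HasLaw (Z a) (multivariateGaussian m S) P) (hI : iIndepFun Z P)
    (hS : S.PosSemidef) (hSr : Sr.PosDef) {κ η l t : ℝ} (hκ : 0 ≤ κ)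
    (hη : 0 < η) (hη1 : η ≤ 1) (hl : Real.log (6 / η) ≤ l) (ht0 : 0 ≤ t) (ht : t ≤ 2 * l)
    {n : ℕ} (hn : 0 < n) :
    P {ω | errorRate κ l m mr S Sr n
        < frechetDist m mr S Sr - optimisticFD κ mr S Sr η (fun i => Z i ω) n}
      ≤ 4 * ENNReal.ofReal (Real.exp (-t)) := by
  have hL := one_le_log_three_div hη hη1
  have htL := log_six_div_eq hη
  have hlog2' := Real.log_two_gt_d9
  have hl0 : 0 ≤ l := by linarith
  rcases (specNorm_nonneg S).eq_or_lt with hσ | hσ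
  · have h0 := eq_zero_of_specNorm_eq_zero hσ.symm
    subst h0
    have hnull : P {ω | errorRate κ l m mr 0 Sr n
        < frechetDist m mr 0 Sr - optimisticFD κ mr 0 Sr η (fun i => Z i ω) n} = 0 := by
      rw [← nonpos_iff_eq_zero, ← ae_iff.1 (ae_eq_mean_of_zero_cov hZ)]
      refine measure_mono fun ω hω hc => ?_
      simp only [Set.mem_ofPred_eq] at hω
      rw [hc, optimisticFD, empFrechetDist_const hn, sub_sub_cancel] at hω
      have hb := bonus_le (m := m) (mr := mr) (x := fun _ => m) (Sr := Sr) hS hκ hη hη1 hl hn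
        (by rw [empMean_const hn]; simp)
      have he : 0 ≤ errorRate κ l m mr 0 Sr n := errorRate_nonneg hκ hl0 m mr hS Sr n
      simp only [specNorm_zero, Matrix.trace_zero, ne_eq, OfNat.ofNat_ne_zero, not_false_eq_true,
        zero_pow, zero_mul, Real.sqrt_zero, mul_zero, add_zero, zero_div] at hb
      linarith
    rw [hnull]; exact zero_le
  · have hn' : (0 : ℝ) < n := by exact_mod_cast hn
    have hh := trace_sq_pos hS hσ
    have hτ : 0 < S.trace := hσ.trans_le (specNorm_le_trace hS)
    have hh2 : (S ^ 2).trace ≤ √((S ^ 2).trace) ^ 2 := (Real.sq_sqrt hh.le).ge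
    have hR := CFC_sqrt_posDef hSr
    have hd : Nonempty (Fin d) := by
      by_contra hne
      rw [not_nonempty_iff] at hne
      have : S.trace = 0 := by simp [Matrix.trace]
      linarith
    have hRtr : 0 < (CFC.sqrt Sr).trace := hR.trace_pos
    have hτ' : 0 < √(specNorm S / n) := Real.sqrt_pos.2 (by positivity)
    set M := supportMatrix (CFC.sqrt Sr) S (√(specNorm S / n)) with hMdef
    have hM : M.PosSemidef := supportMatrix_posSemidef hR hτ'
    set B := CFC.sqrt S * M * CFC.sqrt S with hBdef
    have hBp : B.PosSemidef := PosSemidef.conj_self hM (CFC_sqrt_posSemidef S).1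
    -- One trace bound serves twice below: it dominates the spectral norm of `B`, and its square
    -- dominates Tr B².
    have hBt : B.trace ≤ √(specNorm S) * (CFC.sqrt Sr).trace := by
      rw [hBdef, trace_sqrt_conj hS]
      exact (trace_mul_supportMatrix_le hR hS hτ').trans (traceSqrtConj_le_specNorm hR hS)
    have e1 := measure_sum_quadForm_upper hZm hZ hI hS hM
      (h := √(specNorm S) * (CFC.sqrt Sr).trace) (σ := √(specNorm S) * (CFC.sqrt Sr).trace)
      (by positivity) ((trace_sq_le hBp).trans (pow_le_pow_left₀ hBp.trace_nonneg hBt 2))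
      ((specNorm_le_trace hBp).trans hBt) ht0 hn
    have e2 := measure_sum_quadForm_lower hZm hZ hI hS Matrix.PosSemidef.one (t := t)
      (by rwa [mul_one]) ht0 hn
    have e3 := measure_norm_sum_upper hZm hZ hI hS (Real.sqrt_pos.2 hh) hh2 le_rfl ht0 hn
    have e4 := measure_inner_sum_upper hZm hZ hI hS hσ (-(m - mr)) ht0 hn
    refine measure_le_four_mul (fun ω hω => ?_) e1 e2 e3 e4
    by_contra hc
    simp only [Set.mem_ofPred_eq, not_or, not_lt] at hc hω
    obtain ⟨c1, c2, c3, c4⟩ := hc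
    rw [normalized_sum_eq (x := fun i => Z i ω) hn] at c3 c4
    refine absurd (frechetDist_sub_optimisticFD_le hS hSr hσ hκ hη hη1 hl ht0 ht hn ?_ ?_ c3 c4)
      hω.not_ge
    · rw [trace_secondMoment_mul, inv_mul_le_iff₀ hn']
      exact c1
    · rw [trace_secondMoment, le_inv_mul_iff₀ hn']
      rwa [mul_one] at c2

end Concentration

/-! ### The sub-Gaussian constant is at least 1 for a nonzero covariance. -/

section SubGaussian

variable {d : ℕ}

theorem lintegral_inner_sq_multivariateGaussian {m : Emb d} {S : Matrix (Fin d) (Fin d) ℝ}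
    (hS : S.PosSemidef) (y : Emb d) :
    ∫⁻ z, ENNReal.ofReal (inner ℝ y (z - m) ^ 2) ∂(multivariateGaussian m S)
      = ENNReal.ofReal (quadForm S y) := by
  set M := Matrix.vecMulVec (fun k => y k) (fun k => y k)
  have hM : M.PosSemidef := posSemidef_vecMulVec_real _
  have h := lintegral_quadForm_multivariateGaussian (m := m) (S := S) (M := M)
    (g := ENNReal.ofReal) ENNReal.measurable_ofReal
  have hp := PosSemidef.conj_self hM (CFC_sqrt_posSemidef S).1
  simp_rw [M, quadForm_vecMulVec] at h
  rw [h, ← ofReal_integral_eq_lintegral_ofReal (integrable_quadForm_stdGaussian _)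
    (ae_of_all _ fun w => quadForm_nonneg hp w), integral_quadForm_stdGaussian hp.1,
    trace_sqrt_conj hS, trace_mul_vecMulVec]

/-- The second moment is at most the squared sub-Gaussian norm. -/
theorem one_le_of_psi2Norm_le {𝒳 : Type*} [MeasurableSpace 𝒳] {p : Measure 𝒳} {f : 𝒳 → Emb d}
    {m : Emb d} {S : Matrix (Fin d) (Fin d) ℝ} (hS : S.PosSemidef)
    (hf : HasLaw f (multivariateGaussian m S) p) {κ : ℝ} (hκ : 0 < κ)
    (hψ : ∀ y : Emb d, psi2Norm (fun z => inner ℝ y (f z - m)) p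
      ≤ ENNReal.ofReal (κ * √(inner ℝ y (Matrix.toEuclideanCLM (𝕜 := ℝ) S y))))
    (hσ : 0 < specNorm S) : 1 ≤ κ := by
  have hp : IsProbabilityMeasure p := hf.isProbabilityMeasure
  obtain ⟨y, hy⟩ : ∃ y : Emb d, 0 < quadForm S y := by
    by_contra hall
    push Not at hall
    have h1 : S.trace ≤ 0 := by
      rw [← integral_quadForm_stdGaussian hS.1]
      exact integral_nonpos hall
    linarith [specNorm_le_trace hS]
  by_contra hκ1
  push Not at hκ1
  have h1 : psi2Norm (fun z => inner ℝ y (f z - m)) p < ENNReal.ofReal √(quadForm S y) := by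
    refine (hψ y).trans_lt ((ENNReal.ofReal_lt_ofReal_iff (Real.sqrt_pos.2 hy)).2 ?_)
    exact mul_lt_of_lt_one_left (Real.sqrt_pos.2 hy) hκ1
  unfold psi2Norm at h1
  simp only [iInf_lt_iff] at h1
  obtain ⟨t, ht, hint, hlt⟩ := h1
  rw [ENNReal.ofReal_lt_ofReal_iff (Real.sqrt_pos.2 hy)] at hlt
  -- From exp u ≥ 1 + u, the expectation is at least 1 + Var/t². An admissible t below the standard
  -- deviation would push it above 2.
  have h2 : 1 + ENNReal.ofReal (quadForm S y / t ^ 2)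
      ≤ ∫⁻ z, ENNReal.ofReal (Real.exp (inner ℝ y (f z - m) ^ 2 / t ^ 2)) ∂p := by
    have h3 : ∫⁻ z, (1 + ENNReal.ofReal (inner ℝ y (f z - m) ^ 2)
        * ENNReal.ofReal ((t ^ 2)⁻¹)) ∂p = 1 + ENNReal.ofReal (quadForm S y / t ^ 2) := by
      rw [lintegral_add_left measurable_const, lintegral_mul_const' _ _ ENNReal.ofReal_ne_top]
      have h4 := hf.lintegral_comp (f := fun z => ENNReal.ofReal (inner ℝ y (z - m) ^ 2))
        (by fun_prop)
      rw [h4, lintegral_inner_sq_multivariateGaussian hS, lintegral_const, measure_univ, one_mul,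
        ← ENNReal.ofReal_mul hy.le, div_eq_mul_inv]
    rw [← h3]
    refine lintegral_mono fun z => ?_
    rw [← ENNReal.ofReal_mul (sq_nonneg _), ← ENNReal.ofReal_one, ← ENNReal.ofReal_add zero_le_one
      (by positivity), ← div_eq_mul_inv]
    apply ENNReal.ofReal_le_ofReal
    linarith [Real.add_one_le_exp (inner ℝ y (f z - m) ^ 2 / t ^ 2)]
  have h5 := h2.trans hint
  have h6 : 1 < quadForm S y / t ^ 2 := by
    rw [one_lt_div (by positivity)]
    calc t ^ 2 < √(quadForm S y) ^ 2 := by gcongr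
      _ = quadForm S y := Real.sq_sqrt hy.le
  have h7 : (1 : ℝ≥0∞) < ENNReal.ofReal (quadForm S y / t ^ 2) := by
    rw [← ENNReal.ofReal_one]
    exact (ENNReal.ofReal_lt_ofReal_iff (by linarith)).2 h6
  have h8 : (2 : ℝ≥0∞) < 1 + ENNReal.ofReal (quadForm S y / t ^ 2) := by
    rw [← one_add_one_eq_two]
    exact ENNReal.add_lt_add_left ENNReal.one_ne_top h7
  exact absurd h5 h8.not_ge

end SubGaussian

/-! ### Summing the error rates along a run. -/

section Picks

variable {G : ℕ}

theorem numPicks_succ (pick : ℕ → Fin G) (t : ℕ) (g : Fin G) :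
    numPicks pick (t + 1) g = numPicks pick t g + if pick t = g then 1 else 0 := by
  unfold numPicks
  rw [Finset.range_add_one, Finset.filter_insert]
  split_ifs with h
  · rw [Finset.card_insert_of_notMem (by simp)]
  · simp

theorem numPicks_le (pick : ℕ → Fin G) (t : ℕ) (g : Fin G) : numPicks pick t g ≤ t := by
  exact (Finset.card_filter_le _ _).trans_eq (Finset.card_range t)

/-- Summing along a run a function of how often the picked model was picked before. -/
theorem sum_comp_numPicks (pick : ℕ → Fin G) (φ : ℕ → ℝ) (T : ℕ) :
    ∑ s ∈ Finset.range T, φ (numPicks pick s (pick s))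
      = ∑ g, ∑ k ∈ Finset.range (numPicks pick T g), φ k := by
  induction T with
  | zero => simp [numPicks]
  | succ T ih =>
    rw [Finset.sum_range_succ, ih, show φ (numPicks pick T (pick T))
        = ∑ g, if pick T = g then φ (numPicks pick T g) else 0 by simp, ← Finset.sum_add_distrib]
    refine Finset.sum_congr rfl fun g _ => ?_
    rw [numPicks_succ]
    split_ifs
    · rw [Finset.sum_range_succ]
    · simp

theorem sum_range_inv_le_one_add_log {n T : ℕ} (hT : 1 ≤ T) (hn : n ≤ T) :
    ∑ k ∈ Finset.range n, (k : ℝ)⁻¹ ≤ 1 + Real.log T := by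
  rcases n with _ | n
  · have : 0 ≤ Real.log T := Real.log_nonneg (by exact_mod_cast hT)
    simp only [Finset.range_zero, Finset.sum_empty]
    linarith
  · rw [Finset.sum_range_succ']
    have h := harmonic_le_one_add_log n
    simp only [harmonic] at h
    push_cast at h ⊢
    simp only [inv_zero, add_zero]
    refine h.trans ?_
    rcases n.eq_zero_or_pos with rfl | hn0
    · have : 0 ≤ Real.log T := Real.log_nonneg (by exact_mod_cast hT)
      simpa using this
    · have hnT : (n : ℝ) ≤ T := by exact_mod_cast (Nat.le_succ n).trans hn
      have := Real.log_le_log (by exact_mod_cast hn0) hnT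
      linarith

/-- The final log T term has no additive constant. For T = 1 only k = 0 can occur, and its inverse
is 0 by convention; for T ≥ 2 the 1 is absorbed because log 2 ≥ 1/2. -/
theorem sum_range_inv_le_three_mul_log {n T : ℕ} (hT : 1 ≤ T) (hn : n ≤ T) :
    ∑ k ∈ Finset.range n, (k : ℝ)⁻¹ ≤ 3 * Real.log T := by
  rcases hT.eq_or_lt with rfl | hT2
  · interval_cases n <;> simp
  · have h2 : Real.log 2 ≤ Real.log T := Real.log_le_log (by norm_num) (by exact_mod_cast hT2)
    linarith [sum_range_inv_le_one_add_log hT hn, Real.log_two_gt_d9]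

theorem sum_sqrt_le {ι : Type*} (s : Finset ι) {u : ι → ℝ} (hu : ∀ i ∈ s, 0 ≤ u i) :
    ∑ i ∈ s, √(u i) ≤ √(s.card * ∑ i ∈ s, u i) := by
  apply Real.le_sqrt_of_sq_le
  refine (sq_sum_le_card_mul_sum_sq (s := s) (f := fun i => √(u i))).trans_eq ?_
  rw [Finset.sum_congr rfl fun i hi => Real.sq_sqrt (hu i hi)]

/-- The inverse pick counts sum to at most G harmonic sums. Cauchy–Schwarz passes to their square
roots, and once more to their fourth roots. Since 0⁻¹ = 0, a first pick is charged Δ only. -/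
theorem sum_gap_le {T : ℕ} (hT : 1 ≤ T) (pick : ℕ → Fin G) {gap : Fin G → ℝ} {Δ A B D : ℝ}
    (hΔ : 0 ≤ Δ) (hA : 0 ≤ A) (hB : 0 ≤ B) (hD : 0 ≤ D)
    (h : ∀ s < T, gap (pick s) ≤ (if numPicks pick s (pick s) = 0 then Δ else 0)
      + A * √√((numPicks pick s (pick s) : ℝ)⁻¹) + B * √((numPicks pick s (pick s) : ℝ)⁻¹)
      + D * (numPicks pick s (pick s) : ℝ)⁻¹) :
    ∑ s ∈ Finset.range T, gap (pick s)
      ≤ G * Δ + A * √(T * √(T * (G * (1 + Real.log T)))) + B * √(T * (G * (1 + Real.log T)))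
        + D * (G * (3 * Real.log T)) := by
  set u : ℕ → ℝ := fun s => (numPicks pick s (pick s) : ℝ)⁻¹ with hu
  have hu0 : ∀ s, 0 ≤ u s := fun s => by positivity
  have hsum : ∀ c : ℝ, (∀ n ≤ T, ∑ k ∈ Finset.range n, (k : ℝ)⁻¹ ≤ c) →
      ∑ s ∈ Finset.range T, u s ≤ G * c := by
    intro c hc
    rw [hu, sum_comp_numPicks pick (fun k => (k : ℝ)⁻¹)]
    refine (Finset.sum_le_sum fun g _ => hc _ (numPicks_le pick T g)).trans_eq ?_
    simp
  have h1 := hsum _ fun n hn => sum_range_inv_le_one_add_log hT hn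
  have h1' := hsum _ fun n hn => sum_range_inv_le_three_mul_log hT hn
  have h2 : ∑ s ∈ Finset.range T, √(u s) ≤ √(T * (G * (1 + Real.log T))) := by
    refine (sum_sqrt_le _ fun s _ => hu0 s).trans ?_
    rw [Finset.card_range]
    gcongr
  have h4 : ∑ s ∈ Finset.range T, √√(u s) ≤ √(T * √(T * (G * (1 + Real.log T)))) := by
    refine (sum_sqrt_le _ fun s _ => Real.sqrt_nonneg _).trans ?_
    rw [Finset.card_range]
    gcongr
  have h0 : ∑ s ∈ Finset.range T, (if numPicks pick s (pick s) = 0 then Δ else 0) ≤ G * Δ := by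
    rw [sum_comp_numPicks pick (fun k => if k = 0 then Δ else 0)]
    refine (Finset.sum_le_sum (g := fun _ => Δ) fun g _ => ?_).trans_eq (by simp)
    rw [Finset.sum_ite_eq']
    split_ifs <;> simp [hΔ]
  calc ∑ s ∈ Finset.range T, gap (pick s)
      ≤ ∑ s ∈ Finset.range T, ((if numPicks pick s (pick s) = 0 then Δ else 0)
        + A * √√(u s) + B * √(u s) + D * u s) :=
        Finset.sum_le_sum fun s hs => h s (Finset.mem_range.1 hs)
    _ = ∑ s ∈ Finset.range T, (if numPicks pick s (pick s) = 0 then Δ else 0)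
        + A * ∑ s ∈ Finset.range T, √√(u s) + B * ∑ s ∈ Finset.range T, √(u s)
        + D * ∑ s ∈ Finset.range T, u s := by
        simp only [Finset.sum_add_distrib, Finset.mul_sum]
    _ ≤ _ := by gcongr

end Picks

/-! ### The gap of a picked model and the problem constants. -/

section Regret

variable {d G : ℕ}

theorem fdGap_nonneg (ν : Fin G → ℝ) (g : Fin G) : 0 ≤ fdGap ν g :=
  sub_nonneg.2 (ciInf_le (Set.finite_range ν).bddBelow g)

theorem fdGap_le_iSup (ν : Fin G → ℝ) (g : Fin G) : fdGap ν g ≤ ⨆ g', fdGap ν g' :=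
  le_ciSup (Set.finite_range (fdGap ν)).bddAbove g

theorem exists_eq_iInf (hG : 0 < G) (ν : Fin G → ℝ) : ∃ g, ν g = ⨅ g', ν g' := by
  have : Nonempty (Fin G) := ⟨⟨0, hG⟩⟩
  exact exists_eq_ciInf_of_finite

theorem rpow_one_div_four {x : ℝ} (hx : 0 ≤ x) : x ^ (1 / 4 : ℝ) = √√x := by
  rw [Real.sqrt_eq_rpow, Real.sqrt_eq_rpow, ← Real.rpow_mul hx]
  norm_num

theorem rpow_three_div_four {x : ℝ} (hx : 0 ≤ x) : x ^ (3 / 4 : ℝ) = √x * √√x := by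
  rw [← rpow_one_div_four hx, Real.sqrt_eq_rpow, ← Real.rpow_add_of_nonneg hx] <;> norm_num

theorem le_constD1 {S : Fin G → Matrix (Fin d) (Fin d) ℝ} (hS : ∀ g, (S g).PosSemidef)
    (Sr : Matrix (Fin d) (Fin d) ℝ) (g : Fin G) :
    (CFC.sqrt Sr).trace * √√(specNorm (S g) ^ 2 * (effRank (S g) + 1)) ≤ constD1 S Sr := by
  have h0 := effRank_nonneg (hS g)
  rw [← rpow_one_div_four (by positivity)]
  exact le_ciSup (f := fun g => (CFC.sqrt Sr).trace
    * (specNorm (S g) ^ 2 * (effRank (S g) + 1)) ^ (1 / 4 : ℝ)) (Set.finite_range _).bddAbove g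

theorem le_constD2 (m : Fin G → Emb d) (mr : Emb d) (S : Fin G → Matrix (Fin d) (Fin d) ℝ)
    (Sr : Matrix (Fin d) (Fin d) ℝ) (g : Fin G) :
    (‖m g - mr‖ + (CFC.sqrt Sr).trace) * √(√((S g ^ 2).trace) + specNorm (S g)) + (S g).trace
      ≤ constD2 m mr S Sr := by
  rw [Real.sqrt_eq_rpow]
  exact le_ciSup (f := fun g => (‖m g - mr‖ + (CFC.sqrt Sr).trace)
    * (√((S g ^ 2).trace) + specNorm (S g)) ^ (1 / 2 : ℝ) + (S g).trace)
    (Set.finite_range _).bddAbove g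

theorem le_constD3 (S : Fin G → Matrix (Fin d) (Fin d) ℝ) (g : Fin G) :
    √((S g ^ 2).trace) + specNorm (S g) ≤ constD3 S :=
  le_ciSup (f := fun g => √((S g ^ 2).trace) + specNorm (S g)) (Set.finite_range _).bddAbove g

/-- The burn-in samples are dropped from the count, n ≥ bk, which separates the powers of b and k.
-/
theorem errorRate_le {S : Fin G → Matrix (Fin d) (Fin d) ℝ} (hS : ∀ g, (S g).PosSemidef)
    (Sr : Matrix (Fin d) (Fin d) ℝ) (m : Fin G → Emb d) (mr : Emb d) {κ l : ℝ} (hκ : 0 ≤ κ)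
    (hl : 0 ≤ l) (g : Fin G) {N b k : ℕ} (hb : 0 < b) (hk : 0 < k) :
    errorRate κ l (m g) mr (S g) Sr (N + b * k)
      ≤ 26 * κ * l * constD1 S Sr / √√b * √√((k : ℝ)⁻¹)
        + 33 * l * constD2 m mr S Sr / √b * √((k : ℝ)⁻¹)
        + 24 * l * constD3 S / b * (k : ℝ)⁻¹ := by
  have hb' : (0 : ℝ) < b := by exact_mod_cast hb
  have hk' : (0 : ℝ) < k := by exact_mod_cast hk
  have hn : (b : ℝ) * k ≤ ((N + b * k : ℕ) : ℝ) := by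
    push_cast
    linarith [(Nat.cast_nonneg N : (0 : ℝ) ≤ N)]
  have h1 := le_constD1 hS Sr g
  have h2 := le_constD2 m mr S Sr g
  have h3 := le_constD3 S g
  have hR : 0 ≤ (CFC.sqrt Sr).trace := (CFC_sqrt_posSemidef Sr).trace_nonneg
  have hσ := specNorm_nonneg (S g)
  have htr := (hS g).trace_nonneg
  have i1 : 0 ≤ (CFC.sqrt Sr).trace * √√(specNorm (S g) ^ 2 * (effRank (S g) + 1)) := by
    positivity
  have e1 : 26 * κ * l * constD1 S Sr / √√b * √√((k : ℝ)⁻¹)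
      = 26 * κ * l * constD1 S Sr / √√(b * k) := by
    rw [Real.sqrt_inv, Real.sqrt_inv, Real.sqrt_mul hb'.le, Real.sqrt_mul (Real.sqrt_nonneg _),
      ← div_eq_mul_inv, div_div]
  have e2 : 33 * l * constD2 m mr S Sr / √b * √((k : ℝ)⁻¹)
      = 33 * l * constD2 m mr S Sr / √(b * k) := by
    rw [Real.sqrt_inv, Real.sqrt_mul hb'.le, ← div_eq_mul_inv, div_div]
  have e3 : 24 * l * constD3 S / b * (k : ℝ)⁻¹ = 24 * l * constD3 S / (b * k) := by
    rw [← div_eq_mul_inv, div_div]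
  rw [e1, e2, e3, errorRate]
  have hc1 := i1.trans h1
  have hc2 : 0 ≤ constD2 m mr S Sr := le_trans (by positivity) h2
  have hc3 : 0 ≤ constD3 S := le_trans (by positivity) h3
  gcongr

/-- The score of the picked model is at most that of the optimal model, hence at most the minimum.
Optimism is assumed for that one model only, at every sample count it can have. -/
theorem fdGap_pick_le {evalBurnIn : Bool} {κ δ : ℝ} {mr : Emb d}
    {S : Fin G → Matrix (Fin d) (Fin d) ℝ} {Sr : Matrix (Fin d) (Fin d) ℝ} {T N b : ℕ}
    {x : Fin G → ℕ → Emb d} {pick : ℕ → Fin G} {ν : Fin G → ℝ} {gs : Fin G}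
    (hrun : IsFDUCBRun evalBurnIn κ mr S Sr δ T N b x pick) (hgs : ν gs = ⨅ g, ν g)
    {s : ℕ} (hs : s < T) (hk : numPicks pick s (pick s) ≠ 0)
    (hopt : ∀ k < T, optimisticFD κ mr (S gs) Sr (δ / T) (x gs) (N + b * k) ≤ ν gs) :
    fdGap ν (pick s) ≤ ν (pick s) - optimisticFD κ mr (S (pick s)) Sr (δ / T) (x (pick s))
      (N + b * numPicks pick s (pick s)) := by
  have h := hrun s hs gs
  rw [fducbScore, if_neg (fun hc => hk hc.2), fducbScore] at h
  split_ifs at h with hc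
  -- An unpicked optimal model with score -∞ would have been preferred to the finite score of the
  -- picked one.
  · exact absurd (le_bot_iff.1 h) (EReal.coe_ne_bot _)
  · rw [EReal.coe_le_coe_iff, numSamples, numSamples] at h
    rw [fdGap, ← hgs]
    linarith [hopt _ ((numPicks_le pick s gs).trans_lt hs)]

/-- Almost everywhere measurable samples behave as measurable ones. -/
theorem exists_measurable_version {Ω : Type*} [MeasurableSpace Ω] {P : Measure Ω}
    {Y : ℕ → Ω → Emb d} {μ : Measure (Emb d)} (hY : ∀ i, HasLaw (Y i) μ P)
    (hI : iIndepFun Y P) :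
    ∃ Z : ℕ → Ω → Emb d, (∀ i, Measurable (Z i)) ∧ (∀ i, HasLaw (Z i) μ P) ∧ iIndepFun Z P ∧
      ∀ Q : (ℕ → Emb d) → Prop, P {ω | Q fun i => Y i ω} = P {ω | Q fun i => Z i ω} := by
  have hm : ∀ i, AEMeasurable (Y i) P := fun i => (hY i).aemeasurable
  have hae : ∀ i, Y i =ᵐ[P] (hm i).mk := fun i => (hm i).ae_eq_mk
  refine ⟨fun i => (hm i).mk, fun i => (hm i).measurable_mk, fun i => (hY i).congr (hae i).symm,
    hI.congr hae, fun Q => measure_congr ?_⟩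
  filter_upwards [ae_all_iff.2 hae] with ω hω
  have : (fun i => Y i ω) = fun i => (hm i).mk (Y i) ω := funext hω
  exact congrArg Q this

end Regret

/-! ### Regret on the good event, and the union bound. -/

section Main

theorem sqrt_mul_sqrt_mul_le {T G L l : ℝ} (hT : 0 ≤ T) (hG : 0 ≤ G) (hL : L ≤ l) (hl : 1 ≤ l) :
    √(T * √(T * (G * L))) ≤ l * (√√G * (√T * √√T)) := by
  have h1 : √√l ≤ l := by
    have hl' : √l ≤ l := Real.sqrt_le_left (by linarith) |>.2 (by nlinarith)
    refine (Real.sqrt_le_sqrt hl').trans hl'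
  calc √(T * √(T * (G * L))) ≤ √(T * √(T * (G * l))) := by gcongr
    _ = √T * (√√T * (√√G * √√l)) := by
        rw [Real.sqrt_mul hT, Real.sqrt_mul hT, Real.sqrt_mul (Real.sqrt_nonneg T),
          Real.sqrt_mul hG, Real.sqrt_mul (Real.sqrt_nonneg G)]
    _ ≤ √T * (√√T * (√√G * l)) := by gcongr
    _ = _ := by ring

theorem sqrt_mul_mul_le {T G L l : ℝ} (hT : 0 ≤ T) (hG : 0 ≤ G) (hL : L ≤ l) (hl : 1 ≤ l) :
    √(T * (G * L)) ≤ l * (√G * √T) := by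
  have h1 : √l ≤ l := Real.sqrt_le_left (by linarith) |>.2 (by nlinarith)
  calc √(T * (G * L)) ≤ √(T * (G * l)) := by gcongr
    _ = √T * (√G * √l) := by rw [Real.sqrt_mul hT, Real.sqrt_mul hG]
    _ ≤ √T * (√G * l) := by gcongr
    _ = _ := by ring

variable {d G : ℕ}

theorem totalRegret_le {evalBurnIn : Bool} {κ δ l : ℝ} {m : Fin G → Emb d} {mr : Emb d}
    {S : Fin G → Matrix (Fin d) (Fin d) ℝ} {Sr : Matrix (Fin d) (Fin d) ℝ} {T N b : ℕ}
    {x : Fin G → ℕ → Emb d} {pick : ℕ → Fin G} {gs : Fin G}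
    (hT : 1 ≤ T) (hb : 1 ≤ b) (hN : 1 ≤ N) (hS : ∀ g, (S g).PosSemidef) (hκ : 0 ≤ κ)
    (hl : 1 + Real.log T ≤ l)
    (hrun : IsFDUCBRun evalBurnIn κ mr S Sr δ T N b x pick)
    (hgs : frechetDist (m gs) mr (S gs) Sr = ⨅ g, frechetDist (m g) mr (S g) Sr)
    (hopt : ∀ k < T, optimisticFD κ mr (S gs) Sr (δ / T) (x gs) (N + b * k)
      ≤ frechetDist (m gs) mr (S gs) Sr)
    (herr : ∀ g, ∀ k < T, frechetDist (m g) mr (S g) Sr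
      - optimisticFD κ mr (S g) Sr (δ / T) (x g) (N + b * k)
        ≤ errorRate κ l (m g) mr (S g) Sr (N + b * k)) :
    totalRegret (fun g => frechetDist (m g) mr (S g) Sr) N T pick
      ≤ (26 * κ + 100) * l ^ 2 *
          (constD1 S Sr * (G : ℝ) ^ (1 / 4 : ℝ) / (b : ℝ) ^ (1 / 4 : ℝ) * (T : ℝ) ^ (3 / 4 : ℝ)
            + constD2 m mr S Sr * (G : ℝ) ^ (1 / 2 : ℝ) / (b : ℝ) ^ (1 / 2 : ℝ)
                * (T : ℝ) ^ (1 / 2 : ℝ)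
            + constD3 S * G / b * Real.log T
            + (⨆ g, fdGap (fun g' => frechetDist (m g') mr (S g') Sr) g) * N * G) := by
  set ν : Fin G → ℝ := fun g => frechetDist (m g) mr (S g) Sr with hν
  set Δ := ⨆ g, fdGap ν g with hΔ
  have hb' : (0 : ℝ) < b := by exact_mod_cast hb
  have hT' : (0 : ℝ) ≤ T := Nat.cast_nonneg T
  have hG' : (0 : ℝ) ≤ G := Nat.cast_nonneg G
  have hN' : (1 : ℝ) ≤ N := by exact_mod_cast hN
  have hlogT : 0 ≤ Real.log T := Real.log_nonneg (by exact_mod_cast hT)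
  have hl1 : 1 ≤ l := by linarith
  have hl0 : 0 ≤ l := by linarith
  have hR : 0 ≤ (CFC.sqrt Sr).trace := (CFC_sqrt_posSemidef Sr).trace_nonneg
  have hσ := specNorm_nonneg (S gs)
  have htr := (hS gs).trace_nonneg
  have hD1 : 0 ≤ constD1 S Sr := le_trans (by positivity) (le_constD1 hS Sr gs)
  have hD2 : 0 ≤ constD2 m mr S Sr := le_trans (by positivity) (le_constD2 m mr S Sr gs)
  have hD3 : 0 ≤ constD3 S := le_trans (by positivity) (le_constD3 S gs)
  have hΔ0 : 0 ≤ Δ := (fdGap_nonneg ν gs).trans (fdGap_le_iSup ν gs)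
  have hsteps := sum_gap_le hT pick (gap := fdGap ν) (Δ := Δ)
    (A := 26 * κ * l * constD1 S Sr / √√b) (B := 33 * l * constD2 m mr S Sr / √b)
    (D := 24 * l * constD3 S / b) hΔ0 (by positivity) (by positivity) (by positivity) ?_
  swap
  · intro s hs
    by_cases hk : numPicks pick s (pick s) = 0
    · rw [if_pos hk, hk]
      simpa using fdGap_le_iSup ν (pick s)
    · rw [if_neg hk, zero_add]
      refine (fdGap_pick_le hrun hgs hs hk hopt).trans ?_
      refine (herr (pick s) _ ((numPicks_le pick s _).trans_lt hs)).trans ?_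
      exact errorRate_le hS Sr m mr hκ hl0 (pick s) hb (Nat.pos_of_ne_zero hk)
  have hburn : (N : ℝ) * ∑ g, fdGap ν g ≤ Δ * N * G := by
    have h : ∑ g, fdGap ν g ≤ G * Δ :=
      (Finset.sum_le_sum fun g _ => fdGap_le_iSup ν g).trans_eq (by simp [hΔ])
    calc (N : ℝ) * ∑ g, fdGap ν g ≤ N * (G * Δ) := by gcongr
      _ = Δ * N * G := by ring
  -- The first picks together cost no more than the burn-in, because N ≥ 1.
  have hfirst : G * Δ ≤ Δ * N * G := by
    have := mul_le_mul_of_nonneg_left hN' (mul_nonneg hG' hΔ0)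
    linarith
  have hl2 : 1 ≤ l ^ 2 := one_le_pow₀ hl1
  have hll : l ≤ l ^ 2 := le_self_pow₀ hl1 two_ne_zero
  have t1 : 26 * κ * l * constD1 S Sr / √√b * √(T * √(T * (G * (1 + Real.log T))))
      ≤ (26 * κ + 100) * l ^ 2 * (constD1 S Sr * √√G / √√b * (√T * √√T)) := by
    calc _ ≤ 26 * κ * l * constD1 S Sr / √√b * (l * (√√G * (√T * √√T))) := by
          gcongr
          exact sqrt_mul_sqrt_mul_le hT' hG' hl hl1
      _ = 26 * κ * l ^ 2 * (constD1 S Sr * √√G / √√b * (√T * √√T)) := by ring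
      _ ≤ _ := by gcongr; linarith
  have t2 : 33 * l * constD2 m mr S Sr / √b * √(T * (G * (1 + Real.log T)))
      ≤ (26 * κ + 100) * l ^ 2 * (constD2 m mr S Sr * √G / √b * √T) := by
    calc _ ≤ 33 * l * constD2 m mr S Sr / √b * (l * (√G * √T)) := by
          gcongr
          exact sqrt_mul_mul_le hT' hG' hl hl1
      _ = 33 * l ^ 2 * (constD2 m mr S Sr * √G / √b * √T) := by ring
      _ ≤ _ := by gcongr; linarith
  have t3 : 24 * l * constD3 S / b * (G * (3 * Real.log T))
      ≤ (26 * κ + 100) * l ^ 2 * (constD3 S * G / b * Real.log T) := by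
    calc _ = 72 * l * (constD3 S * G / b * Real.log T) := by ring
      _ ≤ _ := by gcongr; linarith
  have t4 : 2 * (Δ * N * G) ≤ (26 * κ + 100) * l ^ 2 * (Δ * N * G) := by
    have : 2 ≤ (26 * κ + 100) * l ^ 2 :=
      (by linarith : (2 : ℝ) ≤ 26 * κ + 100).trans (le_mul_of_one_le_right (by positivity) hl2)
    gcongr
  rw [totalRegret, rpow_one_div_four hG', rpow_one_div_four hb'.le, rpow_three_div_four hT',
    ← Real.sqrt_eq_rpow, ← Real.sqrt_eq_rpow, ← Real.sqrt_eq_rpow]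
  linarith

/-- The bad event lies in a union over fixed models and fixed counts, so the picks may depend on ω
arbitrarily, even non-measurably. Optimism uses up 2δ/3 and the error bounds δ/3. -/
theorem measure_regret_le {Ω : Type*} [MeasurableSpace Ω] {P : Measure Ω}
    {evalBurnIn : Bool} {κ δ : ℝ} {m : Fin G → Emb d} {mr : Emb d}
    {S : Fin G → Matrix (Fin d) (Fin d) ℝ} {Sr : Matrix (Fin d) (Fin d) ℝ} {T N b : ℕ}
    {Y : Fin G → ℕ → Ω → Emb d} {pick : Ω → ℕ → Fin G} (hG : 0 < G)
    (hT : 1 ≤ T) (hb : 1 ≤ b) (hδ0 : 0 < δ) (hδ1 : δ < 1) (hS : ∀ g, (S g).PosSemidef)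
    (hSr : Sr.PosDef) (hκ : 0 < κ) (hκS : ∀ g, 0 < specNorm (S g) → 1 ≤ κ)
    (hN : ∀ g, 4 * effRank (S g) + Real.log (3 / (δ / T)) ≤ N)
    (hY : ∀ g i, HasLaw (Y g i) (multivariateGaussian (m g) (S g)) P)
    (hI : ∀ g, iIndepFun (Y g) P)
    (hrun : ∀ ω, IsFDUCBRun evalBurnIn κ mr S Sr δ T N b (fun g i => Y g i ω) (pick ω)) :
    P {ω | (26 * κ + 100) * Real.log (6 * G * T / δ) ^ 2 *
          (constD1 S Sr * (G : ℝ) ^ (1 / 4 : ℝ) / (b : ℝ) ^ (1 / 4 : ℝ) * (T : ℝ) ^ (3 / 4 : ℝ)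
            + constD2 m mr S Sr * (G : ℝ) ^ (1 / 2 : ℝ) / (b : ℝ) ^ (1 / 2 : ℝ)
                * (T : ℝ) ^ (1 / 2 : ℝ)
            + constD3 S * G / b * Real.log T
            + (⨆ g, fdGap (fun g' => frechetDist (m g') mr (S g') Sr) g) * N * G)
          < totalRegret (fun g => frechetDist (m g) mr (S g) Sr) N T (pick ω)}
      ≤ ENNReal.ofReal δ := by
  have hT1 : (1 : ℝ) ≤ T := by exact_mod_cast hT
  have hT0 : (0 : ℝ) < T := by linarith
  have hG1 : (1 : ℝ) ≤ G := by exact_mod_cast hG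
  have hG0 : (0 : ℝ) < G := by linarith
  set η := δ / T with hη
  have hη0 : 0 < η := by positivity
  have hη1 : η ≤ 1 := (div_le_one hT0).2 (by linarith)
  obtain ⟨gs, hgs⟩ := exists_eq_iInf hG fun g => frechetDist (m g) mr (S g) Sr
  have hN0 : 0 < N := by
    have h1 := hN gs
    have h2 := one_le_log_three_div hη0 hη1
    have h3 := effRank_nonneg (hS gs)
    have : (0 : ℝ) < N := by linarith
    exact_mod_cast this
  set l := Real.log (6 * G * T / δ) with hl
  have hlog2 := Real.log_two_gt_d9
  have hη6 : Real.log (6 / η) ≤ l := by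
    rw [hl, hη]
    apply Real.log_le_log (by positivity)
    rw [div_div_eq_mul_div]
    gcongr
    linarith
  have hlT : 1 + Real.log T ≤ l := by
    have h6 : 1 ≤ Real.log 6 := by
      rw [Real.le_log_iff_exp_le (by norm_num)]
      linarith [Real.exp_one_lt_d9]
    have h : Real.log (6 * T) ≤ l := by
      apply Real.log_le_log (by positivity)
      rw [le_div_iff₀ hδ0]
      calc 6 * T * δ ≤ 6 * T * 1 := by gcongr
        _ = 6 * 1 * T := by ring
        _ ≤ 6 * G * T := by gcongr
    rw [Real.log_mul (by norm_num) hT0.ne'] at h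
    linarith
  have hlogT : 0 ≤ Real.log T := Real.log_nonneg hT1
  have hlog2' : Real.log 2 ≤ 1 := by linarith [Real.log_two_lt_d9]
  -- The extra log 2 turns four events per model and count into a failure probability of exactly
  -- δ/(3GT).
  have hexp : Real.exp (-(l + Real.log 2)) = δ / (12 * G * T) := by
    rw [hl, ← Real.log_mul (by positivity) two_ne_zero, Real.exp_neg,
      Real.exp_log (by positivity)]
    field_simp
    norm_num
  set B₁ : ℕ → Set Ω := fun k => {ω | frechetDist (m gs) mr (S gs) Sr
    < optimisticFD κ mr (S gs) Sr η (fun i => Y gs i ω) (N + b * k)} with hB₁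
  set B₂ : Fin G → ℕ → Set Ω := fun g k => {ω | errorRate κ l (m g) mr (S g) Sr (N + b * k)
    < frechetDist (m g) mr (S g) Sr
      - optimisticFD κ mr (S g) Sr η (fun i => Y g i ω) (N + b * k)} with hB₂
  have h₁ : ∀ k, P (B₁ k) ≤ ENNReal.ofReal (2 * δ / (3 * T)) := by
    intro k
    obtain ⟨Z, hZm, hZ, hZI, hQ⟩ := exists_measurable_version (hY gs) (hI gs)
    rw [hB₁, hQ fun x => frechetDist (m gs) mr (S gs) Sr
      < optimisticFD κ mr (S gs) Sr η x (N + b * k)]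
    refine (measure_frechetDist_lt_optimisticFD_le hZm hZ hZI (hS gs) hSr (hκS gs) hη0 hη1
      (by omega) ((hN gs).trans ?_)).trans_eq ?_
    · push_cast
      have : (0 : ℝ) ≤ b * k := by positivity
      linarith
    · rw [show (4 : ℝ≥0∞) = ENNReal.ofReal 4 by norm_num, ← ENNReal.ofReal_mul (by norm_num), hη]
      congr 1
      field_simp
      norm_num
  have h₂ : ∀ g k, P (B₂ g k) ≤ ENNReal.ofReal (δ / (3 * G * T)) := by
    intro g k
    obtain ⟨Z, hZm, hZ, hZI, hQ⟩ := exists_measurable_version (hY g) (hI g)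
    rw [hB₂, hQ fun x => errorRate κ l (m g) mr (S g) Sr (N + b * k)
      < frechetDist (m g) mr (S g) Sr - optimisticFD κ mr (S g) Sr η x (N + b * k)]
    refine (measure_errorRate_lt_le hZm hZ hZI (hS g) hSr hκ.le hη0 hη1 hη6
      (t := l + Real.log 2) (by linarith) (by linarith) (by omega)).trans_eq ?_
    rw [hexp, show (4 : ℝ≥0∞) = ENNReal.ofReal 4 by norm_num, ← ENNReal.ofReal_mul (by norm_num)]
    congr 1
    field_simp
    norm_num
  have hsub : {ω | (26 * κ + 100) * l ^ 2 *
          (constD1 S Sr * (G : ℝ) ^ (1 / 4 : ℝ) / (b : ℝ) ^ (1 / 4 : ℝ) * (T : ℝ) ^ (3 / 4 : ℝ)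
            + constD2 m mr S Sr * (G : ℝ) ^ (1 / 2 : ℝ) / (b : ℝ) ^ (1 / 2 : ℝ)
                * (T : ℝ) ^ (1 / 2 : ℝ)
            + constD3 S * G / b * Real.log T
            + (⨆ g, fdGap (fun g' => frechetDist (m g') mr (S g') Sr) g) * N * G)
          < totalRegret (fun g => frechetDist (m g) mr (S g) Sr) N T (pick ω)}
      ⊆ (⋃ k ∈ Finset.range T, B₁ k) ∪ ⋃ g ∈ Finset.univ, ⋃ k ∈ Finset.range T, B₂ g k := by
    intro ω hω
    by_contra hc
    simp only [hB₁, hB₂, Finset.mem_range, Finset.mem_univ, Set.iUnion_true, Set.mem_union,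
      Set.mem_iUnion, Set.mem_ofPred_eq, exists_prop, not_or, not_exists, not_and, not_lt] at hc
    exact absurd (totalRegret_le hT hb hN0 hS hκ.le hlT (hrun ω) hgs hc.1 hc.2) (not_le.2 hω)
  calc _ ≤ P ((⋃ k ∈ Finset.range T, B₁ k)
        ∪ ⋃ g ∈ Finset.univ, ⋃ k ∈ Finset.range T, B₂ g k) := measure_mono hsub
    _ ≤ ∑ k ∈ Finset.range T, P (B₁ k)
        + ∑ g, ∑ k ∈ Finset.range T, P (B₂ g k) := by
        refine (measure_union_le _ _).trans (add_le_add (measure_biUnion_finset_le _ _) ?_)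
        refine (measure_biUnion_finset_le _ _).trans ?_
        exact Finset.sum_le_sum fun g _ => measure_biUnion_finset_le _ _
    _ ≤ ∑ _k ∈ Finset.range T, ENNReal.ofReal (2 * δ / (3 * T))
        + ∑ _g : Fin G, ∑ _k ∈ Finset.range T, ENNReal.ofReal (δ / (3 * G * T)) := by
        gcongr with k _ g _ k _
        · exact h₁ k
        · exact h₂ g k
    _ = ENNReal.ofReal δ := by
        simp only [Finset.sum_const, Finset.card_range, Finset.card_univ, Fintype.card_fin,
          nsmul_eq_mul]
        rw [← ENNReal.ofReal_natCast, ← ENNReal.ofReal_natCast, ← ENNReal.ofReal_mul hT0.le,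
          ← ENNReal.ofReal_mul hT0.le, ← ENNReal.ofReal_mul hG0.le,
          ← ENNReal.ofReal_add (by positivity) (by positivity)]
        congr 1
        field_simp
        norm_num

end Main

theorem theorem3 (κ : ℝ) (hκ : 0 < κ) :
    ∃ C : ℝ, 0 < C ∧ ∃ q : ℕ,
    ∀ (d G T b N : ℕ) (_hT : 1 ≤ T) (_hb : 1 ≤ b)
      (δ : ℝ) (_hδ0 : 0 < δ) (_hδ1 : δ < 1)
      -- the space of images, the generative distributions and the embedding
      (𝒳 : Type*) [MeasurableSpace 𝒳] (p : Fin G → Measure 𝒳) (f : 𝒳 → Emb d)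
      -- means and covariance matrices of the embedded models and of the embedded real data
      (m : Fin G → Emb d) (S : Fin G → Matrix (Fin d) (Fin d) ℝ)
      (mr : Emb d) (Sr : Matrix (Fin d) (Fin d) ℝ)
      (_hS : ∀ g, (S g).PosSemidef) (_hSr : Sr.PosDef)
      (_hf : ∀ g, HasLaw f (multivariateGaussian (m g) (S g)) (p g))
      -- `κ` bounds the sub-Gaussian norm of the one-dimensional projections
      (_hψ : ∀ (g : Fin G) (y : Emb d),
        psi2Norm (fun z => inner ℝ y (f z - m g)) (p g)
          ≤ ENNReal.ofReal (κ * √(inner ℝ y (Matrix.toEuclideanCLM (𝕜 := ℝ) (S g) y))))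
      -- the number of burn-in samples, for the confidence `δ / T`
      (_hN : ∀ g, 4 * effRank (S g) + Real.log (3 / (δ / T)) ≤ N)
      -- `X g i` is the `i`-th sample generated by model `g`
      (Ω : Type*) [MeasurableSpace Ω] (P : Measure Ω) [IsProbabilityMeasure P]
      (X : Fin G → ℕ → Ω → 𝒳)
      (_hX : ∀ g i, HasLaw (X g i) (p g) P)
      (_hind : ∀ g, iIndepFun (X g) P)
      -- a run of the algorithm
      (evalBurnIn : Bool) (pick : Ω → ℕ → Fin G)
      (_hrun : ∀ ω, IsFDUCBRun evalBurnIn κ mr S Sr δ T N b (fun g i => f (X g i ω)) (pick ω)),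
      P {ω |
          C * Real.log (6 * G * T / δ) ^ q *
            (constD1 S Sr * (G : ℝ) ^ (1 / 4 : ℝ) / (b : ℝ) ^ (1 / 4 : ℝ) * (T : ℝ) ^ (3 / 4 : ℝ)
              + constD2 m mr S Sr * (G : ℝ) ^ (1 / 2 : ℝ) / (b : ℝ) ^ (1 / 2 : ℝ)
                  * (T : ℝ) ^ (1 / 2 : ℝ)
              + constD3 S * G / b * Real.log T
              + (⨆ g, fdGap (fun g' => frechetDist (m g') mr (S g') Sr) g) * N * G)
            < totalRegret (fun g => frechetDist (m g) mr (S g) Sr) N T (pick ω)}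
        ≤ ENNReal.ofReal δ := by
  refine ⟨26 * κ + 100, by positivity, 2, ?_⟩
  intro d G T b N hT hb δ hδ0 hδ1 𝒳 _ p f m S mr Sr hS hSr hf hψ hN Ω _ P _ X hX hind
    evalBurnIn pick hrun
  obtain ⟨ω₀⟩ : Nonempty Ω := nonempty_of_isProbabilityMeasure P
  -- The existence of a pick at some point of the probability space rules out G = 0.
  have hG : 0 < G := (pick ω₀ 0).pos
  have hκS : ∀ g, 0 < specNorm (S g) → 1 ≤ κ := fun g =>
    one_le_of_psi2Norm_le (hS g) (hf g) hκ (hψ g)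
  have hY : ∀ g i, HasLaw (fun ω => f (X g i ω)) (multivariateGaussian (m g) (S g)) P :=
    fun g i => (hf g).comp (hX g i)
  have hI : ∀ g, iIndepFun (fun i ω => f (X g i ω)) P := fun g =>
    (hind g).comp₀ (fun _ => f) (fun i => (hX g i).aemeasurable)
      fun i => by rw [(hX g i).map_eq]; exact (hf g).aemeasurable
  exact measure_regret_le hG hT hb hδ0 hδ1 hS hSr hκ hκS hN hY hI hrun
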